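/- **Setting.** Let $\mathcal S$ be a set of states, $\mathcal A$ a finite nonempty set of actions, $H,K\ge 1$ and $T=KH$. An episodic adversarial MDP consists of a fixed initial state $s_1$, transition probabilities $\mathbb P_h(\cdot\mid s,a)$ (discrete distributions on $\mathcal S$, $h\in[H]$), and reward functions $r_h^k:\mathcal S\times\mathcal A\to[0,1]$ that an adversary chooses at the beginning of episode $k$, possibly depending on all previous episodes, and that are revealed after episode $k$ (full information). It is a $B$-bounded linear mixture MDP with (known) feature map $\phi(s'\mid s,a)\in\mathbb R^d$ if there are (unknown) $\theta_h\in\mathbb R^d$ with $\|\theta_h\|_2\le B$ and $\mathbb P_h(s'\mid s,a)=\langle\phi(s'\mid s,a),\theta_h\rangle$ for all $h,s,a,s'$, and if $\|\phi_V(s,a)\|_2\le 1$ for every $V:\mathcal S\to[0,1]$ and all $s,a$, where $\phi_V(s,a)=\sum_{s'}\phi(s'\mid s,a)V(s')$. A policy is $\pi=(\pi_h)_{h\in[H]}$ with $\pi_h:\mathcal S\to\Delta(\mathcal A)$; $V_{k,1}^\pi(s_1)$ is the expected total reward of an episode that starts in $s_1$, follows $\pi$, and is rewarded by $r^k$. If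 $\pi^k$ is the policy played in episode $k$, then $$\mathrm{Regret}(M,K)=\sup_\pi\sum_{k=1}^K\big(V_{k,1}^{\pi}(s_1)-V_{k,1}^{\pi^k}(s_1)\big).$$ **The algorithm POWER** with parameters $\lambda,\alpha$ and $\delta\in(0,1)$ (and knowing $B,H,\phi$). Let $[x]_{[0,b]}=\max\{0,\min\{x,b\}\}$, let $\pi_h^0(\cdot\mid s)$ be uniform, $Q_{0,h}=0$, $\hat\Sigma_{1,h}=\tilde\Sigma_{1,h}=\lambda I$ and $\hat b_{1,h}=\tilde b_{1,h}=0$. Put $\hat\theta_{k,h}=\hat\Sigma_{k,h}^{-1}\hat b_{k,h}$, $\tilde\theta_{k,h}=\tilde\Sigma_{k,h}^{-1}\tilde b_{k,h}$, $\ell_k=\log(4k^2H/\delta)$ and $$\hat\beta_k=8\sqrt{d\log(1+k/\lambda)\,\ell_k}+4\sqrt d\,\ell_k+\sqrt\lambda B,\qquad \bar\beta_k=8d\sqrt{\log(1+k/\lambda)\,\ell_k}+4\sqrt d\,\ell_k+\sqrt\lambda B,$$ $$\tilde\beta_k=8H^2\sqrt{d\log(1+kH^4/(d\lambda))\,\ell_k}+4H^2\ell_k+\sqrt\lambda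 B.$$ In episode $k=1,2,\dots$ the algorithm plays the policy $\pi_h^k(a\mid s)\propto\pi_h^{k-1}(a\mid s)\exp\{\alpha Q_{k-1,h}(s,a)\}$, observes $s_1^k=s_1$, $a_h^k\sim\pi_h^k(\cdot\mid s_h^k)$, $s_{h+1}^k\sim\mathbb P_h(\cdot\mid s_h^k,a_h^k)$ and the rewards $r^k$, and then, with $V_{k,H+1}=0$, for $h=H,\dots,1$ computes $$Q_{k,h}(s,a)=\Big[r_h^k(s,a)+\langle\hat\theta_{k,h},\phi_{V_{k,h+1}}(s,a)\rangle+\hat\beta_k\big\|\hat\Sigma_{k,h}^{-1/2}\phi_{V_{k,h+1}}(s,a)\big\|_2\Big]_{[0,H-h+1]},\qquad V_{k,h}(s)=\sum_a\pi_h^k(a\mid s)Q_{k,h}(s,a).$$ With $x=\phi_{V_{k,h+1}}(s_h^k,a_h^k)$ and $y=\phi_{V_{k,h+1}^2}(s_h^k,a_h^k)$ it sets $$\bar{\mathbb V}_{k,h}=[\langle y,\tilde\theta_{k,h}\rangle]_{[0,H^2]}-\big([\langle x,\hat\theta_{k,h}\rangle]_{[0,H]}\big)^2,$$ $$E_{k,h}=\min\{\tilde\beta_k\|\tilde\Sigma_{k,h}^{-1/2}y\|_2,H^2\}+\min\{2H\bar\beta_k\|\hat\Sigma_{k,h}^{-1/2}x\|_2,H^2\},\qquad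 \bar\sigma_{k,h}^2=\max\{H^2/d,\ \bar{\mathbb V}_{k,h}+E_{k,h}\},$$ $$\hat\Sigma_{k+1,h}=\hat\Sigma_{k,h}+\bar\sigma_{k,h}^{-2}xx^\top,\quad \hat b_{k+1,h}=\hat b_{k,h}+\bar\sigma_{k,h}^{-2}x\,V_{k,h+1}(s_{h+1}^k),\quad \tilde\Sigma_{k+1,h}=\tilde\Sigma_{k,h}+yy^\top,\quad \tilde b_{k+1,h}=\tilde b_{k,h}+y\,V_{k,h+1}^2(s_{h+1}^k).$$ **Theorem.** Write $\iota=\log(4K^2H/\delta)\cdot\log(1+KH^4B^2)$. (a) There are universal constants $C>0$ and $p\in\mathbb N$ such that for every $B$-bounded linear mixture MDP $M$ with adversarial rewards as above, all $\alpha>0$, all $\delta\in(0,1)$ and all $K\ge1$, POWER run with $\lambda=1/B^2$ satisfies, with probability at least $1-6\delta$, $$\mathrm{Regret}(M,K)\le C\,\iota^{p}\Big(\alpha TH^2+\alpha^{-1}H\log|\mathcal A|+\sqrt{d^2H^2T}+\sqrt{dH^3T}+d^2H^3+d^{2.5}H^{2.5}\Big).$$ (b) For all $0<c_1\le c_2$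 there are $C>0$ and $p\in\mathbb N$, depending only on $c_1,c_2$, such that in the same setting, if $c_1\sqrt{\log|\mathcal A|/(H^2K)}\le\alpha\le c_2\sqrt{\log|\mathcal A|/(H^2K)}$ and $T\ge d^3H^3$, $d\ge H$, $d\ge\log|\mathcal A|$, then with probability at least $1-6\delta$, $$\mathrm{Regret}(M,K)\le C\,\iota^{p}\,dH\sqrt T.$$ -/

import Mathlib

open scoped Matrix

universe u v

noncomputable section

namespace PowerMDP

/-- A (Markov, stage-dependent, randomized) policy: `π h s` is a distribution over actions.
Stages are `0`-based: `h : Fin H` is the stage `h + 1` of an episode of length `H`. -/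
abbrev Policy (S : Type u) (A : Type v) (H : ℕ) := Fin H → S → PMF A

/-- The states `s_1, …, s_{H+1}` and the actions `a_1, …, a_H` of one episode. -/
abbrev Trajectory (S : Type u) (A : Type v) (H : ℕ) := (Fin (H + 1) → S) × (Fin H → A)

/-- The reward functions `r_h` of one episode. -/
abbrev Reward (S : Type u) (A : Type v) (H : ℕ) := Fin H → S → A → ℝ

/-- The record of the finished episodes, the most recent one first. -/
abbrev History (S : Type u) (A : Type v) (H : ℕ) := List (Trajectory S A H)

/-- A time-inhomogeneous episodic MDP with a fixed initial state and adversarial rewards in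
`[0, 1]`. The rewards of an episode are chosen at its beginning, possibly depending on
everything that happened in the earlier episodes: `reward hs` is the reward of the episode that
follows the history `hs`. -/
structure AdversarialMDP (S : Type u) (A : Type v) (H : ℕ) where
  start : S
  trans : Fin H → S → A → PMF S
  reward : History S A H → Reward S A H
  reward_mem : ∀ hs h s a, reward hs h s a ∈ Set.Icc (0 : ℝ) 1

variable {S : Type u} {A : Type v} {H d : ℕ}

/-- Law of the first `n` steps of an episode that starts in `s₁`, follows the policy `π`, and
moves according to `P`. -/
def prefixLaw (P : Fin H → S → A → PMF S) (π : Policy S A H) (s₁ : S) :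
    (n : ℕ) → n ≤ H → PMF ((Fin (n + 1) → S) × (Fin n → A))
  | 0, _ => PMF.pure (fun _ => s₁, Fin.elim0)
  | n + 1, hn =>
    (prefixLaw P π s₁ n (Nat.le_of_succ_le hn)).bind fun τ =>
      (π ⟨n, hn⟩ (τ.1 (Fin.last n))).bind fun a =>
        (P ⟨n, hn⟩ (τ.1 (Fin.last n)) a).map fun s' =>
          (Fin.snoc (α := fun _ => S) τ.1 s', Fin.snoc (α := fun _ => A) τ.2 a)

namespace AdversarialMDP

/-- Law of one whole episode under the policy `π`. -/
def episodeLaw (M : AdversarialMDP S A H) (π : Policy S A H) : PMF (Trajectory S A H) :=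
  prefixLaw M.trans π M.start H le_rfl

/-- Value of the policy `π` from the first stage and the initial state, for the rewards `r`:
the expectation of the total reward of an episode. -/
def value (M : AdversarialMDP S A H) (r : Reward S A H) (π : Policy S A H) : ℝ :=
  ∑' τ : Trajectory S A H,
    (M.episodeLaw π τ).toReal * ∑ h : Fin H, r h (τ.1 h.castSucc) (τ.2 h)

/-- Law of the history of the first `K` episodes, when the policy of each episode is determined
from the preceding history by `alg`. -/
def historyLaw (M : AdversarialMDP S A H) (alg : History S A H → Policy S A H) :
    ℕ → PMF (History S A H)
  | 0 => PMF.pure []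
  | K + 1 => (M.historyLaw alg K).bind fun hs =>
      (M.episodeLaw (alg hs)).map fun τ => τ :: hs

/-- `∑ₖ (V_{k,1}^π(s_1) - V_{k,1}^{π^k}(s_1))` over the episodes of a history. -/
def regretAgainst (M : AdversarialMDP S A H) (alg : History S A H → Policy S A H)
    (π : Policy S A H) : History S A H → ℝ
  | [] => 0
  | _ :: hs => M.regretAgainst alg π hs +
      (M.value (M.reward hs) π - M.value (M.reward hs) (alg hs))

/-- Regret against the best fixed policy in hindsight. -/
def regret (M : AdversarialMDP S A H) (alg : History S A H → Policy S A H)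
    (hs : History S A H) : ℝ :=
  ⨆ π : Policy S A H, M.regretAgainst alg π hs

end AdversarialMDP

/-- `φ_V(s,a) = ∑_{s'} φ(s'|s,a) V(s')`, where `φ s a s'` is `φ(s'|s,a)`. -/
def featureOf (φ : S → A → S → EuclideanSpace ℝ (Fin d)) (V : S → ℝ) (s : S) (a : A) :
    EuclideanSpace ℝ (Fin d) :=
  ∑' s', V s' • φ s a s'

/-- `B`-bounded linear mixture MDP with feature map `φ`. (Applied to indicators of finite sets,
the norm condition makes the finite partial sums of `φ s a` bounded, so that the series in
`featureOf` converges absolutely for each bounded `V`.) -/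
def IsLinearMixture (M : AdversarialMDP S A H) (φ : S → A → S → EuclideanSpace ℝ (Fin d))
    (B : ℝ) : Prop :=
  (∃ θ : Fin H → EuclideanSpace ℝ (Fin d),
    (∀ h, ‖θ h‖ ≤ B) ∧
    ∀ h s a s', (M.trans h s a s').toReal = inner ℝ (φ s a s') (θ h)) ∧
  ∀ V : S → ℝ, (∀ s, V s ∈ Set.Icc (0 : ℝ) 1) → ∀ s a, ‖featureOf φ V s a‖ ≤ 1

/-! ### The algorithm POWER -/

/-- `[x]_{[0,b]}`. -/
def clip (b x : ℝ) : ℝ := max 0 (min x b)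

/-- `‖Σ^{-1/2} x‖₂ = √(xᵀ Σ⁻¹ x)`, for a positive definite matrix `Σ`. -/
def invNorm (Sig : Matrix (Fin d) (Fin d) ℝ) (x : Fin d → ℝ) : ℝ :=
  Real.sqrt (x ⬝ᵥ (Sig⁻¹ *ᵥ x))

/-- The distribution `∝ p(a) exp(α q(a))`. -/
def expWeights [Fintype A] (α : ℝ) (p : PMF A) (q : A → ℝ) : PMF A :=
  PMF.normalize (fun a => p a * ENNReal.ofReal (Real.exp (α * q a)))
    (by
      obtain ⟨a, ha⟩ := p.support_nonempty
      intro h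
      have h1 := ENNReal.tsum_eq_zero.mp h a
      rcases mul_eq_zero.mp h1 with h2 | h2
      · exact (p.mem_support_iff a).mp ha h2
      · exact absurd (ENNReal.ofReal_eq_zero.mp h2) (not_le.mpr (Real.exp_pos _)))
    (by
      rw [tsum_fintype]
      exact ENNReal.sum_ne_top.mpr fun a _ =>
        ENNReal.mul_ne_top (p.apply_ne_top a) ENNReal.ofReal_ne_top)

/-- The input of the algorithm: regularization `lam`, learning rate `α`, the bound `B` and the
confidence `δ`. -/
structure Params where
  lam : ℝ
  α : ℝ
  B : ℝ
  δ : ℝ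

/-- `log (4 k² H / δ)`. -/
def Params.logTerm (c : Params) (H k : ℕ) : ℝ := Real.log (4 * (k : ℝ) ^ 2 * H / c.δ)

/-- The radius `β̂_k`. -/
def Params.betaHat (c : Params) (d H k : ℕ) : ℝ :=
  8 * Real.sqrt (d * Real.log (1 + k / c.lam) * c.logTerm H k)
    + 4 * Real.sqrt d * c.logTerm H k + Real.sqrt c.lam * c.B

/-- The radius `β̄_k`. -/
def Params.betaBar (c : Params) (d H k : ℕ) : ℝ :=
  8 * d * Real.sqrt (Real.log (1 + k / c.lam) * c.logTerm H k)
    + 4 * Real.sqrt d * c.logTerm H k + Real.sqrt c.lam * c.B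

/-- The radius `β̃_k`. -/
def Params.betaTilde (c : Params) (d H k : ℕ) : ℝ :=
  8 * (H : ℝ) ^ 2 *
      Real.sqrt (d * Real.log (1 + k * (H : ℝ) ^ 4 / (d * c.lam)) * c.logTerm H k)
    + 4 * (H : ℝ) ^ 2 * c.logTerm H k + Real.sqrt c.lam * c.B

/-- What the algorithm remembers at the beginning of episode `k`: the policy `π^{k-1}` and the
functions `Q_{k-1,h}` of the preceding episode, and the regression data `Σ̂_{k,h}`, `b̂_{k,h}`,
`Σ̃_{k,h}`, `b̃_{k,h}`. -/
structure AlgState (S : Type u) (A : Type v) (H d : ℕ) where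
  policy : Policy S A H
  Q : Fin H → S → A → ℝ
  sigHat : Fin H → Matrix (Fin d) (Fin d) ℝ
  bHat : Fin H → Fin d → ℝ
  sigTilde : Fin H → Matrix (Fin d) (Fin d) ℝ
  bTilde : Fin H → Fin d → ℝ

namespace AlgState

/-- The state before the first episode. -/
def initial (S : Type u) (A : Type v) (H d : ℕ) [Fintype A] [Nonempty A] (c : Params) :
    AlgState S A H d where
  policy := fun _ _ => PMF.uniformOfFintype A
  Q := fun _ _ _ => 0
  sigHat := fun _ => c.lam • 1
  bHat := fun _ => 0
  sigTilde := fun _ => c.lam • 1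
  bTilde := fun _ => 0

/-- `θ̂_{k,h} = Σ̂_{k,h}⁻¹ b̂_{k,h}` (which is `0` for `k = 1`). -/
def thetaHat (st : AlgState S A H d) (h : Fin H) : Fin d → ℝ := (st.sigHat h)⁻¹ *ᵥ st.bHat h

/-- `θ̃_{k,h} = Σ̃_{k,h}⁻¹ b̃_{k,h}` (which is `0` for `k = 1`). -/
def thetaTilde (st : AlgState S A H d) (h : Fin H) : Fin d → ℝ :=
  (st.sigTilde h)⁻¹ *ᵥ st.bTilde h

variable [Fintype A] (φ : S → A → S → EuclideanSpace ℝ (Fin d)) (c : Params)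

/-- The policy `π^k` of the current episode, `π_h^k ∝ π_h^{k-1} exp(α Q_{k-1,h})`. -/
def nextPolicy (st : AlgState S A H d) : Policy S A H :=
  fun h s => expWeights c.α (st.policy h s) (st.Q h s)

/-- The optimistic backup at stage `h`: `Q_{k,h}` computed from `V = V_{k,h+1}`. The upper end
`H - h` of the clipping interval is `H - h + 1` with `1`-based stages. -/
def backup (st : AlgState S A H d) (k : ℕ) (r : Reward S A H) (h : Fin H) (V : S → ℝ)
    (s : S) (a : A) : ℝ :=
  clip ((H : ℝ) - (h : ℕ))
    (r h s a + st.thetaHat h ⬝ᵥ (featureOf φ V s a).ofLp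
      + c.betaHat d H k * invNorm (st.sigHat h) (featureOf φ V s a).ofLp)

/-- The optimistic value functions `V_{k,1}, …, V_{k,H}, V_{k,H+1} = 0` of episode `k`, computed
backwards. -/
def estV (st : AlgState S A H d) (k : ℕ) (r : Reward S A H) : Fin (H + 1) → S → ℝ :=
  Fin.reverseInduction (motive := fun _ => S → ℝ) (fun _ => 0) fun h V s =>
    ∑ a, (st.nextPolicy c h s a).toReal * st.backup φ c k r h V s a

/-- The estimated variance `[V̄_{k,h} V](s,a)` of `V = V_{k,h+1}`. -/
def estVar (st : AlgState S A H d) (h : Fin H) (V : S → ℝ) (s : S) (a : A) : ℝ :=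
  clip ((H : ℝ) ^ 2) ((featureOf φ (fun s' => V s' ^ 2) s a).ofLp ⬝ᵥ st.thetaTilde h)
    - clip H ((featureOf φ V s a).ofLp ⬝ᵥ st.thetaHat h) ^ 2

/-- The bonus `E_{k,h}`, for `V = V_{k,h+1}`. -/
def bonus (st : AlgState S A H d) (k : ℕ) (h : Fin H) (V : S → ℝ) (s : S) (a : A) : ℝ :=
  min (c.betaTilde d H k *
      invNorm (st.sigTilde h) (featureOf φ (fun s' => V s' ^ 2) s a).ofLp) ((H : ℝ) ^ 2)
    + min (2 * H * c.betaBar d H k * invNorm (st.sigHat h) (featureOf φ V s a).ofLp)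
      ((H : ℝ) ^ 2)

/-- `σ̄_{k,h}`, for `V = V_{k,h+1}`. -/
def sigmaBar (st : AlgState S A H d) (k : ℕ) (h : Fin H) (V : S → ℝ) (s : S) (a : A) : ℝ :=
  Real.sqrt (max ((H : ℝ) ^ 2 / d) (st.estVar φ h V s a + st.bonus φ c k h V s a))

/-- The state after episode `k`, in which the trajectory `τ` was observed and the rewards `r`
were revealed. -/
def update (st : AlgState S A H d) (k : ℕ) (r : Reward S A H) (τ : Trajectory S A H) :
    AlgState S A H d :=
  let V := st.estV φ c k r
  let x : Fin H → Fin d → ℝ := fun h =>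
    (featureOf φ (V h.succ) (τ.1 h.castSucc) (τ.2 h)).ofLp
  let y : Fin H → Fin d → ℝ := fun h =>
    (featureOf φ (fun s' => V h.succ s' ^ 2) (τ.1 h.castSucc) (τ.2 h)).ofLp
  let σ : Fin H → ℝ := fun h => st.sigmaBar φ c k h (V h.succ) (τ.1 h.castSucc) (τ.2 h)
  { policy := st.nextPolicy c
    Q := fun h => st.backup φ c k r h (V h.succ)
    sigHat := fun h => st.sigHat h + ((σ h) ^ 2)⁻¹ • Matrix.vecMulVec (x h) (x h)
    bHat := fun h => st.bHat h + (((σ h) ^ 2)⁻¹ * V h.succ (τ.1 h.succ)) • x h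
    sigTilde := fun h => st.sigTilde h + Matrix.vecMulVec (y h) (y h)
    bTilde := fun h => st.bTilde h + (V h.succ (τ.1 h.succ) ^ 2) • y h }

end AlgState

/-- The state of POWER after the episodes of a history, in which the rewards were given by
`reward` (each reward function is used only after its own episode). -/
def powerState [Fintype A] [Nonempty A] (φ : S → A → S → EuclideanSpace ℝ (Fin d))
    (c : Params) (reward : History S A H → Reward S A H) : History S A H → AlgState S A H d
  | [] => AlgState.initial S A H d c
  | τ :: hs => (powerState φ c reward hs).update φ c (hs.length + 1) (reward hs) τ

/-- POWER: the policy that it plays after a history. -/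
def power [Fintype A] [Nonempty A] (φ : S → A → S → EuclideanSpace ℝ (Fin d))
    (c : Params) (reward : History S A H → Reward S A H) : History S A H → Policy S A H :=
  fun hs => (powerState φ c reward hs).nextPolicy c

/-- The probability that the regret of POWER, run for `K` episodes on `M` with `λ = 1 / B²`,
learning rate `α` and confidence `δ`, is at most `b`. -/
def probRegretLe [Fintype A] [Nonempty A] (M : AdversarialMDP S A H)
    (φ : S → A → S → EuclideanSpace ℝ (Fin d)) (B α δ : ℝ) (K : ℕ) (b : ℝ) : ENNReal :=
  let alg := power φ { lam := 1 / B ^ 2, α := α, B := B, δ := δ } M.reward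
  (M.historyLaw alg K).toOuterMeasure {hs | M.regret alg hs ≤ b}

/-- The logarithmic factor, powers of which are hidden in `Õ`. -/
def logFactor (K H : ℕ) (B δ : ℝ) : ℝ :=
  Real.log (4 * (K : ℝ) ^ 2 * H / δ) * Real.log (1 + K * (H : ℝ) ^ 4 * B ^ 2)

end PowerMDP

end

/-!
# The regret of POWER

**Optimism.** Let `Vₖ`, `Qₖ` be the optimistic values that episode `k` computes. Expanding the
value of a policy along its own trajectory (`AdversarialMDP.sum_expect_drift`, the performance
difference identity) splits the regret against any fixed policy `π` into three parts:

* the advantages `⟨π - πᵏ, Qₖ⟩` under the state distribution of `π`. State by state this is the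
  regret of exponential weights with gains in `[0, H]`, at most `log |A| / α + K α H² / 8`
  (`listSum_advantage_le`, where the step is Hoeffding's lemma `PMF.log_expect_exp_le`);
* the gaps `r + P Vₖ - Qₖ` under `π`, which are nonpositive once `θ` lies in the confidence
  ellipsoid around `θ̂`;
* the gaps `Qₖ - r - P Vₖ` under `πᵏ`, at most `min (2 β̂ ‖φ_V‖_{Σ̂⁻¹}, H)` on the same event.

So `regretAgainst_le` bounds the regret by the exponential weights term plus the sum `Y` of the
conditional means of the gap bounds. That bound does not depend on `π`, and neither does the
event, which takes care of the supremum over policies.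

**Confidence sets.** The ellipsoids come from a Bernstein inequality for self-normalized vector
martingales, `prob_exists_lt_invNorm_score`: with noise of conditional variance at most `σ²` and
size at most `R`, the norm `‖∑ xᵢ ηᵢ‖_{Z⁻¹}` is, for all times at once, of the order of
`σ √d + R`, up to logarithms. The squared norm is followed step by step with the Sherman–Morrison
formula; its linear increments, truncated to the times at which the bound still holds, and its
quadratic increments are controlled by exponential supermartingales, and the sum of the potentials
`w² / (1 + w²)` by the determinant (`listSum_potential_le`). The regression for `V` is weighted by
estimated standard deviations `σ̄`, so the variance of the noise is at most one only as long as
`σ̄²` dominates the true variance. This in turn is what the two auxiliary confidence sets (for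
`V²`, and a cruder one for `V`) guarantee, and the noise of the weighted regression is multiplied
by the indicator of those two (`prob_not_confident_le`).

**Variance.** By Cauchy–Schwarz and the potential bound, the realized sum `X` of the gap bounds
satisfies `X² ≲ d² H ∑ σ̄²` (`sq_listSum_episodeGapBound_le`), and `∑ σ̄²` is at most `H²T/d`,
plus the sum of the true variances, plus the sum of the bonuses (`listSum_episodeStdSq_le`). A
telescoping form of the law of total variance gives `2H² + 2H · (mean gap bound)` for the mean
total variance of one episode (`expect_episodeVariance_le`). Multiplicative concentration passes
between the realized sums and their conditional means (`prob_listSum_mean_le`,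
`prob_listSum_le_mean`). Altogether `X² ≲ U² + U X` up to logarithms, with `U` the claimed rate
(`rateSum`), whence `Y ≲ X + H² ≲ U` (`gap_sum_le`).

The process of episodes is encoded as a random list, the most recent term first
(`ListProcess.listLaw`); "all times at once" becomes "all suffixes of the list", and all
expectations are sums against a `PMF`, so that the possibly uncountable state space needs no
measurable structure.
-/

/-! ### Expectations with respect to a discrete distribution -/

namespace PMF

open scoped ENNReal

variable {α β : Type*}

/-- The expectation `E_p[f] ∈ [0, ∞]` of an extended nonnegative function. -/
noncomputable def lexpect (p : PMF α) (f : α → ℝ≥0∞) : ℝ≥0∞ := ∑' x, p x * f x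

theorem lexpect_mono (p : PMF α) {f g : α → ℝ≥0∞} (h : ∀ x, f x ≤ g x) :
    p.lexpect f ≤ p.lexpect g :=
  ENNReal.tsum_le_tsum fun x => mul_le_mul_right (h x) _

theorem lexpect_const (p : PMF α) (c : ℝ≥0∞) : p.lexpect (fun _ => c) = c := by
  simp [lexpect, ENNReal.tsum_mul_right, p.tsum_coe]

theorem lexpect_const_mul (p : PMF α) (c : ℝ≥0∞) (f : α → ℝ≥0∞) :
    p.lexpect (fun x => c * f x) = c * p.lexpect f := by
  simp only [lexpect, ← ENNReal.tsum_mul_left]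
  exact tsum_congr fun x => by ring

theorem lexpect_pure (a : α) (f : α → ℝ≥0∞) : (PMF.pure a).lexpect f = f a := by
  rw [lexpect, tsum_eq_single a]
  · simp
  · intro b hb; simp [PMF.pure_apply, hb]

theorem lexpect_bind (p : PMF α) (q : α → PMF β) (f : β → ℝ≥0∞) :
    (p.bind q).lexpect f = p.lexpect fun x => (q x).lexpect f := by
  simp only [lexpect, PMF.bind_apply, ← ENNReal.tsum_mul_right, ← ENNReal.tsum_mul_left]
  rw [ENNReal.tsum_comm]
  exact tsum_congr fun x => tsum_congr fun y => by ring

theorem lexpect_map (p : PMF α) (g : α → β) (f : β → ℝ≥0∞) :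
    (p.map g).lexpect f = p.lexpect fun x => f (g x) := by
  rw [PMF.map, lexpect_bind]
  simp [lexpect_pure]

theorem toOuterMeasure_eq_lexpect (p : PMF α) (s : Set α) :
    p.toOuterMeasure s = p.lexpect (s.indicator 1) := by
  classical
  rw [PMF.toOuterMeasure_apply, lexpect]
  exact tsum_congr fun x => by by_cases h : x ∈ s <;> simp [h]

/-- Markov's inequality in exponential form. -/
theorem toOuterMeasure_le_exp_neg (p : PMF α) (f : α → ℝ) (t : ℝ)
    (h : p.lexpect (fun x => ENNReal.ofReal (Real.exp (f x))) ≤ 1) :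
    p.toOuterMeasure {x | t ≤ f x} ≤ ENNReal.ofReal (Real.exp (-t)) := by
  classical
  rw [toOuterMeasure_eq_lexpect]
  calc p.lexpect (Set.indicator {x | t ≤ f x} 1)
      ≤ p.lexpect fun x => ENNReal.ofReal (Real.exp (-t)) * ENNReal.ofReal (Real.exp (f x)) := by
        refine lexpect_mono p fun x => ?_
        by_cases hx : t ≤ f x
        · rw [Set.indicator_of_mem (by exact hx), ← ENNReal.ofReal_mul (Real.exp_nonneg _),
            ← Real.exp_add]
          simpa using hx
        · rw [Set.indicator_of_notMem (by exact hx)]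
          exact zero_le
    _ ≤ ENNReal.ofReal (Real.exp (-t)) := by
        rw [lexpect_const_mul]
        exact mul_le_of_le_one_right zero_le h

/-- Boundedness of a real function. It makes the series defining `PMF.expect` summable. -/
def IsBdd (f : α → ℝ) : Prop := ∃ C, ∀ x, |f x| ≤ C

namespace IsBdd

variable {f g : α → ℝ}

theorem const (c : ℝ) : IsBdd fun _ : α => c := ⟨|c|, fun _ => le_rfl⟩

theorem add (hf : IsBdd f) (hg : IsBdd g) : IsBdd fun x => f x + g x := by
  obtain ⟨C, hC⟩ := hf
  obtain ⟨D, hD⟩ := hg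
  exact ⟨C + D, fun x => (abs_add_le _ _).trans (add_le_add (hC x) (hD x))⟩

theorem neg (hf : IsBdd f) : IsBdd fun x => -f x := by
  obtain ⟨C, hC⟩ := hf
  exact ⟨C, fun x => by simpa using hC x⟩

theorem sub (hf : IsBdd f) (hg : IsBdd g) : IsBdd fun x => f x - g x := by
  simpa [sub_eq_add_neg] using hf.add hg.neg

theorem mul (hf : IsBdd f) (hg : IsBdd g) : IsBdd fun x => f x * g x := by
  obtain ⟨C, hC⟩ := hf
  obtain ⟨D, hD⟩ := hg
  exact ⟨C * D, fun x => by
    rw [abs_mul]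
    exact mul_le_mul (hC x) (hD x) (abs_nonneg _) ((abs_nonneg _).trans (hC x))⟩

theorem const_mul (hf : IsBdd f) (c : ℝ) : IsBdd fun x => c * f x := (const c).mul hf

theorem pow_two (hf : IsBdd f) : IsBdd fun x => f x ^ 2 := by
  simpa [sq] using hf.mul hf

theorem finset_sum {ι : Type*} {s : Finset ι} {F : ι → α → ℝ} (h : ∀ i ∈ s, IsBdd (F i)) :
    IsBdd fun x => ∑ i ∈ s, F i x := by
  classical
  induction s using Finset.induction_on with
  | empty => simpa using const (α := α) 0
  | insert i s hi ih =>
    simp only [Finset.sum_insert hi]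
    exact (h i (by simp)).add (ih fun j hj => h j (by simp [hj]))

theorem of_Icc {a b : ℝ} (h : ∀ x, f x ∈ Set.Icc a b) : IsBdd f :=
  ⟨max |a| |b|, fun x => abs_le_max_abs_abs (h x).1 (h x).2⟩

theorem comp (hf : IsBdd f) (k : β → α) : IsBdd fun x => f (k x) := by
  obtain ⟨C, hC⟩ := hf
  exact ⟨C, fun x => hC _⟩

theorem exp (hf : IsBdd f) : IsBdd fun x => Real.exp (f x) := by
  obtain ⟨C, hC⟩ := hf
  exact ⟨Real.exp C, fun x => by
    rw [abs_of_nonneg (Real.exp_nonneg _)]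
    exact Real.exp_le_exp.mpr ((le_abs_self _).trans (hC x))⟩

end IsBdd

/-- The expectation `E_p[f]` of a (bounded) real function. -/
noncomputable def expect (p : PMF α) (f : α → ℝ) : ℝ := ∑' x, (p x).toReal * f x

theorem summable_toReal (p : PMF α) : Summable fun x => (p x).toReal :=
  ENNReal.summable_toReal p.tsum_coe_ne_top

theorem tsum_toReal (p : PMF α) : ∑' x, (p x).toReal = 1 := by
  rw [← ENNReal.tsum_toReal_eq p.apply_ne_top, p.tsum_coe, ENNReal.toReal_one]

theorem summable_expect (p : PMF α) {f : α → ℝ} (hf : IsBdd f) :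
    Summable fun x => (p x).toReal * f x := by
  obtain ⟨C, hC⟩ := hf
  refine Summable.of_norm_bounded (p.summable_toReal.mul_right C) fun x => ?_
  rw [norm_mul, Real.norm_eq_abs, Real.norm_eq_abs, abs_of_nonneg ENNReal.toReal_nonneg]
  exact mul_le_mul_of_nonneg_left (hC x) ENNReal.toReal_nonneg

theorem expect_const (p : PMF α) (c : ℝ) : p.expect (fun _ => c) = c := by
  simp [expect, tsum_mul_right, p.tsum_toReal]

theorem expect_const_mul (p : PMF α) (c : ℝ) (f : α → ℝ) :
    p.expect (fun x => c * f x) = c * p.expect f := by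
  simp only [expect, ← tsum_mul_left]
  exact tsum_congr fun x => by ring

theorem expect_neg (p : PMF α) (f : α → ℝ) : p.expect (fun x => -f x) = -p.expect f := by
  simp [expect, tsum_neg]

theorem expect_add (p : PMF α) {f g : α → ℝ} (hf : IsBdd f) (hg : IsBdd g) :
    p.expect (fun x => f x + g x) = p.expect f + p.expect g := by
  rw [expect, expect, expect, ← (p.summable_expect hf).tsum_add (p.summable_expect hg)]
  exact tsum_congr fun x => by ring

theorem expect_sub (p : PMF α) {f g : α → ℝ} (hf : IsBdd f) (hg : IsBdd g) :
    p.expect (fun x => f x - g x) = p.expect f - p.expect g := by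
  simp only [sub_eq_add_neg]
  rw [expect_add p hf hg.neg, expect_neg]

theorem expect_finset_sum (p : PMF α) {ι : Type*} {s : Finset ι} {F : ι → α → ℝ}
    (h : ∀ i ∈ s, IsBdd (F i)) :
    p.expect (fun x => ∑ i ∈ s, F i x) = ∑ i ∈ s, p.expect (F i) := by
  classical
  induction s using Finset.induction_on with
  | empty => simpa using expect_const p 0
  | insert i s hi ih =>
    simp only [Finset.sum_insert hi]
    rw [expect_add p (h i (by simp)) (IsBdd.finset_sum fun j hj => h j (by simp [hj])),
      ih fun j hj => h j (by simp [hj])]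

theorem expect_mono (p : PMF α) {f g : α → ℝ} (hf : IsBdd f) (hg : IsBdd g)
    (h : ∀ x, f x ≤ g x) : p.expect f ≤ p.expect g :=
  (p.summable_expect hf).tsum_le_tsum
    (fun x => mul_le_mul_of_nonneg_left (h x) ENNReal.toReal_nonneg) (p.summable_expect hg)

theorem expect_nonneg (p : PMF α) {f : α → ℝ} (h : ∀ x, 0 ≤ f x) : 0 ≤ p.expect f :=
  tsum_nonneg fun x => mul_nonneg ENNReal.toReal_nonneg (h x)

theorem expect_le_of_le (p : PMF α) {f : α → ℝ} (hf : IsBdd f) {c : ℝ} (h : ∀ x, f x ≤ c) :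
    p.expect f ≤ c :=
  (expect_mono p hf (IsBdd.const c) h).trans_eq (p.expect_const c)

theorem le_expect_of_le (p : PMF α) {f : α → ℝ} (hf : IsBdd f) {c : ℝ} (h : ∀ x, c ≤ f x) :
    c ≤ p.expect f :=
  (p.expect_const c).symm.trans_le (expect_mono p (IsBdd.const c) hf h)

theorem expect_mem_Icc (p : PMF α) {f : α → ℝ} {a b : ℝ} (h : ∀ x, f x ∈ Set.Icc a b) :
    p.expect f ∈ Set.Icc a b :=
  ⟨p.le_expect_of_le (.of_Icc h) fun x => (h x).1, p.expect_le_of_le (.of_Icc h) fun x => (h x).2⟩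

theorem isBdd_expect {q : β → PMF α} {f : β → α → ℝ} {C : ℝ} (hf : ∀ y x, |f y x| ≤ C) :
    IsBdd fun y => (q y).expect (f y) :=
  .of_Icc fun y => (q y).expect_mem_Icc fun x => abs_le.mp (hf y x)

theorem lexpect_ofReal (p : PMF α) {f : α → ℝ} (hf : IsBdd f) (h : ∀ x, 0 ≤ f x) :
    p.lexpect (fun x => ENNReal.ofReal (f x)) = ENNReal.ofReal (p.expect f) := by
  rw [expect, ENNReal.ofReal_tsum_of_nonneg (fun x => mul_nonneg ENNReal.toReal_nonneg (h x))
    (p.summable_expect hf), lexpect]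
  refine tsum_congr fun x => ?_
  rw [ENNReal.ofReal_mul ENNReal.toReal_nonneg, ENNReal.ofReal_toReal (p.apply_ne_top x)]

theorem expect_bind (p : PMF α) (q : α → PMF β) {f : β → ℝ} (hf : IsBdd f) :
    (p.bind q).expect f = p.expect fun x => (q x).expect f := by
  obtain ⟨C, hC⟩ := id hf
  -- shift `f` to a nonnegative function, for which Tonelli's theorem applies
  have hg : IsBdd fun x => f x + C := hf.add (.const C)
  have hg0 : ∀ x, 0 ≤ f x + C := fun x => by linarith [neg_le_of_abs_le (hC x)]
  have hq : IsBdd fun x => (q x).expect f := isBdd_expect fun _ => hC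
  have key : (p.bind q).expect (fun x => f x + C) =
      p.expect fun x => (q x).expect fun y => f y + C := by
    have h1 := lexpect_bind p q fun x => ENNReal.ofReal (f x + C)
    have hq' : IsBdd fun x => (q x).expect fun y => f y + C := by
      obtain ⟨D, hD⟩ := hg
      exact isBdd_expect fun _ => hD
    simp only [lexpect_ofReal _ hg hg0] at h1
    rw [lexpect_ofReal _ hq' fun x => expect_nonneg _ hg0] at h1
    exact (ENNReal.ofReal_eq_ofReal_iff (expect_nonneg _ hg0)
      (expect_nonneg _ fun x => expect_nonneg _ hg0)).mp h1
  simp only [expect_add _ hf (.const C), expect_const] at key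
  rw [expect_add _ hq (.const C), expect_const] at key
  linarith

theorem expect_pure (a : α) (f : α → ℝ) : (PMF.pure a).expect f = f a := by
  rw [expect, tsum_eq_single a]
  · simp
  · intro b hb; simp [PMF.pure_apply, hb]

theorem expect_map (p : PMF α) (g : α → β) {f : β → ℝ} (hf : IsBdd f) :
    (p.map g).expect f = p.expect fun x => f (g x) := by
  rw [PMF.map, expect_bind _ _ hf]
  simp [expect_pure]

theorem expect_fintype [Fintype α] (p : PMF α) (f : α → ℝ) :
    p.expect f = ∑ x, (p x).toReal * f x := tsum_fintype _

/-- The variance of a bounded function, as the second moment minus the squared mean. -/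
noncomputable def variance (p : PMF α) (f : α → ℝ) : ℝ :=
  p.expect (fun x => f x ^ 2) - p.expect f ^ 2

theorem expect_sub_sq (p : PMF α) {f : α → ℝ} (hf : IsBdd f) (c : ℝ) :
    p.expect (fun x => (f x - c) ^ 2) =
      p.expect (fun x => f x ^ 2) - 2 * c * p.expect f + c ^ 2 := by
  have h : (fun x => (f x - c) ^ 2) = fun x => (f x ^ 2 - 2 * c * f x) + c ^ 2 := by
    funext x; ring
  rw [h, expect_add _ (hf.pow_two.sub (hf.const_mul _)) (.const _),
    expect_sub _ hf.pow_two (hf.const_mul _), expect_const_mul, expect_const]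

theorem expect_sub_mean_sq (p : PMF α) {f : α → ℝ} (hf : IsBdd f) :
    p.expect (fun x => (f x - p.expect f) ^ 2) = p.variance f := by
  rw [expect_sub_sq p hf, variance]; ring

theorem variance_nonneg (p : PMF α) {f : α → ℝ} (hf : IsBdd f) : 0 ≤ p.variance f := by
  rw [← expect_sub_mean_sq p hf]
  exact expect_nonneg _ fun x => sq_nonneg _

theorem sq_expect_le (p : PMF α) {f : α → ℝ} (hf : IsBdd f) :
    p.expect f ^ 2 ≤ p.expect fun x => f x ^ 2 := by
  have := p.variance_nonneg hf
  rw [variance] at this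
  linarith

/-- Bernstein's bound for the exponential moment of a small centered random variable. -/
theorem lexpect_exp_le_one_of_centered (p : PMF α) {f : α → ℝ} {v : ℝ} (hf : ∀ x, |f x| ≤ 1)
    (h0 : p.expect f = 0) (h2 : p.expect (fun x => f x ^ 2) ≤ v) :
    p.lexpect (fun x => ENNReal.ofReal (Real.exp (f x - v))) ≤ 1 := by
  have hb : IsBdd f := ⟨1, hf⟩
  have hb' : IsBdd fun x => Real.exp (f x) := hb.exp
  have h1 : p.expect (fun x => Real.exp (f x)) ≤ 1 + v := by
    have h3 : p.expect (fun x => Real.exp (f x)) ≤ p.expect fun x => (1 + f x) + f x ^ 2 :=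
      expect_mono p hb' (((IsBdd.const 1).add hb).add hb.pow_two) fun x => by
        have := (abs_le.mp (Real.abs_exp_sub_one_sub_id_le (hf x))).2
        linarith
    rw [expect_add _ ((IsBdd.const 1).add hb) hb.pow_two, expect_add _ (.const 1) hb,
      expect_const, h0] at h3
    linarith
  rw [lexpect_ofReal _ (hb.sub (.const v)).exp fun x => Real.exp_nonneg _]
  simp only [sub_eq_add_neg, Real.exp_add]
  simp only [mul_comm _ (Real.exp (-v)), expect_const_mul]
  rw [← ENNReal.ofReal_one]
  refine ENNReal.ofReal_le_ofReal ?_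
  calc Real.exp (-v) * p.expect (fun x => Real.exp (f x)) ≤ Real.exp (-v) * Real.exp v := by
        refine mul_le_mul_of_nonneg_left (h1.trans ?_) (Real.exp_nonneg _)
        linarith [Real.add_one_le_exp v]
    _ = 1 := by rw [← Real.exp_add]; simp

/-- A nonnegative random variable exceeds twice its mean only with a small exponential moment. -/
theorem lexpect_exp_sub_two_mul_le_one (p : PMF α) {f : α → ℝ} {m : ℝ}
    (hf : ∀ x, f x ∈ Set.Icc (0 : ℝ) 1) (hm : p.expect f ≤ m) :
    p.lexpect (fun x => ENNReal.ofReal (Real.exp (f x - 2 * m))) ≤ 1 := by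
  have hb : IsBdd f := .of_Icc hf
  have h1 : p.expect (fun x => Real.exp (f x)) ≤ 1 + 2 * m := by
    have h3 : p.expect (fun x => Real.exp (f x)) ≤ p.expect fun x => 1 + 2 * f x :=
      expect_mono p hb.exp ((IsBdd.const 1).add (hb.const_mul 2)) fun x => by
        have h0 := hf x
        have := (abs_le.mp (Real.abs_exp_sub_one_sub_id_le
          (abs_le.mpr ⟨by linarith [h0.1], h0.2⟩))).2
        nlinarith [h0.1, h0.2]
    rw [expect_add _ (.const 1) (hb.const_mul 2), expect_const_mul, expect_const] at h3
    linarith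
  rw [lexpect_ofReal _ (hb.sub (.const _)).exp fun x => Real.exp_nonneg _]
  simp only [sub_eq_add_neg, Real.exp_add]
  simp only [mul_comm _ (Real.exp (-(2 * m))), expect_const_mul]
  rw [← ENNReal.ofReal_one]
  refine ENNReal.ofReal_le_ofReal ?_
  calc Real.exp (-(2 * m)) * p.expect (fun x => Real.exp (f x))
      ≤ Real.exp (-(2 * m)) * Real.exp (2 * m) := by
        refine mul_le_mul_of_nonneg_left (h1.trans ?_) (Real.exp_nonneg _)
        linarith [Real.add_one_le_exp (2 * m)]
    _ = 1 := by rw [← Real.exp_add]; simp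

/-- A nonnegative random variable falls below half of its mean only with a small exponential
moment. -/
theorem lexpect_exp_half_sub_le_one (p : PMF α) {f : α → ℝ} {m : ℝ}
    (hf : ∀ x, f x ∈ Set.Icc (0 : ℝ) (1 / 2)) (hm : m ≤ p.expect f) :
    p.lexpect (fun x => ENNReal.ofReal (Real.exp (m / 2 - f x))) ≤ 1 := by
  have hb : IsBdd f := .of_Icc hf
  have h1 : p.expect (fun x => Real.exp (-f x)) ≤ 1 - m / 2 := by
    have h3 : p.expect (fun x => Real.exp (-f x)) ≤ p.expect fun x => 1 - 2⁻¹ * f x :=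
      expect_mono p hb.neg.exp ((IsBdd.const 1).sub (hb.const_mul _)) fun x => by
        have h0 := hf x
        have := (abs_le.mp (Real.abs_exp_sub_one_sub_id_le (x := -f x)
          (abs_le.mpr ⟨by linarith [h0.2], by linarith [h0.1]⟩))).2
        nlinarith [h0.1, h0.2]
    rw [expect_sub _ (.const 1) (hb.const_mul _), expect_const_mul, expect_const] at h3
    linarith
  rw [lexpect_ofReal _ ((IsBdd.const _).sub hb).exp fun x => Real.exp_nonneg _]
  simp only [sub_eq_add_neg, Real.exp_add, expect_const_mul]
  rw [← ENNReal.ofReal_one]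
  refine ENNReal.ofReal_le_ofReal ?_
  calc Real.exp (m / 2) * p.expect (fun x => Real.exp (-f x))
      ≤ Real.exp (m / 2) * Real.exp (-(m / 2)) := by
        refine mul_le_mul_of_nonneg_left (h1.trans ?_) (Real.exp_nonneg _)
        linarith [Real.add_one_le_exp (-(m / 2))]
    _ = 1 := by rw [← Real.exp_add]; simp

end PMF

/-! ### Processes as random lists -/

namespace ListProcess

open scoped ENNReal

variable {E : Type*}

/-- The law of the first `n` terms (the most recent one first) of a process, in which the
conditional law of a term given the preceding ones `hs` is `law hs`. -/
noncomputable def listLaw (law : List E → PMF E) : ℕ → PMF (List E)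
  | 0 => PMF.pure []
  | n + 1 => (listLaw law n).bind fun hs => (law hs).map fun e => e :: hs

/-- The sum of `g hs e` over the terms `e` of a list, where `hs` is what precedes `e`. -/
def listSum (g : List E → E → ℝ) : List E → ℝ
  | [] => 0
  | e :: hs => listSum g hs + g hs e

section listSum

variable {f g : List E → E → ℝ}

theorem listSum_add (f g : List E → E → ℝ) (hs : List E) :
    listSum (fun l e => f l e + g l e) hs = listSum f hs + listSum g hs := by
  induction hs with
  | nil => simp [listSum]
  | cons e hs ih => simp only [listSum, ih]; ring

theorem listSum_const_mul (c : ℝ) (f : List E → E → ℝ) (hs : List E) :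
    listSum (fun l e => c * f l e) hs = c * listSum f hs := by
  induction hs with
  | nil => simp [listSum]
  | cons e hs ih => simp only [listSum, ih]; ring

theorem listSum_sub (f g : List E → E → ℝ) (hs : List E) :
    listSum (fun l e => f l e - g l e) hs = listSum f hs - listSum g hs := by
  induction hs with
  | nil => simp [listSum]
  | cons e hs ih => simp only [listSum, ih]; ring

theorem listSum_const (c : ℝ) (hs : List E) :
    listSum (fun _ _ => c) hs = hs.length * c := by
  induction hs with
  | nil => simp [listSum]
  | cons e hs ih => simp only [listSum, ih, List.length_cons]; push_cast; ring

theorem listSum_finset_sum {ι : Type*} (s : Finset ι) (F : ι → List E → E → ℝ) (hs : List E) :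
    listSum (fun l e => ∑ i ∈ s, F i l e) hs = ∑ i ∈ s, listSum (F i) hs := by
  induction hs with
  | nil => simp [listSum]
  | cons e hs ih => simp only [listSum, ih, Finset.sum_add_distrib]

theorem listSum_mono_of_suffix {hs : List E}
    (h : ∀ e l, (e :: l) <:+ hs → f l e ≤ g l e) : listSum f hs ≤ listSum g hs := by
  induction hs with
  | nil => exact le_rfl
  | cons e hs ih =>
    exact add_le_add (ih fun e' l hl => h e' l (hl.trans (List.suffix_cons _ _)))
      (h e hs List.suffix_rfl)

theorem listSum_mono (h : ∀ l e, f l e ≤ g l e) (hs : List E) : listSum f hs ≤ listSum g hs :=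
  listSum_mono_of_suffix fun e l _ => h l e

theorem listSum_nonneg (h : ∀ l e, 0 ≤ f l e) (hs : List E) : 0 ≤ listSum f hs := by
  have := listSum_mono (f := fun _ _ => 0) h hs
  simpa [listSum_const] using this

theorem listSum_congr_of_suffix {hs : List E}
    (h : ∀ e l, (e :: l) <:+ hs → f l e = g l e) : listSum f hs = listSum g hs :=
  le_antisymm (listSum_mono_of_suffix fun e l hl => (h e l hl).le)
    (listSum_mono_of_suffix fun e l hl => (h e l hl).ge)

/-- Cauchy–Schwarz for sums over the terms of a list and a finite index set. -/
theorem listSum_mul_sq_le {ι : Type*} (s : Finset ι) (a b : ι → List E → E → ℝ) (hs : List E) :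
    listSum (fun l e => ∑ i ∈ s, a i l e * b i l e) hs ^ 2 ≤
      listSum (fun l e => ∑ i ∈ s, a i l e ^ 2) hs *
        listSum (fun l e => ∑ i ∈ s, b i l e ^ 2) hs := by
  have h : ∀ x : ℝ, 0 ≤ listSum (fun l e => ∑ i ∈ s, a i l e ^ 2) hs * (x * x)
      + (2 * listSum (fun l e => ∑ i ∈ s, a i l e * b i l e) hs) * x
      + listSum (fun l e => ∑ i ∈ s, b i l e ^ 2) hs := by
    intro x
    have h1 : 0 ≤ listSum (fun l e => ∑ i ∈ s, (a i l e * x + b i l e) ^ 2) hs :=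
      listSum_nonneg (fun l e => Finset.sum_nonneg fun i _ => sq_nonneg _) hs
    have h2 : (fun (l : List E) (e : E) => ∑ i ∈ s, (a i l e * x + b i l e) ^ 2) = fun l e =>
        ((x * x) * ∑ i ∈ s, a i l e ^ 2 + (2 * x) * ∑ i ∈ s, a i l e * b i l e)
          + ∑ i ∈ s, b i l e ^ 2 := by
      funext l e
      simp only [Finset.mul_sum, ← Finset.sum_add_distrib]
      exact Finset.sum_congr rfl fun i _ => by ring
    rw [h2, listSum_add, listSum_add, listSum_const_mul, listSum_const_mul] at h1
    linarith
  have := discrim_le_zero h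
  rw [discrim] at this
  linarith

end listSum

variable {law : List E → PMF E}

theorem length_of_mem_support_listLaw {n : ℕ} {hs : List E}
    (h : hs ∈ (listLaw law n).support) : hs.length = n := by
  induction n generalizing hs with
  | zero =>
    simp only [listLaw, PMF.support_pure, Set.mem_singleton_iff] at h
    simp [h]
  | succ n ih =>
    simp only [listLaw, PMF.mem_support_bind_iff, PMF.mem_support_map_iff] at h
    obtain ⟨l, hl, e, -, rfl⟩ := h
    simp [ih hl]

theorem lexpect_exp_listSum_le_one {g : List E → E → ℝ}
    (h : ∀ l, (law l).lexpect (fun e => ENNReal.ofReal (Real.exp (g l e))) ≤ 1) (n : ℕ) :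
    (listLaw law n).lexpect (fun l => ENNReal.ofReal (Real.exp (listSum g l))) ≤ 1 := by
  induction n with
  | zero => simp [listLaw, PMF.lexpect_pure, listSum]
  | succ n ih =>
    rw [listLaw, PMF.lexpect_bind]
    refine le_trans (PMF.lexpect_mono _ fun l => ?_) ih
    rw [PMF.lexpect_map]
    simp only [listSum, Real.exp_add, ENNReal.ofReal_mul (Real.exp_nonneg _)]
    rw [PMF.lexpect_const_mul]
    exact mul_le_of_le_one_right zero_le (h l)

/-- The maximal deviation bound of an exponential supermartingale, at a fixed time. -/
theorem prob_le_listSum {g : List E → E → ℝ}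
    (h : ∀ l, (law l).lexpect (fun e => ENNReal.ofReal (Real.exp (g l e))) ≤ 1) (n : ℕ) (t : ℝ) :
    (listLaw law n).toOuterMeasure {l | t ≤ listSum g l} ≤ ENNReal.ofReal (Real.exp (-t)) :=
  PMF.toOuterMeasure_le_exp_neg _ _ _ (lexpect_exp_listSum_le_one h n)

/-- Union bound over the times `1, …, n`. -/
theorem prob_exists_suffix_le {Bad : List E → Prop} {ε : ℕ → ℝ≥0∞}
    (n : ℕ) (h : ∀ t < n, (listLaw law (t + 1)).toOuterMeasure {l | Bad l} ≤ ε (t + 1)) :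
    (listLaw law n).toOuterMeasure {l | ∃ l', l' <:+ l ∧ l' ≠ [] ∧ Bad l'} ≤
      ∑ t ∈ Finset.range n, ε (t + 1) := by
  induction n with
  | zero =>
    refine le_of_eq_of_le ?_ zero_le
    rw [PMF.toOuterMeasure_apply_eq_zero_iff]
    simp only [listLaw, PMF.support_pure, Set.disjoint_singleton_left, Set.mem_ofPred_eq,
      not_exists, not_and]
    intro l hl hne
    exact absurd (List.suffix_nil.mp hl) hne
  | succ n ih =>
    have hsub : ({l | ∃ l', l' <:+ l ∧ l' ≠ [] ∧ Bad l'} : Set (List E)) ⊆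
        {l | Bad l} ∪ {l | ∃ l', l' <:+ l.tail ∧ l' ≠ [] ∧ Bad l'} := by
      rintro l ⟨l', hl, hne, hb⟩
      rcases l with _ | ⟨e, l⟩
      · exact absurd (List.suffix_nil.mp hl) hne
      · rcases List.suffix_cons_iff.mp hl with rfl | hl
        · exact Or.inl hb
        · exact Or.inr ⟨l', hl, hne, hb⟩
    refine (MeasureTheory.measure_mono hsub).trans ((MeasureTheory.measure_union_le _ _).trans ?_)
    rw [Finset.sum_range_succ, add_comm]
    refine add_le_add ?_ (h n (Nat.lt_succ_self n))
    refine le_trans (le_of_eq ?_) (ih fun t ht => h t (ht.trans (Nat.lt_succ_self n)))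
    rw [PMF.toOuterMeasure_eq_lexpect, PMF.toOuterMeasure_eq_lexpect, listLaw, PMF.lexpect_bind]
    congr 1
    funext l
    rw [PMF.lexpect_map]
    refine Eq.trans ?_ (PMF.lexpect_const (law l) _)
    rfl

/-- If the sums of a nonnegative process are small, then so are the sums of its conditional
means. -/
theorem prob_listSum_mean_le {g : List E → E → ℝ} {m : List E → ℝ} {M : ℝ} (hM : 0 < M)
    (hg : ∀ l e, g l e ∈ Set.Icc 0 M) (hm : ∀ l, m l ≤ (law l).expect (g l))
    (n : ℕ) (t : ℝ) :
    (listLaw law n).toOuterMeasure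
      {l | 2 * listSum g l + 4 * M * t ≤ listSum (fun l _ => m l) l} ≤
        ENNReal.ofReal (Real.exp (-t)) := by
  have hs : ∀ l, (law l).lexpect (fun e => ENNReal.ofReal (Real.exp
      ((2 * M)⁻¹ * m l / 2 - (2 * M)⁻¹ * g l e))) ≤ 1 := fun l => by
    refine PMF.lexpect_exp_half_sub_le_one _ (fun e => ⟨?_, ?_⟩) ?_
    · exact mul_nonneg (by positivity) (hg l e).1
    · calc (2 * M)⁻¹ * g l e ≤ (2 * M)⁻¹ * M :=
            mul_le_mul_of_nonneg_left (hg l e).2 (by positivity)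
        _ = 1 / 2 := by field_simp
    · rw [PMF.expect_const_mul]
      exact mul_le_mul_of_nonneg_left (hm l) (by positivity)
  refine le_trans (MeasureTheory.measure_mono fun l hl => ?_) (prob_le_listSum hs n t)
  simp only [Set.mem_ofPred_eq] at hl ⊢
  have h1 : listSum (fun l e => (2 * M)⁻¹ * m l / 2 - (2 * M)⁻¹ * g l e) l =
      (4 * M)⁻¹ * (listSum (fun l _ => m l) l - 2 * listSum g l) := by
    rw [listSum_sub, listSum_const_mul]
    have : (fun (l : List E) (_ : E) => (2 * M)⁻¹ * m l / 2) =
        fun l _ => (4 * M)⁻¹ * m l := by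
      funext l e; field_simp; ring
    rw [this, listSum_const_mul]
    field_simp; ring
  rw [h1, inv_mul_eq_div, le_div_iff₀ (by positivity)]
  linarith

/-- If the sums of the conditional means of a nonnegative process are small, then so are its
sums. -/
theorem prob_listSum_le_mean {g : List E → E → ℝ} {m : List E → ℝ} {M : ℝ} (hM : 0 < M)
    (hg : ∀ l e, g l e ∈ Set.Icc 0 M) (hm : ∀ l, (law l).expect (g l) ≤ m l)
    (n : ℕ) (t : ℝ) :
    (listLaw law n).toOuterMeasure
      {l | 2 * listSum (fun l _ => m l) l + M * t ≤ listSum g l} ≤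
        ENNReal.ofReal (Real.exp (-t)) := by
  have hs : ∀ l, (law l).lexpect (fun e => ENNReal.ofReal (Real.exp
      (M⁻¹ * g l e - 2 * (M⁻¹ * m l)))) ≤ 1 := fun l => by
    refine PMF.lexpect_exp_sub_two_mul_le_one _ (fun e => ⟨?_, ?_⟩) ?_
    · exact mul_nonneg (by positivity) (hg l e).1
    · calc M⁻¹ * g l e ≤ M⁻¹ * M := mul_le_mul_of_nonneg_left (hg l e).2 (by positivity)
        _ = 1 := inv_mul_cancel₀ hM.ne'
    · rw [PMF.expect_const_mul]
      exact mul_le_mul_of_nonneg_left (hm l) (by positivity)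
  refine le_trans (MeasureTheory.measure_mono fun l hl => ?_) (prob_le_listSum hs n t)
  simp only [Set.mem_ofPred_eq] at hl ⊢
  have h1 : listSum (fun l e => M⁻¹ * g l e - 2 * (M⁻¹ * m l)) l =
      M⁻¹ * (listSum g l - 2 * listSum (fun l _ => m l) l) := by
    rw [listSum_sub, listSum_const_mul, listSum_const_mul, listSum_const_mul]
    ring
  rw [h1, inv_mul_eq_div, le_div_iff₀ hM]
  linarith

end ListProcess

/-! ### Rank-one updates and the elliptical potential -/

namespace Matrix

variable {d : ℕ} {Z : Matrix (Fin d) (Fin d) ℝ}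

theorem PosDef.inv_dotProduct_comm (hZ : Z.PosDef) (x y : Fin d → ℝ) :
    x ⬝ᵥ (Z⁻¹ *ᵥ y) = y ⬝ᵥ (Z⁻¹ *ᵥ x) := by
  have hT : (Z⁻¹)ᵀ = Z⁻¹ := by simpa [Matrix.IsHermitian] using hZ.inv.isHermitian
  rw [dotProduct_mulVec, ← mulVec_transpose, hT, dotProduct_comm]

theorem PosDef.inv_dotProduct_self_nonneg (hZ : Z.PosDef) (x : Fin d → ℝ) :
    0 ≤ x ⬝ᵥ (Z⁻¹ *ᵥ x) := by
  simpa using hZ.inv.posSemidef.dotProduct_mulVec_nonneg x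

theorem PosDef.inv_dotProduct_sq_le (hZ : Z.PosDef) (x y : Fin d → ℝ) :
    (x ⬝ᵥ (Z⁻¹ *ᵥ y)) ^ 2 ≤ (x ⬝ᵥ (Z⁻¹ *ᵥ x)) * (y ⬝ᵥ (Z⁻¹ *ᵥ y)) := by
  have h : ∀ t : ℝ, 0 ≤ (y ⬝ᵥ (Z⁻¹ *ᵥ y)) * (t * t) + (2 * (x ⬝ᵥ (Z⁻¹ *ᵥ y))) * t
      + x ⬝ᵥ (Z⁻¹ *ᵥ x) := by
    intro t
    have h1 := hZ.inv_dotProduct_self_nonneg (t • y + x)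
    have h2 := hZ.inv_dotProduct_comm y x
    simp only [mulVec_add, mulVec_smul, dotProduct_add, add_dotProduct, smul_dotProduct,
      dotProduct_smul, smul_eq_mul] at h1
    rw [h2] at h1
    linarith
  have := discrim_le_zero h
  rw [discrim] at this
  nlinarith

theorem PosDef.add_vecMulVec_self (hZ : Z.PosDef) (x : Fin d → ℝ) :
    (Z + vecMulVec x x).PosDef :=
  hZ.add_posSemidef (by simpa using posSemidef_vecMulVec_self_star x)

theorem PosDef.isUnit_det (hZ : Z.PosDef) : IsUnit Z.det := hZ.det_pos.ne'.isUnit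

/-- The Sherman–Morrison formula. -/
theorem PosDef.inv_add_vecMulVec_self (hZ : Z.PosDef) (x : Fin d → ℝ) :
    (Z + vecMulVec x x)⁻¹ =
      Z⁻¹ - (1 + x ⬝ᵥ (Z⁻¹ *ᵥ x))⁻¹ • vecMulVec (Z⁻¹ *ᵥ x) (Z⁻¹ *ᵥ x) := by
  have hT : (Z⁻¹)ᵀ = Z⁻¹ := by simpa [Matrix.IsHermitian] using hZ.inv.isHermitian
  have hw := hZ.inv_dotProduct_self_nonneg x
  set w := x ⬝ᵥ (Z⁻¹ *ᵥ x) with hw_def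
  have h1 : x ᵥ* Z⁻¹ = Z⁻¹ *ᵥ x := by rw [← mulVec_transpose, hT]
  refine inv_eq_right_inv ?_
  rw [mul_sub, add_mul, mul_nonsing_inv _ hZ.isUnit_det, vecMulVec_mul, h1, mul_smul_comm, add_mul,
    mul_vecMulVec, mulVec_mulVec, mul_nonsing_inv _ hZ.isUnit_det, one_mulVec,
    vecMulVec_mul_vecMulVec, vecMulVec_smul, ← hw_def]
  have h2 : vecMulVec x (Z⁻¹ *ᵥ x) + w • vecMulVec x (Z⁻¹ *ᵥ x) =
      (1 + w) • vecMulVec x (Z⁻¹ *ᵥ x) := by rw [add_smul, one_smul]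
  rw [h2, smul_smul, inv_mul_cancel₀ (by positivity), one_smul]
  abel

/-- The growth of the self-normalized square norm of a martingale in one step. -/
theorem PosDef.inv_add_vecMulVec_self_dotProduct_le (hZ : Z.PosDef) (x v : Fin d → ℝ) (η : ℝ) :
    (v + η • x) ⬝ᵥ ((Z + vecMulVec x x)⁻¹ *ᵥ (v + η • x)) ≤
      v ⬝ᵥ (Z⁻¹ *ᵥ v) + 2 * η * (x ⬝ᵥ (Z⁻¹ *ᵥ v)) / (1 + x ⬝ᵥ (Z⁻¹ *ᵥ x))
        + η ^ 2 * ((x ⬝ᵥ (Z⁻¹ *ᵥ x)) / (1 + x ⬝ᵥ (Z⁻¹ *ᵥ x))) := by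
  have hw := hZ.inv_dotProduct_self_nonneg x
  have hT : (Z⁻¹)ᵀ = Z⁻¹ := by simpa [Matrix.IsHermitian] using hZ.inv.isHermitian
  have h3 : ∀ y, (Z⁻¹ *ᵥ x) ⬝ᵥ y = x ⬝ᵥ (Z⁻¹ *ᵥ y) := fun y => by
    rw [dotProduct_mulVec x, ← mulVec_transpose, hT]
  have h4 := hZ.inv_dotProduct_comm v x
  rw [hZ.inv_add_vecMulVec_self]
  simp only [sub_mulVec, smul_mulVec, vecMulVec_mulVec, mulVec_add, mulVec_smul, dotProduct_add,
    add_dotProduct, smul_dotProduct, dotProduct_smul, dotProduct_sub, smul_eq_mul, h3, h4,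
    op_smul_eq_smul]
  set w := x ⬝ᵥ (Z⁻¹ *ᵥ x)
  set c := x ⬝ᵥ (Z⁻¹ *ᵥ v)
  set a := v ⬝ᵥ (Z⁻¹ *ᵥ v)
  have h5 : 0 ≤ c ^ 2 / (1 + w) := by positivity
  have h6 : a + 2 * η * c / (1 + w) + η ^ 2 * (w / (1 + w)) - c ^ 2 / (1 + w) =
      a + 2 * η * c + η ^ 2 * w - (1 + w)⁻¹ * (c + η * w) ^ 2 := by
    field_simp
    ring
  nlinarith

theorem PosDef.det_add_vecMulVec_self (hZ : Z.PosDef) (x : Fin d → ℝ) :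
    (Z + vecMulVec x x).det = Z.det * (1 + x ⬝ᵥ (Z⁻¹ *ᵥ x)) := by
  rw [vecMulVec_eq Unit, det_add_replicateCol_mul_replicateRow hZ.isUnit_det]
  congr 1
  rw [det_unique]
  simp [Matrix.mul_apply, dotProduct, mulVec, Finset.sum_mul, Finset.mul_sum]
  rw [Finset.sum_comm]
  exact Finset.sum_congr rfl fun i _ => Finset.sum_congr rfl fun j _ => by ring

/-- The inequality of arithmetic and geometric means for the eigenvalues. -/
theorem PosDef.log_det_le (hZ : Z.PosDef) (hd : 0 < d) :
    Real.log Z.det ≤ d * Real.log (Z.trace / d) := by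
  have : Nonempty (Fin d) := ⟨⟨0, hd⟩⟩
  have hc : 0 < Z.trace / d := by
    have := hZ.trace_pos
    positivity
  set c := Z.trace / d with hc_def
  have h1 : Real.log Z.det = ∑ i, Real.log (hZ.1.eigenvalues i) := by
    rw [hZ.1.det_eq_prod_eigenvalues]
    simp only [RCLike.ofReal_real_eq_id, id_eq]
    exact Real.log_prod fun i _ => (hZ.eigenvalues_pos i).ne'
  have h2 : Z.trace = ∑ i, hZ.1.eigenvalues i := by
    rw [hZ.1.trace_eq_sum_eigenvalues]; simp
  rw [h1]
  calc ∑ i, Real.log (hZ.1.eigenvalues i)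
      ≤ ∑ i, (hZ.1.eigenvalues i / c - 1 + Real.log c) := by
        refine Finset.sum_le_sum fun i _ => ?_
        have h3 := Real.log_le_sub_one_of_pos (div_pos (hZ.eigenvalues_pos i) hc)
        rw [Real.log_div (hZ.eigenvalues_pos i).ne' hc.ne'] at h3
        linarith
    _ = d * Real.log c := by
        rw [Finset.sum_add_distrib, Finset.sum_sub_distrib, ← Finset.sum_div, ← h2]
        have : Z.trace / c = d := by rw [hc_def]; field_simp [hZ.trace_pos.ne']
        simp [this]

/-- A multiple of `θ` is small in the norm of the inverse of a matrix with large eigenvalues. -/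
theorem PosDef.inv_smul_dotProduct_le (hZ : Z.PosDef) {lam : ℝ} (hlam : 0 < lam)
    (h : ∀ u, lam * (u ⬝ᵥ u) ≤ u ⬝ᵥ (Z *ᵥ u)) (θ : Fin d → ℝ) :
    (lam • θ) ⬝ᵥ (Z⁻¹ *ᵥ (lam • θ)) ≤ lam * (θ ⬝ᵥ θ) := by
  set u := Z⁻¹ *ᵥ (lam • θ) with hu
  have h1 : Z *ᵥ u = lam • θ := by
    rw [hu, mulVec_mulVec, mul_nonsing_inv _ hZ.isUnit_det, one_mulVec]
  have h2 := h u
  rw [h1, dotProduct_smul, smul_eq_mul] at h2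
  have h3 : u ⬝ᵥ u ≤ u ⬝ᵥ θ := le_of_mul_le_mul_left h2 hlam
  have h4 : 0 ≤ (θ - u) ⬝ᵥ (θ - u) := Finset.sum_nonneg fun i _ => mul_self_nonneg _
  simp only [sub_dotProduct, dotProduct_sub] at h4
  rw [smul_dotProduct, smul_eq_mul]
  refine mul_le_mul_of_nonneg_left ?_ hlam.le
  rw [dotProduct_comm u θ] at h3 h4
  linarith

end Matrix

namespace PowerMDP

variable {d : ℕ} {Z : Matrix (Fin d) (Fin d) ℝ}

open Matrix

theorem invNorm_nonneg (Z : Matrix (Fin d) (Fin d) ℝ) (x : Fin d → ℝ) : 0 ≤ invNorm Z x :=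
  Real.sqrt_nonneg _

theorem sq_invNorm (hZ : Z.PosDef) (x : Fin d → ℝ) : invNorm Z x ^ 2 = x ⬝ᵥ (Z⁻¹ *ᵥ x) :=
  Real.sq_sqrt (hZ.inv_dotProduct_self_nonneg x)

theorem abs_inv_dotProduct_le (hZ : Z.PosDef) (x y : Fin d → ℝ) :
    |x ⬝ᵥ (Z⁻¹ *ᵥ y)| ≤ invNorm Z x * invNorm Z y := by
  refine abs_le_of_sq_le_sq ?_ (mul_nonneg (invNorm_nonneg _ _) (invNorm_nonneg _ _))
  rw [mul_pow, sq_invNorm hZ, sq_invNorm hZ]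
  exact hZ.inv_dotProduct_sq_le x y

theorem invNorm_sub_le (hZ : Z.PosDef) (x y : Fin d → ℝ) :
    invNorm Z (x - y) ≤ invNorm Z x + invNorm Z y := by
  refine abs_le_of_sq_le_sq' ?_ (add_nonneg (invNorm_nonneg _ _) (invNorm_nonneg _ _)) |>.2
  have h1 := (abs_le.mp (abs_inv_dotProduct_le hZ x y)).1
  rw [sq_invNorm hZ, add_sq, sq_invNorm hZ, sq_invNorm hZ]
  simp only [mulVec_sub, dotProduct_sub, sub_dotProduct]
  rw [hZ.inv_dotProduct_comm y x]
  linarith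

theorem invNorm_smul (Z : Matrix (Fin d) (Fin d) ℝ) {c : ℝ} (hc : 0 ≤ c) (x : Fin d → ℝ) :
    invNorm Z (c • x) = c * invNorm Z x := by
  rw [invNorm, invNorm, mulVec_smul, dotProduct_smul, smul_dotProduct, smul_eq_mul, smul_eq_mul,
    ← mul_assoc, Real.sqrt_mul (mul_self_nonneg c), Real.sqrt_mul_self hc]

section GramMatrix

open ListProcess

variable {E : Type*}

/-- The regularized Gram matrix `λ I + ∑ x xᵀ` of the vectors `x` along a list. -/
def gram (lam : ℝ) (x : List E → E → Fin d → ℝ) : List E → Matrix (Fin d) (Fin d) ℝ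
  | [] => lam • 1
  | e :: hs => gram lam x hs + vecMulVec (x hs e) (x hs e)

/-- The vector-valued martingale `∑ η x`. -/
def score (x : List E → E → Fin d → ℝ) (η : List E → E → ℝ) : List E → Fin d → ℝ
  | [] => 0
  | e :: hs => score x η hs + η hs e • x hs e

variable {lam : ℝ} (x : List E → E → Fin d → ℝ)

theorem gram_posDef (hlam : 0 < lam) (hs : List E) : (gram lam x hs).PosDef := by
  induction hs with
  | nil => exact PosDef.one.smul hlam
  | cons e hs ih => exact ih.add_vecMulVec_self _

theorem le_dotProduct_gram (hs : List E) (u : Fin d → ℝ) :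
    lam * (u ⬝ᵥ u) ≤ u ⬝ᵥ (gram lam x hs *ᵥ u) := by
  induction hs with
  | nil => simp [gram, smul_mulVec]
  | cons e hs ih =>
    rw [gram, add_mulVec, dotProduct_add]
    have h : 0 ≤ u ⬝ᵥ (vecMulVec (x hs e) (x hs e) *ᵥ u) := by
      simpa using (posSemidef_vecMulVec_self_star (x hs e)).dotProduct_mulVec_nonneg u
    linarith

theorem trace_gram (hs : List E) :
    (gram lam x hs).trace = d * lam + listSum (fun l e => x l e ⬝ᵥ x l e) hs := by
  induction hs with
  | nil => simp [gram, listSum, trace_smul, mul_comm]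
  | cons e hs ih => rw [gram, trace_add, ih, listSum, trace_vecMulVec, add_assoc]

theorem log_det_gram (hlam : 0 < lam) (hs : List E) :
    Real.log (gram lam x hs).det = d * Real.log lam +
      listSum (fun l e => Real.log (1 + x l e ⬝ᵥ ((gram lam x l)⁻¹ *ᵥ x l e))) hs := by
  induction hs with
  | nil => simp [gram, listSum]
  | cons e hs ih =>
    have hZ := gram_posDef x hlam hs
    have hw := hZ.inv_dotProduct_self_nonneg (x hs e)
    rw [gram, hZ.det_add_vecMulVec_self, Real.log_mul hZ.det_pos.ne' (by positivity), ih, listSum]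
    ring

/-- The elliptical potential lemma. -/
theorem listSum_potential_le (hlam : 0 < lam) (hd : 0 < d) {L2 : ℝ}
    (hx : ∀ l e, x l e ⬝ᵥ x l e ≤ L2)
    (hs : List E) :
    listSum (fun l e => (x l e ⬝ᵥ ((gram lam x l)⁻¹ *ᵥ x l e)) /
        (1 + x l e ⬝ᵥ ((gram lam x l)⁻¹ *ᵥ x l e))) hs ≤
      d * Real.log (1 + hs.length * L2 / (d * lam)) := by
  have h1 : listSum (fun l e => (x l e ⬝ᵥ ((gram lam x l)⁻¹ *ᵥ x l e)) /
        (1 + x l e ⬝ᵥ ((gram lam x l)⁻¹ *ᵥ x l e))) hs ≤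
      listSum (fun l e => Real.log (1 + x l e ⬝ᵥ ((gram lam x l)⁻¹ *ᵥ x l e))) hs := by
    refine listSum_mono (fun l e => ?_) hs
    have hw := (gram_posDef x hlam l).inv_dotProduct_self_nonneg (x l e)
    have h2 := Real.one_sub_inv_le_log_of_pos (x := 1 + x l e ⬝ᵥ ((gram lam x l)⁻¹ *ᵥ x l e))
      (by positivity)
    refine le_trans (le_of_eq ?_) h2
    field_simp
    ring
  have h2 := log_det_gram x hlam hs
  have hZ := gram_posDef x hlam hs
  have h3 := hZ.log_det_le hd
  have : Nonempty (Fin d) := ⟨⟨0, hd⟩⟩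
  have hd' : (0 : ℝ) < d := by exact_mod_cast hd
  have h4 : (gram lam x hs).trace / d / lam ≤ 1 + hs.length * L2 / (d * lam) := by
    have h5 := listSum_mono hx hs
    rw [listSum_const] at h5
    rw [trace_gram, div_div, div_le_iff₀ (by positivity), add_mul,
      div_mul_cancel₀ _ (by positivity)]
    linarith
  have htr := hZ.trace_pos
  have h5 : Real.log ((gram lam x hs).trace / d) - Real.log lam ≤
      Real.log (1 + hs.length * L2 / (d * lam)) := by
    rw [← Real.log_div (by positivity) hlam.ne']
    exact Real.log_le_log (by positivity) h4
  nlinarith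

end GramMatrix

end PowerMDP

/-! ### A Bernstein inequality for self-normalized vector martingales -/

namespace PowerMDP

open Matrix ListProcess

theorem sum_range_inv_sq_le (n : ℕ) :
    ∑ t ∈ Finset.range n, 1 / ((t : ℝ) + 1) ^ 2 ≤ 2 - 1 / (n : ℝ) := by
  induction n with
  | zero => simp
  | succ n ih =>
    rw [Finset.sum_range_succ]
    rcases Nat.eq_zero_or_pos n with rfl | hn
    · norm_num
    · have hn' : (0 : ℝ) < n := by exact_mod_cast hn
      have h : 1 / ((n : ℝ) + 1) ^ 2 ≤ 1 / n - 1 / (n + 1) := by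
        rw [div_sub_div _ _ hn'.ne' (by positivity),
          div_le_div_iff₀ (by positivity) (by positivity)]
        nlinarith
      push_cast
      linarith

section SelfNormalized

variable {E C S : Type*} {d : ℕ}

/-- Along a list, the self-normalized square norm of `∑ η x` is at most the sum of a martingale
and of a quadratic term weighted by the elliptical potential. -/
theorem score_dotProduct_le {lam : ℝ} (hlam : 0 < lam) (x : List E → E → Fin d → ℝ)
    (η : List E → E → ℝ) (hs : List E) :
    score x η hs ⬝ᵥ ((gram lam x hs)⁻¹ *ᵥ score x η hs) ≤
      listSum (fun l e => 2 * η l e * (x l e ⬝ᵥ ((gram lam x l)⁻¹ *ᵥ score x η l)) /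
        (1 + x l e ⬝ᵥ ((gram lam x l)⁻¹ *ᵥ x l e))) hs +
      listSum (fun l e => η l e ^ 2 * ((x l e ⬝ᵥ ((gram lam x l)⁻¹ *ᵥ x l e)) /
        (1 + x l e ⬝ᵥ ((gram lam x l)⁻¹ *ᵥ x l e)))) hs := by
  induction hs with
  | nil => simp [score, listSum]
  | cons e hs ih =>
    have := (gram_posDef x hlam hs).inv_add_vecMulVec_self_dotProduct_le (x hs e)
      (score x η hs) (η hs e)
    simp only [score, gram, listSum]
    linarith

variable {law : List E → PMF E} {ctx : E → C} {out : E → S} {κ : C → PMF S}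

/-- The outcome `out e` is drawn from `κ (ctx e)`, given the preceding terms and the context
`ctx e`. (The consequence for exponential moments is all that is needed.) -/
def DrawnFrom (law : List E → PMF E) (ctx : E → C) (out : E → S) (κ : C → PMF S) : Prop :=
  ∀ (l : List E) (F : C → S → ENNReal), (∀ c, (κ c).lexpect (F c) ≤ 1) →
    (law l).lexpect (fun e => F (ctx e) (out e)) ≤ 1

/-- The elliptical potential `w / (1 + w)`, for `w = ‖x‖²` in the norm of `Z⁻¹`. -/
noncomputable def potential (Z : Matrix (Fin d) (Fin d) ℝ) (x : Fin d → ℝ) : ℝ :=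
  (x ⬝ᵥ (Z⁻¹ *ᵥ x)) / (1 + x ⬝ᵥ (Z⁻¹ *ᵥ x))

theorem potential_nonneg {Z : Matrix (Fin d) (Fin d) ℝ} (hZ : Z.PosDef) (x : Fin d → ℝ) :
    0 ≤ potential Z x := by
  have := hZ.inv_dotProduct_self_nonneg x
  rw [potential]; positivity

theorem potential_le_one {Z : Matrix (Fin d) (Fin d) ℝ} (hZ : Z.PosDef) (x : Fin d → ℝ) :
    potential Z x ≤ 1 := by
  have := hZ.inv_dotProduct_self_nonneg x
  rw [potential, div_le_one (by positivity)]
  linarith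

/-- The linear term of the self-normalized square norm, switched off once the norm has exceeded
`β`. -/
noncomputable def truncatedIncrement (lam β : ℝ) (x : List E → E → Fin d → ℝ) (η : List E → E → ℝ)
    (l : List E) (e : E) : ℝ :=
  open Classical in
  if invNorm (gram lam x l) (score x η l) ≤ β then
    2 * η l e * (x l e ⬝ᵥ ((gram lam x l)⁻¹ *ᵥ score x η l)) /
      (1 + x l e ⬝ᵥ ((gram lam x l)⁻¹ *ᵥ x l e))
  else 0

theorem prob_truncatedIncrement (hdraw : DrawnFrom law ctx out κ) {lam : ℝ} (hlam : 0 < lam)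
    {x : List E → C → Fin d → ℝ} {η : List E → C → S → ℝ} {R σ2 : ℝ}
    (hη : ∀ l c s, |η l c s| ≤ R) (hη0 : ∀ l c, (κ c).expect (η l c) = 0)
    (hη2 : ∀ l c, (κ c).expect (fun s => η l c s ^ 2) ≤ σ2) {β ℓ : ℝ} (hβ : 0 < β)
    (hℓ : 0 < ℓ) (hR : 4 * R * ℓ ≤ β) (n : ℕ) :
    (listLaw law n).toOuterMeasure {l | ℓ ≤ listSum (fun l e =>
      4 * ℓ / β ^ 2 * truncatedIncrement lam β (fun l e => x l (ctx e))
          (fun l e => η l (ctx e) (out e)) l e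
        - 64 * ℓ ^ 2 / β ^ 2 * σ2 *
          potential (gram lam (fun l e => x l (ctx e)) l) (x l (ctx e))) l} ≤
      ENNReal.ofReal (Real.exp (-ℓ)) := by
  classical
  refine prob_le_listSum (fun l => ?_) n ℓ
  set Z := gram lam (fun l e => x l (ctx e)) l with hZdef
  set v := score (fun l e => x l (ctx e)) (fun l e => η l (ctx e) (out e)) l with hvdef
  have hZ : Z.PosDef := gram_posDef _ hlam l
  -- the coefficient of the noise in the increment
  let coef : C → ℝ := fun c =>
    if invNorm Z v ≤ β then
      4 * ℓ / β ^ 2 * (2 * (x l c ⬝ᵥ (Z⁻¹ *ᵥ v)) / (1 + x l c ⬝ᵥ (Z⁻¹ *ᵥ x l c))) else 0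
  have hcoef : ∀ c, coef c ^ 2 ≤ 64 * ℓ ^ 2 / β ^ 2 * potential Z (x l c) ∧
      |coef c| ≤ 4 * ℓ / β := by
    intro c
    have hw := hZ.inv_dotProduct_self_nonneg (x l c)
    have hp := potential_nonneg hZ (x l c)
    by_cases hb : invNorm Z v ≤ β
    · have h1 := hZ.inv_dotProduct_sq_le (x l c) v
      rw [← sq_invNorm hZ v] at h1
      have h2 : invNorm Z v ^ 2 ≤ β ^ 2 := pow_le_pow_left₀ (invNorm_nonneg _ _) hb 2
      have hc : coef c = 4 * ℓ / β ^ 2 *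
          (2 * (x l c ⬝ᵥ (Z⁻¹ *ᵥ v)) / (1 + x l c ⬝ᵥ (Z⁻¹ *ᵥ x l c))) := if_pos hb
      rw [hc]
      set w := x l c ⬝ᵥ (Z⁻¹ *ᵥ x l c) with hwdef
      set y := x l c ⬝ᵥ (Z⁻¹ *ᵥ v)
      have h3 : y ^ 2 ≤ w * β ^ 2 := h1.trans (mul_le_mul_of_nonneg_left h2 hw)
      have h4 : (2 * y / (1 + w)) ^ 2 ≤ 4 * β ^ 2 * (w / (1 + w)) := by
        rw [div_pow, ← mul_div_assoc, div_le_div_iff₀ (by positivity) (by positivity)]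
        have h5 : y ^ 2 * (1 + w) ≤ w * β ^ 2 * (1 + w) ^ 2 := by
          have := mul_le_mul_of_nonneg_right h3 (by positivity : 0 ≤ 1 + w)
          have h6 : 0 ≤ w * β ^ 2 * (1 + w) * w := by positivity
          nlinarith
        nlinarith
      have h4' : (2 * y / (1 + w)) ^ 2 ≤ β ^ 2 := by
        rw [div_pow, div_le_iff₀ (by positivity)]
        nlinarith [mul_nonneg (sq_nonneg β) (sq_nonneg (1 - w))]
      constructor
      · rw [mul_pow]
        calc (4 * ℓ / β ^ 2) ^ 2 * (2 * y / (1 + w)) ^ 2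
            ≤ (4 * ℓ / β ^ 2) ^ 2 * (4 * β ^ 2 * (w / (1 + w))) :=
              mul_le_mul_of_nonneg_left h4 (sq_nonneg _)
          _ = 64 * ℓ ^ 2 / β ^ 2 * potential Z (x l c) := by
              rw [potential, ← hwdef]; field_simp; ring
      · rw [abs_mul, abs_of_pos (by positivity : 0 < 4 * ℓ / β ^ 2)]
        calc 4 * ℓ / β ^ 2 * |2 * y / (1 + w)| ≤ 4 * ℓ / β ^ 2 * β :=
              mul_le_mul_of_nonneg_left (abs_le_of_sq_le_sq h4' hβ.le) (by positivity)
          _ = 4 * ℓ / β := by field_simp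
    · have hc : coef c = 0 := if_neg hb
      rw [hc]
      refine ⟨?_, ?_⟩
      · rw [zero_pow two_ne_zero]; positivity
      · rw [abs_zero]; positivity
  refine le_of_eq_of_le ?_ (hdraw l (fun c s => ENNReal.ofReal (Real.exp (coef c * η l c s
    - 64 * ℓ ^ 2 / β ^ 2 * σ2 * potential Z (x l c)))) fun c => ?_)
  · congr 1
    funext e
    congr 3
    simp only [truncatedIncrement, coef, ← hZdef, ← hvdef]
    split_ifs
    · ring
    · simp
  · have hb : PMF.IsBdd (η l c) := ⟨R, hη l c⟩
    refine PMF.lexpect_exp_le_one_of_centered _ (fun s => ?_) ?_ ?_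
    · rw [abs_mul]
      calc |coef c| * |η l c s| ≤ 4 * ℓ / β * R :=
            mul_le_mul (hcoef c).2 (hη l c s) (abs_nonneg _) (by positivity)
        _ ≤ 1 := by
            rw [div_mul_eq_mul_div, div_le_one hβ]; linarith
    · rw [PMF.expect_const_mul, hη0, mul_zero]
    · simp only [mul_pow, PMF.expect_const_mul]
      have h0 : 0 ≤ (κ c).expect fun s => η l c s ^ 2 := PMF.expect_nonneg _ fun s => sq_nonneg _
      calc coef c ^ 2 * (κ c).expect (fun s => η l c s ^ 2)
          ≤ (64 * ℓ ^ 2 / β ^ 2 * potential Z (x l c)) * σ2 :=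
            mul_le_mul (hcoef c).1 (hη2 l c) h0 ((sq_nonneg _).trans (hcoef c).1)
        _ = _ := by ring

theorem prob_sq_potential (hdraw : DrawnFrom law ctx out κ) {lam : ℝ} (hlam : 0 < lam)
    {x : List E → C → Fin d → ℝ} {η : List E → C → S → ℝ} {R σ2 : ℝ} (hRpos : 0 < R)
    (hη : ∀ l c s, |η l c s| ≤ R)
    (hη2 : ∀ l c, (κ c).expect (fun s => η l c s ^ 2) ≤ σ2) (ℓ : ℝ) (n : ℕ) :
    (listLaw law n).toOuterMeasure {l | ℓ ≤ listSum (fun l e =>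
      (R ^ 2)⁻¹ * (η l (ctx e) (out e) ^ 2 *
          potential (gram lam (fun l e => x l (ctx e)) l) (x l (ctx e)))
        - 2 * ((R ^ 2)⁻¹ * σ2) *
          potential (gram lam (fun l e => x l (ctx e)) l) (x l (ctx e))) l} ≤
      ENNReal.ofReal (Real.exp (-ℓ)) := by
  refine prob_le_listSum (fun l => ?_) n ℓ
  set Z := gram lam (fun l e => x l (ctx e)) l with hZdef
  have hZ : Z.PosDef := gram_posDef _ hlam l
  refine hdraw l (fun c s => ENNReal.ofReal (Real.exp ((R ^ 2)⁻¹ * (η l c s ^ 2 *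
    potential Z (x l c)) - 2 * ((R ^ 2)⁻¹ * σ2) * potential Z (x l c)))) fun c => ?_
  have hp := potential_nonneg hZ (x l c)
  simp only [mul_assoc (2 : ℝ)]
  refine PMF.lexpect_exp_sub_two_mul_le_one _ (fun s => ⟨by positivity, ?_⟩) ?_
  · have h1 : η l c s ^ 2 ≤ R ^ 2 := by
      rw [← sq_abs]; exact pow_le_pow_left₀ (abs_nonneg _) (hη l c s) 2
    rw [inv_mul_le_iff₀ (by positivity), mul_one]
    calc η l c s ^ 2 * potential Z (x l c) ≤ R ^ 2 * 1 :=
          mul_le_mul h1 (potential_le_one hZ _) hp (sq_nonneg _)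
      _ = R ^ 2 := mul_one _
  · rw [PMF.expect_const_mul, mul_assoc]
    refine mul_le_mul_of_nonneg_left ?_ (by positivity)
    simp only [mul_comm _ (potential Z (x l c)), PMF.expect_const_mul]
    exact mul_le_mul_of_nonneg_left (hη2 l c) hp

/-- **Bernstein-type self-normalized concentration.** If the noise `η` is centered, bounded by
`R`, and of conditional variance at most `σ2`, then with high probability the self-normalized norm
of `∑ η x` stays below every sequence of radii that satisfies the two lower bounds `hβR` and
`hβσ`. -/
theorem prob_exists_lt_invNorm_score (hdraw : DrawnFrom law ctx out κ) {lam : ℝ} (hlam : 0 < lam)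
    (hd : 0 < d) {x : List E → C → Fin d → ℝ} {η : List E → C → S → ℝ} {R σ2 L2 δ : ℝ}
    (hR : 0 < R) (hx : ∀ l c, x l c ⬝ᵥ x l c ≤ L2)
    (hη : ∀ l c s, |η l c s| ≤ R) (hη0 : ∀ l c, (κ c).expect (η l c) = 0)
    (hη2 : ∀ l c, (κ c).expect (fun s => η l c s ^ 2) ≤ σ2) (hσ : 0 ≤ σ2)
    (hδ : 0 < δ) (hδ1 : δ ≤ 1)
    {β : ℕ → ℝ} (hmono : Monotone β) (hβ0 : 0 ≤ β 0)
    (hβR : ∀ t : ℕ, 0 < t → 4 * R * Real.log (4 * (t : ℝ) ^ 2 / δ) ≤ β t)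
    (hβσ : ∀ t : ℕ, 0 < t → 64 * σ2 * (d * Real.log (1 + t * L2 / (d * lam))) *
      Real.log (4 * (t : ℝ) ^ 2 / δ) ≤ β t ^ 2) (n : ℕ) :
    (listLaw law n).toOuterMeasure {l | ∃ l', l' <:+ l ∧ β l'.length <
        invNorm (gram lam (fun l e => x l (ctx e)) l')
          (score (fun l e => x l (ctx e)) (fun l e => η l (ctx e) (out e)) l')} ≤
      ENNReal.ofReal δ := by
  set X : List E → E → Fin d → ℝ := fun l e => x l (ctx e) with hX
  set N : List E → E → ℝ := fun l e => η l (ctx e) (out e) with hN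
  set ℓ : ℕ → ℝ := fun t => Real.log (4 * (t : ℝ) ^ 2 / δ) with hℓ
  set pot : List E → E → ℝ := fun l e => potential (gram lam X l) (X l e) with hpot
  let G1 : ℕ → List E → E → ℝ := fun t l e =>
    4 * ℓ t / β t ^ 2 * truncatedIncrement lam (β t) X N l e
      - 64 * ℓ t ^ 2 / β t ^ 2 * σ2 * pot l e
  let G2 : List E → E → ℝ := fun l e => (R ^ 2)⁻¹ * (N l e ^ 2 * pot l e)
    - 2 * ((R ^ 2)⁻¹ * σ2) * pot l e
  let Bad : List E → Prop := fun l =>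
    ℓ l.length ≤ listSum (G1 l.length) l ∨ ℓ l.length ≤ listSum G2 l
  have hℓ1 : ∀ t : ℕ, 0 < t → 1 ≤ ℓ t := by
    intro t ht
    have ht' : (1 : ℝ) ≤ t := by exact_mod_cast ht
    rw [hℓ, Real.le_log_iff_exp_le (by positivity), le_div_iff₀ hδ]
    nlinarith [Real.exp_one_lt_d9]
  have hβpos : ∀ t : ℕ, 0 < t → 0 < β t := fun t ht =>
    lt_of_lt_of_le (by have := hℓ1 t ht; positivity) (hβR t ht)
  -- the probability that one of the two deviation bounds fails
  have hprob : (listLaw law n).toOuterMeasure {l | ∃ l', l' <:+ l ∧ l' ≠ [] ∧ Bad l'} ≤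
      ENNReal.ofReal δ := by
    refine (prob_exists_suffix_le (ε := fun t => ENNReal.ofReal (δ / 2 * (1 / (t : ℝ) ^ 2))) n
      fun t _ => ?_).trans ?_
    · have ht : 0 < t + 1 := Nat.succ_pos t
      have h1 := prob_truncatedIncrement hdraw hlam hη hη0 hη2 (hβpos _ ht)
        (lt_of_lt_of_le one_pos (hℓ1 _ ht)) (hβR _ ht) (x := x) (t + 1)
      have h2 := prob_sq_potential hdraw hlam hR hη hη2 (x := x) (ℓ (t + 1)) (t + 1)
      have h3 : Real.exp (-ℓ (t + 1)) = δ / 4 * (1 / ((t + 1 : ℕ) : ℝ) ^ 2) := by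
        have ht' : (0 : ℝ) < ((t + 1 : ℕ) : ℝ) := by exact_mod_cast ht
        rw [Real.exp_neg, hℓ, Real.exp_log (by positivity)]
        field_simp
      refine (PMF.toOuterMeasure_mono _ (t := {l | ℓ (t + 1) ≤ listSum (G1 (t + 1)) l} ∪
        {l | ℓ (t + 1) ≤ listSum G2 l}) ?_).trans ((MeasureTheory.measure_union_le _ _).trans
          ((add_le_add h1 h2).trans ?_))
      · rintro l ⟨hl, hsup⟩
        have hlen := length_of_mem_support_listLaw hsup
        simpa only [Bad, Set.mem_ofPred_eq, hlen, Set.mem_union] using hl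
      · rw [← ENNReal.ofReal_add (Real.exp_nonneg _) (Real.exp_nonneg _), h3]
        exact ENNReal.ofReal_le_ofReal (le_of_eq (by ring))
    · rw [← ENNReal.ofReal_sum_of_nonneg fun i _ => by positivity]
      refine ENNReal.ofReal_le_ofReal ?_
      rw [← Finset.mul_sum]
      have h1 := sum_range_inv_sq_le n
      have h2 : (0 : ℝ) ≤ 1 / n := by positivity
      push_cast
      nlinarith
  refine (MeasureTheory.measure_mono fun l hl => ?_).trans hprob
  rw [Set.mem_ofPred_eq] at hl ⊢
  by_contra hgood
  push Not at hgood
  obtain ⟨l', hl', hlt⟩ := hl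
  refine absurd hlt (not_lt.mpr ?_)
  clear hlt
  -- on the good event, the norm stays below `β` by induction on time
  induction hm : l'.length using Nat.strong_induction_on generalizing l' with
  | _ m ih =>
  subst hm
  by_cases hne : l' = []
  · subst hne
    have : invNorm (gram lam X []) (score X N []) = 0 := by simp [score, invNorm]
    rw [this]; exact hβ0
  set t := l'.length with ht_def
  have ht : 0 < t := List.length_pos_of_ne_nil hne
  have hb := hgood l' hl' hne
  simp only [Bad, not_or, not_le, ← ht_def] at hb
  obtain ⟨hb1, hb2⟩ := hb
  have hβt := hβpos t ht
  have hlt := hℓ1 t ht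
  have hRt := hβR t ht
  have hσt := hβσ t ht
  rw [← show ℓ t = Real.log (4 * (t : ℝ) ^ 2 / δ) from rfl] at hRt hσt
  have hpotsum : listSum pot l' ≤ d * Real.log (1 + t * L2 / (d * lam)) :=
    listSum_potential_le X hlam hd (fun l e => hx l (ctx e)) l'
  have hpot0 : 0 ≤ listSum pot l' :=
    listSum_nonneg (fun l e => potential_nonneg (gram_posDef X hlam l) _) l'
  have h16 : 64 * σ2 * listSum pot l' * ℓ t ≤ β t ^ 2 := by
    refine le_trans ?_ hσt
    gcongr
  -- the norm stayed below `β t` at all earlier times, so the truncation has no effect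
  have htr : listSum (truncatedIncrement lam (β t) X N) l' =
      listSum (fun l e => 2 * N l e * (X l e ⬝ᵥ ((gram lam X l)⁻¹ *ᵥ score X N l)) /
        (1 + X l e ⬝ᵥ ((gram lam X l)⁻¹ *ᵥ X l e))) l' := by
    refine listSum_congr_of_suffix fun e l'' hl'' => if_pos ?_
    have hlen : l''.length < t := by
      have := hl''.length_le
      simp only [List.length_cons] at this
      omega
    exact (ih l''.length hlen l'' (((List.suffix_cons e l'').trans hl'').trans hl') rfl).trans
      (hmono hlen.le)
  have hscore := score_dotProduct_le hlam X N l'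
  rw [← htr, ← sq_invNorm (gram_posDef X hlam l')] at hscore
  have e1 : listSum (G1 t) l' = 4 * ℓ t / β t ^ 2 * listSum (truncatedIncrement lam (β t) X N) l'
      - 64 * ℓ t ^ 2 / β t ^ 2 * σ2 * listSum pot l' := by
    simp only [G1]
    rw [listSum_sub, listSum_const_mul, listSum_const_mul]
  have e2 : listSum G2 l' = (R ^ 2)⁻¹ * listSum (fun l e => N l e ^ 2 * pot l e) l'
      - 2 * ((R ^ 2)⁻¹ * σ2) * listSum pot l' := by
    simp only [G2]
    rw [listSum_sub, listSum_const_mul, listSum_const_mul]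
  rw [e1] at hb1
  rw [e2] at hb2
  change _ ≤ listSum (truncatedIncrement lam (β t) X N) l' +
    listSum (fun l e => N l e ^ 2 * pot l e) l' at hscore
  set A := listSum (truncatedIncrement lam (β t) X N) l'
  set Q := listSum (fun l e => N l e ^ 2 * pot l e) l'
  set P := listSum pot l'
  have hA : A ≤ β t ^ 2 / 2 := by
    have h1 : 4 * ℓ t / β t ^ 2 * A - 64 * ℓ t ^ 2 / β t ^ 2 * σ2 * P =
        (4 * ℓ t * A - 64 * σ2 * P * ℓ t * ℓ t) / β t ^ 2 := by
      field_simp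
    rw [h1, div_lt_iff₀ (by positivity)] at hb1
    have h2 := mul_le_mul_of_nonneg_right h16 (by positivity : 0 ≤ ℓ t)
    have h3 : ℓ t * (4 * A) ≤ ℓ t * (2 * β t ^ 2) := by linarith
    have := le_of_mul_le_mul_left h3 (by positivity)
    linarith
  have hQ : Q ≤ β t ^ 2 / 2 := by
    have h1 : (R ^ 2)⁻¹ * Q - 2 * ((R ^ 2)⁻¹ * σ2) * P = (Q - 2 * σ2 * P) / R ^ 2 := by
      field_simp
    rw [h1, div_lt_iff₀ (by positivity)] at hb2
    have h2 : (4 * R * ℓ t) ^ 2 ≤ β t ^ 2 := pow_le_pow_left₀ (by positivity) hRt 2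
    have h3 : ℓ t * R ^ 2 ≤ (R * ℓ t) ^ 2 := by
      rw [mul_pow]; nlinarith [sq_nonneg R, mul_nonneg (sq_nonneg R) (sub_nonneg.mpr hlt)]
    have h4 : 64 * σ2 * P * 1 ≤ 64 * σ2 * P * ℓ t :=
      mul_le_mul_of_nonneg_left hlt (by positivity)
    nlinarith
  exact (sq_le_sq₀ (invNorm_nonneg _ _) hβt.le).mp (by linarith)

end SelfNormalized

end PowerMDP

/-! ### Occupancy measures and the performance difference identity -/

namespace PowerMDP

namespace AdversarialMDP

variable {S : Type u} {A : Type v} {H : ℕ} (M : AdversarialMDP S A H) (π : Policy S A H)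

/-- The law of the state `s_{i+1}` (stages are `0`-based) under the policy `π`. -/
noncomputable def stateLaw (i : Fin (H + 1)) : PMF S :=
  (prefixLaw M.trans π M.start i (Nat.lt_succ_iff.mp i.2)).map fun τ => τ.1 (Fin.last i)

/-- The joint law of state and action at stage `h` under the policy `π`. -/
noncomputable def occupancy (h : Fin H) : PMF (S × A) :=
  (M.stateLaw π h.castSucc).bind fun s => (π h s).map fun a => (s, a)

theorem stateLaw_zero : M.stateLaw π 0 = PMF.pure M.start := by
  simp [stateLaw, prefixLaw, PMF.pure_map]

theorem stateLaw_succ (h : Fin H) :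
    M.stateLaw π h.succ = (M.occupancy π h).bind fun c => M.trans h c.1 c.2 := by
  simp only [stateLaw, occupancy, Fin.val_succ, prefixLaw, PMF.map_bind, PMF.bind_bind,
    PMF.bind_map, PMF.map_comp, Function.comp_def, Fin.snoc_last, Fin.val_castSucc, Fin.eta]
  congr 1
  funext τ
  congr 1
  funext a
  exact PMF.map_id _

theorem map_prefixLaw (h : Fin H) {n : ℕ} (hn : (h : ℕ) + 1 ≤ n) (hnH : n ≤ H) :
    (prefixLaw M.trans π M.start n hnH).map (fun τ =>
      ((τ.1 ⟨h, by omega⟩, τ.2 ⟨h, by omega⟩), τ.1 ⟨h + 1, by omega⟩)) =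
    (M.occupancy π h).bind fun c => (M.trans h c.1 c.2).map fun s' => (c, s') := by
  induction n, hn using Nat.le_induction with
  | base =>
    simp only [stateLaw, occupancy, prefixLaw, PMF.map_bind, PMF.bind_bind,
      PMF.bind_map, PMF.map_comp, Function.comp_def, Fin.val_castSucc, Fin.eta]
    congr 1
    funext τ
    congr 1
    funext a
    congr 1
    funext s'
    have h1 : (⟨h, by omega⟩ : Fin ((h : ℕ) + 1 + 1)) = (Fin.last (h : ℕ)).castSucc := rfl
    have h2 : (⟨h, by omega⟩ : Fin ((h : ℕ) + 1)) = Fin.last (h : ℕ) := rfl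
    have h3 : (⟨(h : ℕ) + 1, by omega⟩ : Fin ((h : ℕ) + 1 + 1)) = Fin.last ((h : ℕ) + 1) := rfl
    rw [h1, h2, h3, Fin.snoc_castSucc, Fin.snoc_last, Fin.snoc_last]
  | succ n hn ih =>
    rw [← ih (by omega)]
    simp only [prefixLaw, PMF.map_bind, PMF.map_comp, Function.comp_def]
    have h1 : (⟨h, by omega⟩ : Fin (n + 1 + 1)) = (⟨h, by omega⟩ : Fin (n + 1)).castSucc := rfl
    have h2 : (⟨h, by omega⟩ : Fin (n + 1)) = (⟨h, by omega⟩ : Fin n).castSucc := rfl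
    have h3 : (⟨(h : ℕ) + 1, by omega⟩ : Fin (n + 1 + 1)) =
      (⟨(h : ℕ) + 1, by omega⟩ : Fin (n + 1)).castSucc := rfl
    simp only [h1, h3, Fin.snoc_castSucc]
    simp only [h2, Fin.snoc_castSucc]
    have hc : ∀ (p : PMF S) (y : (S × A) × S), (PMF.map (fun _ : S => y) p) = PMF.pure y :=
      fun p y => PMF.map_const p y
    simp only [hc, PMF.bind_const]
    rfl

/-- The law of one step of an episode: the next state is drawn from the transition kernel. -/
theorem map_episodeLaw (h : Fin H) :
    (M.episodeLaw π).map (fun τ => ((τ.1 h.castSucc, τ.2 h), τ.1 h.succ)) =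
      (M.occupancy π h).bind fun c => (M.trans h c.1 c.2).map fun s' => (c, s') :=
  M.map_prefixLaw π h h.2 le_rfl

theorem lexpect_episodeLaw (h : Fin H) (F : S × A → S → ENNReal) :
    (M.episodeLaw π).lexpect (fun τ => F (τ.1 h.castSucc, τ.2 h) (τ.1 h.succ)) =
      (M.occupancy π h).lexpect fun c => (M.trans h c.1 c.2).lexpect (F c) := by
  have h1 := (M.episodeLaw π).lexpect_map
    (fun τ => ((τ.1 h.castSucc, τ.2 h), τ.1 h.succ)) (fun y => F y.1 y.2)
  rw [map_episodeLaw, PMF.lexpect_bind] at h1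
  rw [← h1]
  simp only [PMF.lexpect_map]

theorem expect_episodeLaw (h : Fin H) {f : S × A → ℝ} (hf : PMF.IsBdd f) :
    (M.episodeLaw π).expect (fun τ => f (τ.1 h.castSucc, τ.2 h)) =
      (M.occupancy π h).expect f := by
  have h1 := (M.episodeLaw π).expect_map
    (fun τ => ((τ.1 h.castSucc, τ.2 h), τ.1 h.succ)) (f := fun y => f y.1) (hf.comp _)
  rw [map_episodeLaw, PMF.expect_bind _ _ (hf.comp _)] at h1
  rw [← h1]
  congr 1
  funext c
  rw [PMF.expect_map _ _ (hf.comp _)]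
  exact PMF.expect_const _ (f c)

theorem expect_occupancy_state (h : Fin H) {f : S → ℝ} (hf : PMF.IsBdd f) :
    (M.occupancy π h).expect (fun c => f c.1) = (M.stateLaw π h.castSucc).expect f := by
  rw [occupancy, PMF.expect_bind _ _ (hf.comp _)]
  congr 1
  funext s
  rw [PMF.expect_map _ _ (hf.comp _)]
  exact PMF.expect_const _ (f s)

theorem expect_occupancy (h : Fin H) {f : S × A → ℝ} (hf : PMF.IsBdd f) :
    (M.occupancy π h).expect f =
      (M.stateLaw π h.castSucc).expect fun s => (π h s).expect fun a => f (s, a) := by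
  rw [occupancy, PMF.expect_bind _ _ hf]
  congr 1
  funext s
  rw [PMF.expect_map _ _ hf]

theorem expect_occupancy_trans (h : Fin H) {f : S → ℝ} (hf : PMF.IsBdd f) :
    (M.occupancy π h).expect (fun c => (M.trans h c.1 c.2).expect f) =
      (M.stateLaw π h.succ).expect f := by
  rw [stateLaw_succ, PMF.expect_bind _ _ hf]

/-- The performance difference identity: along an episode, the one-step drifts of the functions
`f_1, …, f_{H+1}` telescope. -/
theorem sum_expect_drift (f : Fin (H + 1) → S → ℝ) (hf : ∀ i, PMF.IsBdd (f i)) :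
    ∑ h : Fin H, (M.occupancy π h).expect
        (fun c => (M.trans h c.1 c.2).expect (f h.succ) - f h.castSucc c.1) =
      (M.stateLaw π (Fin.last H)).expect (f (Fin.last H)) - f 0 M.start := by
  have h1 : ∀ h : Fin H, (M.occupancy π h).expect
        (fun c => (M.trans h c.1 c.2).expect (f h.succ) - f h.castSucc c.1) =
      (M.stateLaw π h.succ).expect (f h.succ) -
        (M.stateLaw π h.castSucc).expect (f h.castSucc) := by
    intro h
    obtain ⟨C, hC⟩ := hf h.succ
    rw [PMF.expect_sub _ (PMF.isBdd_expect fun _ => hC) ((hf _).comp _),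
      expect_occupancy_trans _ _ _ (hf _), expect_occupancy_state _ _ _ (hf _)]
  have h2 := Fin.sum_univ_succ fun i => (M.stateLaw π i).expect (f i)
  rw [Fin.sum_univ_castSucc, stateLaw_zero, PMF.expect_pure] at h2
  rw [Finset.sum_congr rfl fun h _ => h1 h, Finset.sum_sub_distrib]
  linarith

theorem value_eq_sum (r : Reward S A H) (hr : ∀ h s a, r h s a ∈ Set.Icc (0 : ℝ) 1) :
    M.value r π = ∑ h, (M.occupancy π h).expect fun c => r h c.1 c.2 := by
  have hb : ∀ h, PMF.IsBdd fun c : S × A => r h c.1 c.2 := fun h => .of_Icc fun c => hr h c.1 c.2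
  have h1 : M.value r π =
      (M.episodeLaw π).expect fun τ => ∑ h, r h (τ.1 h.castSucc) (τ.2 h) := rfl
  rw [h1, PMF.expect_finset_sum]
  · exact Finset.sum_congr rfl fun h _ => M.expect_episodeLaw π h (hb h)
  · exact fun h _ => (hb h).comp fun τ : Trajectory S A H => (τ.1 h.castSucc, τ.2 h)

theorem historyLaw_eq_listLaw (alg : History S A H → Policy S A H) (n : ℕ) :
    M.historyLaw alg n = ListProcess.listLaw (fun hs => M.episodeLaw (alg hs)) n := by
  induction n with
  | zero => rfl
  | succ n ih => rw [historyLaw, ListProcess.listLaw, ih]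

theorem regretAgainst_eq_listSum (alg : History S A H → Policy S A H) (hs : History S A H) :
    M.regretAgainst alg π hs = ListProcess.listSum
      (fun l _ => M.value (M.reward l) π - M.value (M.reward l) (alg l)) hs := by
  induction hs with
  | nil => rfl
  | cons τ hs ih => rw [regretAgainst, ListProcess.listSum, ih]

theorem drawnFrom (alg : History S A H → Policy S A H) (h : Fin H) :
    DrawnFrom (fun hs => M.episodeLaw (alg hs)) (fun τ => (τ.1 h.castSucc, τ.2 h))
      (fun τ => τ.1 h.succ) (fun c => M.trans h c.1 c.2) := by
  intro l F hF
  rw [lexpect_episodeLaw]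
  exact (PMF.lexpect_mono _ hF).trans_eq (PMF.lexpect_const _ _)

end AdversarialMDP

theorem isBdd_reward {S : Type u} {A : Type v} {H : ℕ} {M : AdversarialMDP S A H}
    (hs : History S A H) (h : Fin H) : PMF.IsBdd fun p : S × A => M.reward hs h p.1 p.2 :=
  .of_Icc fun p => M.reward_mem hs h p.1 p.2

end PowerMDP

/-! ### Linear mixtures and the optimistic estimates -/

namespace PowerMDP

open Matrix

variable {S : Type u} {A : Type v} {H d : ℕ}

section Features

variable {φ : S → A → S → EuclideanSpace ℝ (Fin d)}

theorem dotProduct_ofLp_eq_inner (x y : EuclideanSpace ℝ (Fin d)) :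
    x.ofLp ⬝ᵥ y.ofLp = inner ℝ x y := by
  rw [EuclideanSpace.inner_eq_star_dotProduct, dotProduct_comm]
  simp

theorem dotProduct_ofLp_self (x : EuclideanSpace ℝ (Fin d)) :
    x.ofLp ⬝ᵥ x.ofLp = ‖x‖ ^ 2 := by
  rw [dotProduct_ofLp_eq_inner, real_inner_self_eq_norm_sq]

theorem norm_le_sum_abs (x : EuclideanSpace ℝ (Fin d)) : ‖x‖ ≤ ∑ i, |x i| := by
  refine abs_le_of_sq_le_sq' ?_ (Finset.sum_nonneg fun i _ => abs_nonneg _) |>.2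
  rw [EuclideanSpace.real_norm_sq_eq]
  calc ∑ i, x i ^ 2 = ∑ i, |x i| * |x i| := by simp [sq]
    _ ≤ ∑ i, |x i| * ∑ j, |x j| := Finset.sum_le_sum fun i _ =>
        mul_le_mul_of_nonneg_left
          (Finset.single_le_sum (f := fun j => |x j|) (fun j _ => abs_nonneg _) (Finset.mem_univ i))
          (abs_nonneg _)
    _ = (∑ i, |x i|) ^ 2 := by rw [← Finset.sum_mul, sq]

/-- The norm condition on the features of indicator functions makes the features absolutely
summable. -/
theorem summable_norm_feature
    (hφ : ∀ V : S → ℝ, (∀ s, V s ∈ Set.Icc (0 : ℝ) 1) → ∀ s a, ‖featureOf φ V s a‖ ≤ 1)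
    (s : S) (a : A) : Summable fun s' => ‖φ s a s'‖ := by
  classical
  have h1 : ∀ F : Finset S, ‖∑ s' ∈ F, φ s a s'‖ ≤ 1 := by
    intro F
    have h := hφ (fun s' => if s' ∈ F then 1 else 0)
      (fun s' => by by_cases h : s' ∈ F <;> simp [h]) s a
    rwa [featureOf, tsum_eq_sum (s := F) (fun s' hs' => by simp [hs']),
      Finset.sum_congr rfl fun s' hs' => by rw [if_pos hs', one_smul]] at h
  have h2 : ∀ (F : Finset S) (i : Fin d), |∑ s' ∈ F, φ s a s' i| ≤ 1 := by
    intro F i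
    have h3 := (PiLp.norm_apply_le (∑ s' ∈ F, φ s a s') i).trans (h1 F)
    rwa [Real.norm_eq_abs, WithLp.ofLp_sum, Finset.sum_apply] at h3
  have h4 : ∀ i : Fin d, Summable fun s' => |φ s a s' i| := by
    intro i
    refine summable_of_sum_le (c := 2) (fun _ => abs_nonneg _) fun F => ?_
    -- split the partial sum according to the sign of its terms
    rw [← Finset.sum_filter_add_sum_filter_not F fun s' => 0 ≤ φ s a s' i]
    have h5 : ∑ s' ∈ F.filter (fun s' => 0 ≤ φ s a s' i), |φ s a s' i| =
        ∑ s' ∈ F.filter (fun s' => 0 ≤ φ s a s' i), φ s a s' i :=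
      Finset.sum_congr rfl fun s' hs' => abs_of_nonneg (Finset.mem_filter.mp hs').2
    have h6 : ∑ s' ∈ F.filter (fun s' => ¬ 0 ≤ φ s a s' i), |φ s a s' i| =
        -∑ s' ∈ F.filter (fun s' => ¬ 0 ≤ φ s a s' i), φ s a s' i := by
      rw [← Finset.sum_neg_distrib]
      exact Finset.sum_congr rfl fun s' hs' =>
        abs_of_neg (not_le.mp (Finset.mem_filter.mp hs').2)
    rw [h5, h6]
    have h7 := (abs_le.mp (h2 (F.filter fun s' => 0 ≤ φ s a s' i) i)).2
    have h8 := (abs_le.mp (h2 (F.filter fun s' => ¬ 0 ≤ φ s a s' i) i)).1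
    linarith
  exact Summable.of_nonneg_of_le (fun _ => norm_nonneg _) (fun s' => norm_le_sum_abs _)
    (summable_sum fun i _ => h4 i)

theorem summable_smul_feature
    (hφ : ∀ V : S → ℝ, (∀ s, V s ∈ Set.Icc (0 : ℝ) 1) → ∀ s a, ‖featureOf φ V s a‖ ≤ 1)
    {V : S → ℝ} (hV : PMF.IsBdd V) (s : S) (a : A) : Summable fun s' => V s' • φ s a s' := by
  obtain ⟨C, hC⟩ := hV
  refine Summable.of_norm_bounded ((summable_norm_feature hφ s a).mul_left C) fun s' => ?_
  rw [norm_smul]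
  exact mul_le_mul_of_nonneg_right (hC s') (norm_nonneg _)

theorem norm_featureOf_le
    (hφ : ∀ V : S → ℝ, (∀ s, V s ∈ Set.Icc (0 : ℝ) 1) → ∀ s a, ‖featureOf φ V s a‖ ≤ 1)
    {V : S → ℝ} {b : ℝ} (hb : 0 < b) (hV : ∀ s, V s ∈ Set.Icc 0 b) (s : S) (a : A) :
    ‖featureOf φ V s a‖ ≤ b := by
  have h1 := hφ (fun s' => b⁻¹ * V s') (fun s' => ⟨mul_nonneg (by positivity) (hV s').1, by
    rw [inv_mul_le_iff₀ hb, mul_one]; exact (hV s').2⟩) s a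
  have h2 : featureOf φ (fun s' => b⁻¹ * V s') s a = b⁻¹ • featureOf φ V s a := by
    simp only [featureOf, mul_smul]
    exact tsum_const_smul'' _
  rwa [h2, norm_smul, Real.norm_eq_abs, abs_of_pos (by positivity), inv_mul_le_iff₀ hb,
    mul_one] at h1

variable {M : AdversarialMDP S A H} {B : ℝ}

/-- In a linear mixture MDP, `⟨φ_V(s,a), θ_h⟩ = ∑ P_h(s'|s,a) V(s')`. -/
theorem featureOf_dotProduct
    (hφ : ∀ V : S → ℝ, (∀ s, V s ∈ Set.Icc (0 : ℝ) 1) → ∀ s a, ‖featureOf φ V s a‖ ≤ 1)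
    {θ : Fin H → EuclideanSpace ℝ (Fin d)}
    (hθ : ∀ h s a s', (M.trans h s a s').toReal = inner ℝ (φ s a s') (θ h))
    {V : S → ℝ} (hV : PMF.IsBdd V) (h : Fin H) (s : S) (a : A) :
    (featureOf φ V s a).ofLp ⬝ᵥ (θ h).ofLp = (M.trans h s a).expect V := by
  rw [dotProduct_ofLp_eq_inner, real_inner_comm, featureOf, PMF.expect]
  have h1 := (innerSL ℝ (θ h)).map_tsum (summable_smul_feature hφ hV s a)
  simp only [innerSL_apply_apply] at h1
  rw [h1]
  refine tsum_congr fun s' => ?_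
  rw [real_inner_smul_right, hθ, real_inner_comm, mul_comm]

/-- The total mass of a transition is a feature of norm at most one paired with a parameter of
norm at most `B`, so that `B ≥ 1`. -/
theorem IsLinearMixture.one_le (hM : IsLinearMixture M φ B) (hH : 0 < H) [Nonempty A] :
    1 ≤ B := by
  obtain ⟨⟨θ, hθB, hθ⟩, hφ⟩ := hM
  obtain ⟨a⟩ := ‹Nonempty A›
  have h1 := featureOf_dotProduct hφ hθ (PMF.IsBdd.const 1) ⟨0, hH⟩ M.start a
  rw [PMF.expect_const, dotProduct_ofLp_eq_inner] at h1
  have h2 := real_inner_le_norm (featureOf φ (fun _ => 1) M.start a) (θ ⟨0, hH⟩)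
  have h3 := hφ (fun _ => 1) (fun _ => by simp) M.start a
  have h4 := hθB ⟨0, hH⟩
  have h5 := mul_le_mul h3 h4 (norm_nonneg _) zero_le_one
  linarith

theorem IsLinearMixture.dim_pos (hM : IsLinearMixture M φ B) (hH : 0 < H) [Nonempty A] :
    0 < d := by
  obtain ⟨⟨θ, hθB, hθ⟩, hφ⟩ := hM
  obtain ⟨a⟩ := ‹Nonempty A›
  have h1 := featureOf_dotProduct hφ hθ (PMF.IsBdd.const 1) ⟨0, hH⟩ M.start a
  rw [PMF.expect_const] at h1
  rcases Nat.eq_zero_or_pos d with rfl | h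
  · simp at h1
  · exact h

end Features

section Estimates

theorem clip_mem_Icc {b : ℝ} (hb : 0 ≤ b) (x : ℝ) : clip b x ∈ Set.Icc 0 b :=
  ⟨le_max_left _ _, max_le hb (min_le_right _ _)⟩

theorem clip_eq_self {b x : ℝ} (hx : x ∈ Set.Icc 0 b) : clip b x = x := by
  rw [clip, min_eq_left hx.2, max_eq_right hx.1]

theorem clip_le_of_le {b x y : ℝ} (hy : 0 ≤ y) (h : x ≤ y) : clip b x ≤ y :=
  max_le hy ((min_le_left _ _).trans h)

theorem clip_mono (b : ℝ) {x y : ℝ} (h : x ≤ y) : clip b x ≤ clip b y :=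
  max_le_max le_rfl (min_le_min h le_rfl)

theorem abs_clip_sub_clip_le (b x y : ℝ) : |clip b x - clip b y| ≤ |x - y| := by
  rw [clip, clip, max_comm 0, max_comm 0]
  exact (abs_max_sub_max_le_abs _ _ _).trans (by
    simpa using abs_min_sub_min_le_max x b y b)

theorem abs_clip_sub_le_min {b x y ε : ℝ} (hb : 0 ≤ b) (hy : y ∈ Set.Icc 0 b)
    (h : |x - y| ≤ ε) : |clip b x - y| ≤ min ε b := by
  refine le_min ?_ ?_
  · conv_lhs => rw [← clip_eq_self hy]
    exact (abs_clip_sub_clip_le _ _ _).trans h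
  · have h1 := clip_mem_Icc hb x
    exact abs_le.mpr ⟨by linarith [h1.1, hy.2], by linarith [h1.2, hy.1]⟩

variable (φ : S → A → S → EuclideanSpace ℝ (Fin d)) (c : Params)
  (st : AlgState S A H d) (k : ℕ) (r : Reward S A H)

theorem sub_nonneg_of_fin (h : Fin H) : (0 : ℝ) ≤ (H : ℝ) - (h : ℕ) := by
  have : ((h : ℕ) : ℝ) ≤ H := by exact_mod_cast h.2.le
  linarith

theorem backup_mem_Icc (h : Fin H) (V : S → ℝ) (s : S) (a : A) :
    st.backup φ c k r h V s a ∈ Set.Icc (0 : ℝ) ((H : ℝ) - (h : ℕ)) :=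
  clip_mem_Icc (sub_nonneg_of_fin h) _

variable [Fintype A]

theorem estV_last : st.estV φ c k r (Fin.last H) = fun _ => 0 := by
  rw [AlgState.estV, Fin.reverseInduction_last]

theorem estV_castSucc (h : Fin H) (s : S) :
    st.estV φ c k r h.castSucc s = (st.nextPolicy c h s).expect fun a =>
      st.backup φ c k r h (st.estV φ c k r h.succ) s a := by
  rw [AlgState.estV, Fin.reverseInduction_castSucc, PMF.expect_fintype]

theorem estV_mem_Icc (i : Fin (H + 1)) (s : S) :
    st.estV φ c k r i s ∈ Set.Icc (0 : ℝ) ((H : ℝ) - (i : ℕ)) := by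
  induction i using Fin.lastCases with
  | last => rw [estV_last]; simp
  | cast h =>
    rw [estV_castSucc]
    exact PMF.expect_mem_Icc _ fun a => backup_mem_Icc φ c st k r h _ s a

theorem estV_mem_Icc_H (i : Fin (H + 1)) (s : S) :
    st.estV φ c k r i s ∈ Set.Icc (0 : ℝ) H := by
  have h := estV_mem_Icc φ c st k r i s
  exact ⟨h.1, h.2.trans (by simp)⟩

theorem estV_sq_mem_Icc (i : Fin (H + 1)) (s : S) :
    st.estV φ c k r i s ^ 2 ∈ Set.Icc (0 : ℝ) ((H : ℝ) ^ 2) := by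
  have h := estV_mem_Icc_H φ c st k r i s
  exact ⟨sq_nonneg _, pow_le_pow_left₀ h.1 h.2 2⟩

end Estimates

end PowerMDP

/-! ### The regressions along a history -/

namespace PowerMDP

open Matrix ListProcess

variable {S : Type u} {A : Type v} {H d : ℕ}

section Radii

/-- The martingale part of the radius `β̂_k`. -/
noncomputable def Params.radHat (c : Params) (d H k : ℕ) : ℝ :=
  8 * Real.sqrt (d * Real.log (1 + k / c.lam) * c.logTerm H k)
    + 4 * Real.sqrt d * c.logTerm H k

/-- The martingale part of the radius `β̄_k`. -/
noncomputable def Params.radBar (c : Params) (d H k : ℕ) : ℝ :=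
  8 * d * Real.sqrt (Real.log (1 + k / c.lam) * c.logTerm H k)
    + 4 * Real.sqrt d * c.logTerm H k

/-- The martingale part of the radius `β̃_k`. -/
noncomputable def Params.radTilde (c : Params) (d H k : ℕ) : ℝ :=
  8 * (H : ℝ) ^ 2 *
      Real.sqrt (d * Real.log (1 + k * (H : ℝ) ^ 4 / (d * c.lam)) * c.logTerm H k)
    + 4 * (H : ℝ) ^ 2 * c.logTerm H k

variable {c : Params}

theorem Params.logTerm_mono (hδ : 0 < c.δ) (hH : 0 < H) {j k : ℕ} (hj : 0 < j) (h : j ≤ k) :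
    c.logTerm H j ≤ c.logTerm H k := by
  have hj' : (0 : ℝ) < j := by exact_mod_cast hj
  have hH' : (0 : ℝ) < H := by exact_mod_cast hH
  have hjk : (j : ℝ) ≤ k := by exact_mod_cast h
  rw [Params.logTerm, Params.logTerm]
  exact Real.log_le_log (by positivity) (by gcongr)

theorem Params.one_le_logTerm (hδ : 0 < c.δ) (hδ1 : c.δ ≤ 1) (hH : 0 < H) {k : ℕ} (hk : 0 < k) :
    1 ≤ c.logTerm H k := by
  have hk' : (1 : ℝ) ≤ k := by exact_mod_cast hk
  have hH' : (1 : ℝ) ≤ H := by exact_mod_cast hH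
  rw [Params.logTerm, Real.le_log_iff_exp_le (by positivity), le_div_iff₀ hδ]
  have h1 : (1 : ℝ) ≤ (k : ℝ) ^ 2 * H := by nlinarith
  nlinarith [Real.exp_one_lt_d9, Real.exp_pos 1]

theorem log_one_add_mul_mono {a : ℝ} (ha : 0 ≤ a) {j k : ℕ} (h : j ≤ k) :
    Real.log (1 + j * a) ≤ Real.log (1 + k * a) :=
  Real.log_le_log (by positivity) (by gcongr)

theorem log_one_add_mul_nonneg {a : ℝ} (ha : 0 ≤ a) (k : ℕ) : 0 ≤ Real.log (1 + k * a) :=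
  Real.log_nonneg (by have : 0 ≤ (k : ℝ) * a := by positivity
                      linarith)

theorem Params.radHat_mono (hlam : 0 < c.lam) (hδ : 0 < c.δ) (hδ1 : c.δ ≤ 1) (hH : 0 < H)
    {j k : ℕ} (hj : 0 < j) (h : j ≤ k) : c.radHat d H j ≤ c.radHat d H k := by
  have h1 := Params.logTerm_mono hδ hH hj h
  have h2 := (Params.one_le_logTerm hδ hδ1 hH hj).trans' zero_le_one
  have ha : 0 ≤ c.lam⁻¹ := by positivity
  have h3 := log_one_add_mul_mono ha h
  have h4 := log_one_add_mul_nonneg ha j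
  simp only [Params.radHat, div_eq_mul_inv]
  have h5 := h4.trans h3
  gcongr

theorem Params.radBar_mono (hlam : 0 < c.lam) (hδ : 0 < c.δ) (hδ1 : c.δ ≤ 1) (hH : 0 < H)
    {j k : ℕ} (hj : 0 < j) (h : j ≤ k) : c.radBar d H j ≤ c.radBar d H k := by
  have h1 := Params.logTerm_mono hδ hH hj h
  have h2 := (Params.one_le_logTerm hδ hδ1 hH hj).trans' zero_le_one
  have ha : 0 ≤ c.lam⁻¹ := by positivity
  have h3 := log_one_add_mul_mono ha h
  have h4 := log_one_add_mul_nonneg ha j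
  simp only [Params.radBar, div_eq_mul_inv]
  have h5 := h4.trans h3
  gcongr

theorem Params.radTilde_mono (hlam : 0 < c.lam) (hδ : 0 < c.δ) (hδ1 : c.δ ≤ 1) (hH : 0 < H)
    {j k : ℕ} (hj : 0 < j) (h : j ≤ k) : c.radTilde d H j ≤ c.radTilde d H k := by
  have h1 := Params.logTerm_mono hδ hH hj h
  have h2 := (Params.one_le_logTerm hδ hδ1 hH hj).trans' zero_le_one
  have ha : 0 ≤ (H : ℝ) ^ 4 / (d * c.lam) := by positivity
  have h3 := log_one_add_mul_mono ha h
  have h4 := log_one_add_mul_nonneg ha j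
  simp only [Params.radTilde, mul_div_assoc]
  have h5 := h4.trans h3
  gcongr

theorem le_sq_sqrt_add {a X Y : ℝ} (ha : 0 ≤ a) (hX : 0 ≤ X) (hY : 0 ≤ Y) :
    64 * a ^ 2 * X ≤ (8 * a * Real.sqrt X + Y) ^ 2 := by
  have h1 := Real.sq_sqrt hX
  have h2 : 0 ≤ 8 * a * Real.sqrt X := by positivity
  calc 64 * a ^ 2 * X = (8 * a * Real.sqrt X) ^ 2 := by rw [mul_pow, mul_pow, h1]; ring
    _ ≤ _ := pow_le_pow_left₀ h2 (by linarith) 2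

end Radii

section Regression

/-- The error of a regularized least squares estimate `Z⁻¹ b`, when `b = Z θ + v - λ θ`. -/
theorem abs_dotProduct_regression_sub_le {Z : Matrix (Fin d) (Fin d) ℝ} (hZ : Z.PosDef) {lam : ℝ}
    (hlam : 0 < lam) (hlow : ∀ u, lam * (u ⬝ᵥ u) ≤ u ⬝ᵥ (Z *ᵥ u))
    {θ : EuclideanSpace ℝ (Fin d)} {B β : ℝ} (hθ : ‖θ‖ ≤ B) {b v : Fin d → ℝ}
    (hb : b = Z *ᵥ θ.ofLp + v - lam • θ.ofLp) (hv : invNorm Z v ≤ β) (x : Fin d → ℝ) :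
    |x ⬝ᵥ (Z⁻¹ *ᵥ b) - x ⬝ᵥ θ.ofLp| ≤ (β + Real.sqrt lam * B) * invNorm Z x := by
  have h1 : x ⬝ᵥ (Z⁻¹ *ᵥ b) - x ⬝ᵥ θ.ofLp = x ⬝ᵥ (Z⁻¹ *ᵥ (v - lam • θ.ofLp)) := by
    rw [hb, add_sub_assoc, mulVec_add, mulVec_mulVec, nonsing_inv_mul _ hZ.isUnit_det, one_mulVec,
      dotProduct_add]
    ring
  have h2 : invNorm Z (lam • θ.ofLp) ≤ Real.sqrt lam * B := by
    have h3 := hZ.inv_smul_dotProduct_le hlam hlow θ.ofLp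
    rw [dotProduct_ofLp_self] at h3
    calc invNorm Z (lam • θ.ofLp) ≤ Real.sqrt (lam * ‖θ‖ ^ 2) := Real.sqrt_le_sqrt h3
      _ = Real.sqrt lam * ‖θ‖ := by
        rw [Real.sqrt_mul hlam.le, Real.sqrt_sq (norm_nonneg _)]
      _ ≤ Real.sqrt lam * B := mul_le_mul_of_nonneg_left hθ (Real.sqrt_nonneg _)
  rw [h1, mul_comm]
  refine (abs_inv_dotProduct_le hZ _ _).trans
    (mul_le_mul_of_nonneg_left ?_ (invNorm_nonneg _ _))
  exact (invNorm_sub_le hZ _ _).trans (add_le_add hv h2)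

end Regression

variable [Fintype A] [Nonempty A] (M : AdversarialMDP S A H)
  (φ : S → A → S → EuclideanSpace ℝ (Fin d)) (c : Params)

/-- The optimistic value functions `V_{k,i}` that POWER computes after the history `hs`. -/
noncomputable def optV (hs : History S A H) (i : Fin (H + 1)) : S → ℝ :=
  (powerState φ c M.reward hs).estV φ c (hs.length + 1) (M.reward hs) i

/-- The optimistic action-value functions `Q_{k,h}` that POWER computes after the history `hs`. -/
noncomputable def optQ (hs : History S A H) (h : Fin H) : S → A → ℝ :=
  (powerState φ c M.reward hs).backup φ c (hs.length + 1) (M.reward hs) h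
    (optV M φ c hs h.succ)

/-- The regressor `φ_V(s,a)` for `V = V_{k,h+1}`. -/
noncomputable def featV (h : Fin H) (hs : History S A H) (p : S × A) : Fin d → ℝ :=
  (featureOf φ (optV M φ c hs h.succ) p.1 p.2).ofLp

/-- The regressor `φ_{V²}(s,a)` for `V = V_{k,h+1}`. -/
noncomputable def featSq (h : Fin H) (hs : History S A H) (p : S × A) : Fin d → ℝ :=
  (featureOf φ (fun s' => optV M φ c hs h.succ s' ^ 2) p.1 p.2).ofLp

/-- The estimated standard deviation `σ̄_{k,h}`, at any state-action pair. -/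
noncomputable def stdV (h : Fin H) (hs : History S A H) (p : S × A) : ℝ :=
  (powerState φ c M.reward hs).sigmaBar φ c (hs.length + 1) h (optV M φ c hs h.succ) p.1 p.2

/-- The regressor weighted by the inverse of the estimated standard deviation. -/
noncomputable def scaledFeat (h : Fin H) (hs : History S A H) (p : S × A) : Fin d → ℝ :=
  (stdV M φ c h hs p)⁻¹ • featV M φ c h hs p

/-- The noise of the weighted regression of `V_{k,h+1}`. -/
noncomputable def scaledNoise (h : Fin H) (hs : History S A H) (p : S × A) (s' : S) : ℝ :=
  (stdV M φ c h hs p)⁻¹ *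
    (optV M φ c hs h.succ s' - (M.trans h p.1 p.2).expect (optV M φ c hs h.succ))

/-- The noise of the regression of `V_{k,h+1}²`. -/
noncomputable def noiseSq (h : Fin H) (hs : History S A H) (p : S × A) (s' : S) : ℝ :=
  optV M φ c hs h.succ s' ^ 2
    - (M.trans h p.1 p.2).expect fun s' => optV M φ c hs h.succ s' ^ 2

/-- The state and the action of stage `h`. -/
def stateAction (h : Fin H) (τ : Trajectory S A H) : S × A := (τ.1 h.castSucc, τ.2 h)

/-- The martingale in the weighted regression of the value functions at stage `h`. -/
noncomputable def scoreHat (h : Fin H) (hs : History S A H) : Fin d → ℝ :=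
  score (fun l τ => scaledFeat M φ c h l (stateAction h τ))
    (fun l τ => scaledNoise M φ c h l (stateAction h τ) (τ.1 h.succ)) hs

/-- The martingale in the regression of the squared value functions at stage `h`. -/
noncomputable def scoreTilde (h : Fin H) (hs : History S A H) : Fin d → ℝ :=
  score (fun l τ => featSq M φ c h l (stateAction h τ))
    (fun l τ => noiseSq M φ c h l (stateAction h τ) (τ.1 h.succ)) hs

variable {M φ c}

theorem sigHat_eq_gram (h : Fin H) (hs : History S A H) :
    (powerState φ c M.reward hs).sigHat h =
      gram c.lam (fun l τ => scaledFeat M φ c h l (stateAction h τ)) hs := by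
  induction hs with
  | nil => rfl
  | cons τ hs ih =>
    rw [gram, ← ih]
    change _ + (stdV M φ c h hs (stateAction h τ) ^ 2)⁻¹ •
      vecMulVec (featV M φ c h hs (stateAction h τ)) (featV M φ c h hs (stateAction h τ)) = _
    rw [scaledFeat, vecMulVec_smul, smul_vecMulVec, smul_smul, sq, mul_inv]

theorem sigTilde_eq_gram (h : Fin H) (hs : History S A H) :
    (powerState φ c M.reward hs).sigTilde h =
      gram c.lam (fun l τ => featSq M φ c h l (stateAction h τ)) hs := by
  induction hs with
  | nil => rfl
  | cons τ hs ih => rw [gram, ← ih]; rfl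

theorem sigHat_posDef (hlam : 0 < c.lam) (h : Fin H) (hs : History S A H) :
    ((powerState φ c M.reward hs).sigHat h).PosDef := by
  rw [sigHat_eq_gram]; exact gram_posDef _ hlam hs

theorem sigTilde_posDef (hlam : 0 < c.lam) (h : Fin H) (hs : History S A H) :
    ((powerState φ c M.reward hs).sigTilde h).PosDef := by
  rw [sigTilde_eq_gram]; exact gram_posDef _ hlam hs

theorem optV_mem_Icc (hs : History S A H) (i : Fin (H + 1)) (s : S) :
    optV M φ c hs i s ∈ Set.Icc (0 : ℝ) H :=
  estV_mem_Icc_H φ c _ _ _ i s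

theorem optV_sq_mem_Icc (hs : History S A H) (i : Fin (H + 1)) (s : S) :
    optV M φ c hs i s ^ 2 ∈ Set.Icc (0 : ℝ) ((H : ℝ) ^ 2) :=
  estV_sq_mem_Icc φ c _ _ _ i s

theorem isBdd_optV (hs : History S A H) (i : Fin (H + 1)) : PMF.IsBdd (optV M φ c hs i) :=
  .of_Icc fun s => optV_mem_Icc hs i s

section Mixture

variable (hφ : ∀ V : S → ℝ, (∀ s, V s ∈ Set.Icc (0 : ℝ) 1) → ∀ s a, ‖featureOf φ V s a‖ ≤ 1)
  {θ : Fin H → EuclideanSpace ℝ (Fin d)}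
  (hθ : ∀ h s a s', (M.trans h s a s').toReal = inner ℝ (φ s a s') (θ h))

include hφ hθ in
theorem featV_dotProduct (h : Fin H) (hs : History S A H) (p : S × A) :
    featV M φ c h hs p ⬝ᵥ (θ h).ofLp = (M.trans h p.1 p.2).expect (optV M φ c hs h.succ) :=
  featureOf_dotProduct hφ hθ (isBdd_optV hs _) h p.1 p.2

include hφ hθ in
theorem featSq_dotProduct (h : Fin H) (hs : History S A H) (p : S × A) :
    featSq M φ c h hs p ⬝ᵥ (θ h).ofLp =
      (M.trans h p.1 p.2).expect fun s' => optV M φ c hs h.succ s' ^ 2 :=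
  featureOf_dotProduct hφ hθ (isBdd_optV hs _).pow_two h p.1 p.2

include hφ hθ in
theorem bHat_eq (h : Fin H) (hs : History S A H) :
    (powerState φ c M.reward hs).bHat h = (powerState φ c M.reward hs).sigHat h *ᵥ (θ h).ofLp
      + scoreHat M φ c h hs - c.lam • (θ h).ofLp := by
  induction hs with
  | nil =>
    change (0 : Fin d → ℝ) = (c.lam • (1 : Matrix (Fin d) (Fin d) ℝ)) *ᵥ (θ h).ofLp + 0 - _
    rw [smul_mulVec, one_mulVec]; simp
  | cons τ hs ih =>
    have hf := featV_dotProduct (c := c) hφ hθ h hs (stateAction h τ)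
    set p := stateAction h τ with hp
    change (powerState φ c M.reward hs).bHat h + ((stdV M φ c h hs p ^ 2)⁻¹ *
        optV M φ c hs h.succ (τ.1 h.succ)) • featV M φ c h hs p =
      ((powerState φ c M.reward hs).sigHat h + (stdV M φ c h hs p ^ 2)⁻¹ •
        vecMulVec (featV M φ c h hs p) (featV M φ c h hs p)) *ᵥ (θ h).ofLp +
      (scoreHat M φ c h hs + scaledNoise M φ c h hs p (τ.1 h.succ) • scaledFeat M φ c h hs p) -
        c.lam • (θ h).ofLp
    rw [ih, add_mulVec, smul_mulVec, vecMulVec_mulVec, hf, scaledFeat, scaledNoise]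
    ext i
    simp only [Pi.add_apply, Pi.sub_apply, Pi.smul_apply, smul_eq_mul, op_smul_eq_smul]
    rw [sq, mul_inv]
    ring

include hφ hθ in
theorem bTilde_eq (h : Fin H) (hs : History S A H) :
    (powerState φ c M.reward hs).bTilde h = (powerState φ c M.reward hs).sigTilde h *ᵥ (θ h).ofLp
      + scoreTilde M φ c h hs - c.lam • (θ h).ofLp := by
  induction hs with
  | nil =>
    change (0 : Fin d → ℝ) = (c.lam • (1 : Matrix (Fin d) (Fin d) ℝ)) *ᵥ (θ h).ofLp + 0 - _
    rw [smul_mulVec, one_mulVec]; simp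
  | cons τ hs ih =>
    have hf := featSq_dotProduct (c := c) hφ hθ h hs (stateAction h τ)
    set p := stateAction h τ with hp
    change (powerState φ c M.reward hs).bTilde h + (optV M φ c hs h.succ (τ.1 h.succ) ^ 2) •
        featSq M φ c h hs p =
      ((powerState φ c M.reward hs).sigTilde h +
        vecMulVec (featSq M φ c h hs p) (featSq M φ c h hs p)) *ᵥ (θ h).ofLp +
      (scoreTilde M φ c h hs + noiseSq M φ c h hs p (τ.1 h.succ) • featSq M φ c h hs p) -
        c.lam • (θ h).ofLp
    rw [ih, add_mulVec, vecMulVec_mulVec, hf, noiseSq]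
    ext i
    simp only [Pi.add_apply, Pi.sub_apply, Pi.smul_apply, smul_eq_mul, op_smul_eq_smul]
    ring

end Mixture

end PowerMDP

/-! ### Confidence sets -/

namespace PowerMDP

open Matrix ListProcess

variable {S : Type u} {A : Type v} {H d : ℕ}
variable [Fintype A] [Nonempty A] {M : AdversarialMDP S A H}
  {φ : S → A → S → EuclideanSpace ℝ (Fin d)} {c : Params}

/-- The confidence set `‖θ̃_{k,h} - θ_h‖ ≤ β̃_k`, in terms of the martingale part of the error. -/
def TildeConfident (M : AdversarialMDP S A H) (φ : S → A → S → EuclideanSpace ℝ (Fin d))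
    (c : Params) (h : Fin H) (hs : History S A H) : Prop :=
  invNorm ((powerState φ c M.reward hs).sigTilde h) (scoreTilde M φ c h hs) ≤
    c.radTilde d H (hs.length + 1)

/-- The confidence set `‖θ̂_{k,h} - θ_h‖ ≤ β̄_k`, in terms of the martingale part of the error. -/
def BarConfident (M : AdversarialMDP S A H) (φ : S → A → S → EuclideanSpace ℝ (Fin d))
    (c : Params) (h : Fin H) (hs : History S A H) : Prop :=
  invNorm ((powerState φ c M.reward hs).sigHat h) (scoreHat M φ c h hs) ≤
    c.radBar d H (hs.length + 1)

/-- The confidence set `‖θ̂_{k,h} - θ_h‖ ≤ β̂_k`, in terms of the martingale part of the error. -/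
def HatConfident (M : AdversarialMDP S A H) (φ : S → A → S → EuclideanSpace ℝ (Fin d))
    (c : Params) (h : Fin H) (hs : History S A H) : Prop :=
  invNorm ((powerState φ c M.reward hs).sigHat h) (scoreHat M φ c h hs) ≤
    c.radHat d H (hs.length + 1)

section Deterministic

variable (hφ : ∀ V : S → ℝ, (∀ s, V s ∈ Set.Icc (0 : ℝ) 1) → ∀ s a, ‖featureOf φ V s a‖ ≤ 1)
  {θ : Fin H → EuclideanSpace ℝ (Fin d)} (hθB : ∀ h, ‖θ h‖ ≤ c.B)
  (hθ : ∀ h s a s', (M.trans h s a s').toReal = inner ℝ (φ s a s') (θ h))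
  (hlam : 0 < c.lam)

include hφ hθB hθ hlam

theorem abs_thetaTilde_error_le {h : Fin H} {hs : History S A H}
    (hc : TildeConfident M φ c h hs) (p : S × A) :
    |featSq M φ c h hs p ⬝ᵥ (powerState φ c M.reward hs).thetaTilde h -
        (M.trans h p.1 p.2).expect fun s' => optV M φ c hs h.succ s' ^ 2| ≤
      c.betaTilde d H (hs.length + 1) *
        invNorm ((powerState φ c M.reward hs).sigTilde h) (featSq M φ c h hs p) := by
  rw [← featSq_dotProduct hφ hθ]
  refine abs_dotProduct_regression_sub_le (sigTilde_posDef hlam h hs) hlam (fun u => ?_) (hθB h)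
    (bTilde_eq hφ hθ h hs) hc _
  rw [sigTilde_eq_gram]
  exact le_dotProduct_gram _ hs u

theorem abs_thetaHat_error_le {h : Fin H} {hs : History S A H} {β : ℝ}
    (hc : invNorm ((powerState φ c M.reward hs).sigHat h) (scoreHat M φ c h hs) ≤ β)
    (p : S × A) :
    |featV M φ c h hs p ⬝ᵥ (powerState φ c M.reward hs).thetaHat h -
        (M.trans h p.1 p.2).expect (optV M φ c hs h.succ)| ≤
      (β + Real.sqrt c.lam * c.B) *
        invNorm ((powerState φ c M.reward hs).sigHat h) (featV M φ c h hs p) := by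
  rw [← featV_dotProduct hφ hθ]
  refine abs_dotProduct_regression_sub_le (sigHat_posDef hlam h hs) hlam (fun u => ?_) (hθB h)
    (bHat_eq hφ hθ h hs) hc _
  rw [sigHat_eq_gram]
  exact le_dotProduct_gram _ hs u

/-- The bonus dominates the error of the variance estimate. -/
theorem abs_estVar_sub_variance_le {h : Fin H} {hs : History S A H}
    (ht : TildeConfident M φ c h hs) (hb : BarConfident M φ c h hs) (p : S × A) :
    |(powerState φ c M.reward hs).estVar φ h (optV M φ c hs h.succ) p.1 p.2 -
        (M.trans h p.1 p.2).variance (optV M φ c hs h.succ)| ≤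
      (powerState φ c M.reward hs).bonus φ c (hs.length + 1) h (optV M φ c hs h.succ)
        p.1 p.2 := by
  have hH0 : (0 : ℝ) ≤ H := by positivity
  have h1 := abs_thetaTilde_error_le hφ hθB hθ hlam ht p
  have h2 := abs_thetaHat_error_le hφ hθB hθ hlam hb p
  have hm2 := (M.trans h p.1 p.2).expect_mem_Icc
    (fun s' => optV_sq_mem_Icc (M := M) (φ := φ) (c := c) hs h.succ s')
  have hm1 := (M.trans h p.1 p.2).expect_mem_Icc
    (fun s' => optV_mem_Icc (M := M) (φ := φ) (c := c) hs h.succ s')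
  have h3 := abs_clip_sub_le_min (by positivity) hm2 h1
  have h4 := (abs_clip_sub_clip_le H _ _).trans h2
  rw [clip_eq_self hm1] at h4
  change |clip ((H : ℝ) ^ 2) (featSq M φ c h hs p ⬝ᵥ (powerState φ c M.reward hs).thetaTilde h)
      - clip H (featV M φ c h hs p ⬝ᵥ (powerState φ c M.reward hs).thetaHat h) ^ 2 - _| ≤
    min (c.betaTilde d H (hs.length + 1) *
        invNorm ((powerState φ c M.reward hs).sigTilde h) (featSq M φ c h hs p)) ((H : ℝ) ^ 2)
      + min (2 * H * c.betaBar d H (hs.length + 1) *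
        invNorm ((powerState φ c M.reward hs).sigHat h) (featV M φ c h hs p)) ((H : ℝ) ^ 2)
  have hx := clip_mem_Icc hH0
    (featV M φ c h hs p ⬝ᵥ (powerState φ c M.reward hs).thetaHat h)
  rw [PMF.variance]
  set a := clip ((H : ℝ) ^ 2)
    (featSq M φ c h hs p ⬝ᵥ (powerState φ c M.reward hs).thetaTilde h)
  set x := clip H (featV M φ c h hs p ⬝ᵥ (powerState φ c M.reward hs).thetaHat h)
  set m2 := (M.trans h p.1 p.2).expect fun s' => optV M φ c hs h.succ s' ^ 2
  set m1 := (M.trans h p.1 p.2).expect (optV M φ c hs h.succ)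
  change |x - m1| ≤ c.betaBar d H (hs.length + 1) * _ at h4
  have h5 : |x ^ 2 - m1 ^ 2| ≤ min (2 * H * c.betaBar d H (hs.length + 1) *
        invNorm ((powerState φ c M.reward hs).sigHat h) (featV M φ c h hs p)) ((H : ℝ) ^ 2) := by
    refine le_min ?_ ?_
    · have h6 : |x + m1| ≤ 2 * H := abs_le.mpr
        ⟨by linarith [hx.1, hm1.1], by linarith [hx.2, hm1.2]⟩
      calc |x ^ 2 - m1 ^ 2| = |x + m1| * |x - m1| := by rw [← abs_mul]; congr 1; ring
        _ ≤ 2 * H * (c.betaBar d H (hs.length + 1) *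
          invNorm ((powerState φ c M.reward hs).sigHat h) (featV M φ c h hs p)) :=
            mul_le_mul h6 h4 (abs_nonneg _) (by positivity)
        _ = _ := by ring
    · have h7 := pow_le_pow_left₀ hx.1 hx.2 2
      have h8 := pow_le_pow_left₀ hm1.1 hm1.2 2
      exact abs_le.mpr ⟨by linarith [sq_nonneg x], by linarith [sq_nonneg m1]⟩
  calc |a - x ^ 2 - (m2 - m1 ^ 2)| = |(a - m2) - (x ^ 2 - m1 ^ 2)| := by congr 1; ring
    _ ≤ |a - m2| + |x ^ 2 - m1 ^ 2| := abs_sub _ _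
    _ ≤ _ := add_le_add h3 h5

theorem variance_le_sq_stdV {h : Fin H} {hs : History S A H}
    (ht : TildeConfident M φ c h hs) (hb : BarConfident M φ c h hs) (p : S × A) :
    (M.trans h p.1 p.2).variance (optV M φ c hs h.succ) ≤ stdV M φ c h hs p ^ 2 := by
  have h1 := (abs_le.mp (abs_estVar_sub_variance_le hφ hθB hθ hlam ht hb p)).1
  rw [stdV, AlgState.sigmaBar, Real.sq_sqrt (le_max_of_le_left (by positivity))]
  exact le_max_of_le_right (by linarith)

end Deterministic

theorem sq_stdV (h : Fin H) (hs : History S A H) (p : S × A) :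
    stdV M φ c h hs p ^ 2 = max ((H : ℝ) ^ 2 / d)
      ((powerState φ c M.reward hs).estVar φ h (optV M φ c hs h.succ) p.1 p.2 +
        (powerState φ c M.reward hs).bonus φ c (hs.length + 1) h (optV M φ c hs h.succ)
          p.1 p.2) := by
  rw [stdV, AlgState.sigmaBar, Real.sq_sqrt (le_max_of_le_left (by positivity))]

theorem stdV_pos (hH : 0 < H) (hd : 0 < d) (h : Fin H) (hs : History S A H) (p : S × A) :
    0 < stdV M φ c h hs p := by
  have hH' : (0 : ℝ) < H := by exact_mod_cast hH
  have hd' : (0 : ℝ) < d := by exact_mod_cast hd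
  exact Real.sqrt_pos.mpr (lt_max_of_lt_left (by positivity))

theorem H_le_sqrt_mul_stdV (hd : 0 < d) (h : Fin H) (hs : History S A H) (p : S × A) :
    (H : ℝ) ≤ Real.sqrt d * stdV M φ c h hs p := by
  have hd' : (0 : ℝ) < d := by exact_mod_cast hd
  have h1 : (H : ℝ) ^ 2 / d ≤ stdV M φ c h hs p ^ 2 := by
    rw [sq_stdV]; exact le_max_left _ _
  have h0 : 0 ≤ stdV M φ c h hs p := Real.sqrt_nonneg _
  refine (sq_le_sq₀ (by positivity) (by positivity)).mp ?_
  rw [mul_pow, Real.sq_sqrt hd'.le]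
  rwa [div_le_iff₀ hd', mul_comm] at h1

theorem inv_stdV_mul_H_le (hH : 0 < H) (hd : 0 < d) (h : Fin H) (hs : History S A H)
    (p : S × A) : (stdV M φ c h hs p)⁻¹ * H ≤ Real.sqrt d := by
  have h1 := H_le_sqrt_mul_stdV (M := M) (φ := φ) (c := c) hd h hs p
  have h2 := stdV_pos (M := M) (φ := φ) (c := c) hH hd h hs p
  rw [inv_mul_le_iff₀ h2, mul_comm]
  exact h1

section Bounds

variable (hφ : ∀ V : S → ℝ, (∀ s, V s ∈ Set.Icc (0 : ℝ) 1) → ∀ s a, ‖featureOf φ V s a‖ ≤ 1)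

include hφ in
theorem featSq_dotProduct_self_le (hH : 0 < H) (h : Fin H) (hs : History S A H) (p : S × A) :
    featSq M φ c h hs p ⬝ᵥ featSq M φ c h hs p ≤ (H : ℝ) ^ 4 := by
  have hH' : (0 : ℝ) < H := by exact_mod_cast hH
  rw [featSq, dotProduct_ofLp_self]
  have := norm_featureOf_le hφ (b := (H : ℝ) ^ 2) (by positivity)
    (fun s' => optV_sq_mem_Icc (M := M) (φ := φ) (c := c) hs h.succ s') p.1 p.2
  calc _ ≤ ((H : ℝ) ^ 2) ^ 2 := pow_le_pow_left₀ (norm_nonneg _) this 2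
    _ = _ := by ring

include hφ in
theorem scaledFeat_dotProduct_self_le (hH : 0 < H) (hd : 0 < d) (h : Fin H) (hs : History S A H)
    (p : S × A) : scaledFeat M φ c h hs p ⬝ᵥ scaledFeat M φ c h hs p ≤ d := by
  have hH' : (0 : ℝ) < H := by exact_mod_cast hH
  have h2 := stdV_pos (M := M) (φ := φ) (c := c) hH hd h hs p
  rw [scaledFeat, smul_dotProduct, dotProduct_smul, featV, dotProduct_ofLp_self, smul_eq_mul,
    smul_eq_mul]
  have h1 := norm_featureOf_le hφ hH'
    (fun s' => optV_mem_Icc (M := M) (φ := φ) (c := c) hs h.succ s') p.1 p.2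
  have h3 : (stdV M φ c h hs p)⁻¹ * ‖featureOf φ (optV M φ c hs h.succ) p.1 p.2‖ ≤ Real.sqrt d :=
    (mul_le_mul_of_nonneg_left h1 (by positivity)).trans (inv_stdV_mul_H_le hH hd h hs p)
  calc _ = ((stdV M φ c h hs p)⁻¹ * ‖featureOf φ (optV M φ c hs h.succ) p.1 p.2‖) ^ 2 := by ring
    _ ≤ Real.sqrt d ^ 2 := pow_le_pow_left₀ (by positivity) h3 2
    _ = d := Real.sq_sqrt (by positivity)

end Bounds

theorem abs_sub_expect_le {p : PMF S} {f : S → ℝ} {b : ℝ} (hf : ∀ s, f s ∈ Set.Icc 0 b) (s : S) :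
    |f s - p.expect f| ≤ b := by
  have h1 := p.expect_mem_Icc hf
  exact abs_le.mpr ⟨by linarith [h1.2, (hf s).1], by linarith [h1.1, (hf s).2]⟩

theorem abs_scaledNoise_le (hH : 0 < H) (hd : 0 < d) (h : Fin H) (hs : History S A H) (p : S × A)
    (s' : S) : |scaledNoise M φ c h hs p s'| ≤ Real.sqrt d := by
  have h2 := stdV_pos (M := M) (φ := φ) (c := c) hH hd h hs p
  rw [scaledNoise, abs_mul, abs_of_pos (inv_pos.mpr h2)]
  exact (mul_le_mul_of_nonneg_left (abs_sub_expect_le (optV_mem_Icc hs h.succ) s')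
    (by positivity)).trans (inv_stdV_mul_H_le hH hd h hs p)

theorem expect_scaledNoise (h : Fin H) (hs : History S A H) (p : S × A) :
    (M.trans h p.1 p.2).expect (scaledNoise M φ c h hs p) = 0 := by
  have hN : scaledNoise M φ c h hs p = fun s' => (stdV M φ c h hs p)⁻¹ *
      (optV M φ c hs h.succ s' - (M.trans h p.1 p.2).expect (optV M φ c hs h.succ)) := rfl
  rw [hN, PMF.expect_const_mul, PMF.expect_sub _ (isBdd_optV hs _) (.const _), PMF.expect_const,
    sub_self, mul_zero]

theorem expect_scaledNoise_sq (h : Fin H) (hs : History S A H) (p : S × A) :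
    (M.trans h p.1 p.2).expect (fun s' => scaledNoise M φ c h hs p s' ^ 2) =
      (stdV M φ c h hs p ^ 2)⁻¹ * (M.trans h p.1 p.2).variance (optV M φ c hs h.succ) := by
  simp only [scaledNoise, mul_pow, PMF.expect_const_mul]
  rw [PMF.expect_sub_mean_sq _ (isBdd_optV hs _), inv_pow]

theorem abs_noiseSq_le (h : Fin H) (hs : History S A H) (p : S × A) (s' : S) :
    |noiseSq M φ c h hs p s'| ≤ (H : ℝ) ^ 2 :=
  abs_sub_expect_le (optV_sq_mem_Icc hs h.succ) s'

theorem expect_noiseSq (h : Fin H) (hs : History S A H) (p : S × A) :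
    (M.trans h p.1 p.2).expect (noiseSq M φ c h hs p) = 0 := by
  have hN : noiseSq M φ c h hs p = fun s' => optV M φ c hs h.succ s' ^ 2 -
      (M.trans h p.1 p.2).expect fun s' => optV M φ c hs h.succ s' ^ 2 := rfl
  rw [hN, PMF.expect_sub _ (isBdd_optV hs _).pow_two (.const _), PMF.expect_const, sub_self]

theorem expect_sq_le_of_abs_le {p : PMF S} {f : S → ℝ} {b : ℝ} (hf : ∀ s, |f s| ≤ b) :
    p.expect (fun s => f s ^ 2) ≤ b ^ 2 :=
  p.expect_le_of_le (PMF.IsBdd.pow_two ⟨b, hf⟩) fun s => by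
    rw [← sq_abs]; exact pow_le_pow_left₀ (abs_nonneg _) (hf s) 2

theorem logTerm_eq (c : Params) (H t : ℕ) :
    Real.log (4 * (t : ℝ) ^ 2 / (c.δ / H)) = c.logTerm H t := by
  rw [Params.logTerm, div_div_eq_mul_div]

theorem score_congr_of_suffix {E : Type*} {x : List E → E → Fin d → ℝ} {f g : List E → E → ℝ}
    {hs : List E} (h : ∀ e l, (e :: l) <:+ hs → f l e = g l e) : score x f hs = score x g hs := by
  induction hs with
  | nil => rfl
  | cons e hs ih =>
    rw [score, score, ih fun e' l hl => h e' l (hl.trans (List.suffix_cons _ _)),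
      h e hs List.suffix_rfl]

section Probability

variable (hφ : ∀ V : S → ℝ, (∀ s, V s ∈ Set.Icc (0 : ℝ) 1) → ∀ s a, ‖featureOf φ V s a‖ ≤ 1)
  (hH : 0 < H) (hd : 0 < d) (hlam : 0 < c.lam) (hδ : 0 < c.δ) (hδ1 : c.δ ≤ 1)

include hφ hH hd hlam hδ hδ1

/-- The radii of the episode after `t` finished ones have the index `t + 1`, which only enlarges the
radius needed for the `t` terms of the martingale. -/
theorem prob_not_tildeConfident_le (h : Fin H) (K : ℕ) :
    (M.historyLaw (power φ c M.reward) K).toOuterMeasure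
      {hs | ∃ l, l <:+ hs ∧ ¬TildeConfident M φ c h l} ≤ ENNReal.ofReal (c.δ / H) := by
  have hH' : (1 : ℝ) ≤ H := by exact_mod_cast hH
  have hd' : (0 : ℝ) < d := by exact_mod_cast hd
  have hrad : ∀ k : ℕ, 0 < k → 0 ≤ c.logTerm H k ∧
      0 ≤ Real.log (1 + k * (H : ℝ) ^ 4 / (d * c.lam)) := fun k hk =>
    ⟨(Params.one_le_logTerm hδ hδ1 hH hk).trans' zero_le_one,
      by simpa only [mul_div_assoc] using
        log_one_add_mul_nonneg (a := (H : ℝ) ^ 4 / (d * c.lam)) (by positivity) k⟩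
  rw [M.historyLaw_eq_listLaw]
  refine (MeasureTheory.measure_mono fun hs hl => ?_).trans
    (prob_exists_lt_invNorm_score (M.drawnFrom (power φ c M.reward) h) hlam hd
      (x := featSq M φ c h) (η := noiseSq M φ c h) (R := (H : ℝ) ^ 2) (σ2 := ((H : ℝ) ^ 2) ^ 2)
      (L2 := (H : ℝ) ^ 4) (β := fun t => c.radTilde d H (t + 1)) (by positivity)
      (featSq_dotProduct_self_le hφ hH h) (abs_noiseSq_le h) (expect_noiseSq h)
      (fun l p => expect_sq_le_of_abs_le (abs_noiseSq_le h l p)) (by positivity) (by positivity)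
      (by rw [div_le_one (by positivity)]; exact hδ1.trans hH')
      (fun j k hjk => Params.radTilde_mono hlam hδ hδ1 hH (Nat.succ_pos _) (by omega)) ?_ ?_ ?_ K)
  · obtain ⟨l, hl, hn⟩ := hl
    refine ⟨l, hl, ?_⟩
    rw [TildeConfident, not_le, sigTilde_eq_gram] at hn
    exact hn
  · have := hrad 1 one_pos
    simp only [Params.radTilde]
    have h1 := this.1
    positivity
  · intro t ht
    rw [logTerm_eq]
    refine le_trans ?_ (Params.radTilde_mono hlam hδ hδ1 hH ht (Nat.le_succ t))
    rw [Params.radTilde]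
    exact le_add_of_nonneg_left (by positivity)
  · intro t ht
    rw [logTerm_eq]
    obtain ⟨h1, h2⟩ := hrad t ht
    have h3 := le_sq_sqrt_add (a := (H : ℝ) ^ 2)
      (X := d * Real.log (1 + t * (H : ℝ) ^ 4 / (d * c.lam)) * c.logTerm H t)
      (Y := 4 * (H : ℝ) ^ 2 * c.logTerm H t) (by positivity) (by positivity) (by positivity)
    calc _ = 64 * ((H : ℝ) ^ 2) ^ 2 *
          (d * Real.log (1 + t * (H : ℝ) ^ 4 / (d * c.lam)) * c.logTerm H t) := by ring
      _ ≤ c.radTilde d H t ^ 2 := h3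
      _ ≤ _ := pow_le_pow_left₀ (by rw [Params.radTilde]; positivity)
        (Params.radTilde_mono hlam hδ hδ1 hH ht (Nat.le_succ t)) 2

theorem prob_not_barConfident_le (h : Fin H) (K : ℕ) :
    (M.historyLaw (power φ c M.reward) K).toOuterMeasure
      {hs | ∃ l, l <:+ hs ∧ ¬BarConfident M φ c h l} ≤ ENNReal.ofReal (c.δ / H) := by
  have hH' : (1 : ℝ) ≤ H := by exact_mod_cast hH
  have hd' : (0 : ℝ) < d := by exact_mod_cast hd
  have hrad : ∀ k : ℕ, 0 < k → 0 ≤ c.logTerm H k ∧ 0 ≤ Real.log (1 + k / c.lam) := fun k hk =>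
    ⟨(Params.one_le_logTerm hδ hδ1 hH hk).trans' zero_le_one,
      by simpa only [div_eq_mul_inv] using
        log_one_add_mul_nonneg (a := c.lam⁻¹) (by positivity) k⟩
  rw [M.historyLaw_eq_listLaw]
  refine (MeasureTheory.measure_mono fun hs hl => ?_).trans
    (prob_exists_lt_invNorm_score (M.drawnFrom (power φ c M.reward) h) hlam hd
      (x := scaledFeat M φ c h) (η := scaledNoise M φ c h) (R := Real.sqrt d)
      (σ2 := Real.sqrt d ^ 2) (L2 := d) (β := fun t => c.radBar d H (t + 1)) (by positivity)
      (scaledFeat_dotProduct_self_le hφ hH hd h) (abs_scaledNoise_le hH hd h)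
      (expect_scaledNoise h)
      (fun l p => expect_sq_le_of_abs_le (abs_scaledNoise_le hH hd h l p)) (by positivity)
      (by positivity) (by rw [div_le_one (by positivity)]; exact hδ1.trans hH')
      (fun j k hjk => Params.radBar_mono hlam hδ hδ1 hH (Nat.succ_pos _) (by omega)) ?_ ?_ ?_ K)
  · obtain ⟨l, hl, hn⟩ := hl
    refine ⟨l, hl, ?_⟩
    rw [BarConfident, not_le, sigHat_eq_gram] at hn
    exact hn
  · have h1 := (hrad 1 one_pos).1
    simp only [Params.radBar]
    positivity
  · intro t ht
    rw [logTerm_eq]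
    refine le_trans ?_ (Params.radBar_mono hlam hδ hδ1 hH ht (Nat.le_succ t))
    rw [Params.radBar]
    exact le_add_of_nonneg_left (by positivity)
  · intro t ht
    rw [logTerm_eq, mul_comm (d : ℝ) c.lam, mul_div_mul_right _ _ hd'.ne', Real.sq_sqrt hd'.le]
    obtain ⟨h1, h2⟩ := hrad t ht
    have h3 := le_sq_sqrt_add (a := (d : ℝ))
      (X := Real.log (1 + t / c.lam) * c.logTerm H t)
      (Y := 4 * Real.sqrt d * c.logTerm H t) (by positivity) (by positivity) (by positivity)
    calc _ = 64 * (d : ℝ) ^ 2 * (Real.log (1 + t / c.lam) * c.logTerm H t) := by ring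
      _ ≤ c.radBar d H t ^ 2 := h3
      _ ≤ _ := pow_le_pow_left₀ (by rw [Params.radBar]; positivity)
        (Params.radBar_mono hlam hδ hδ1 hH ht (Nat.le_succ t)) 2

/-- The sharper radius `β̂` for the noise that is switched off when the variance estimate may be
wrong, so that its conditional variance is at most one. -/
theorem prob_not_hatConfident_le {θ : Fin H → EuclideanSpace ℝ (Fin d)}
    (hθB : ∀ h, ‖θ h‖ ≤ c.B)
    (hθ : ∀ h s a s', (M.trans h s a s').toReal = inner ℝ (φ s a s') (θ h))
    (h : Fin H) (K : ℕ) :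
    (M.historyLaw (power φ c M.reward) K).toOuterMeasure
      {hs | (∃ l, l <:+ hs ∧ ¬HatConfident M φ c h l) ∧
        ∀ l, l <:+ hs → TildeConfident M φ c h l ∧ BarConfident M φ c h l} ≤
      ENNReal.ofReal (c.δ / H) := by
  classical
  have hH' : (1 : ℝ) ≤ H := by exact_mod_cast hH
  have hd' : (0 : ℝ) < d := by exact_mod_cast hd
  have hrad : ∀ k : ℕ, 0 < k → 0 ≤ c.logTerm H k ∧ 0 ≤ Real.log (1 + k / c.lam) := fun k hk =>
    ⟨(Params.one_le_logTerm hδ hδ1 hH hk).trans' zero_le_one,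
      by simpa only [div_eq_mul_inv] using
        log_one_add_mul_nonneg (a := c.lam⁻¹) (by positivity) k⟩
  let N : History S A H → S × A → S → ℝ := fun l p s' =>
    if TildeConfident M φ c h l ∧ BarConfident M φ c h l then scaledNoise M φ c h l p s' else 0
  have hNabs : ∀ l p s', |N l p s'| ≤ Real.sqrt d := by
    intro l p s'
    by_cases hg : TildeConfident M φ c h l ∧ BarConfident M φ c h l
    · simpa only [N, if_pos hg] using abs_scaledNoise_le hH hd h l p s'
    · simp only [N, if_neg hg, abs_zero]; positivity
  have hNmean : ∀ (l : History S A H) (p : S × A), (M.trans h p.1 p.2).expect (N l p) = 0 := by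
    intro l p
    by_cases hg : TildeConfident M φ c h l ∧ BarConfident M φ c h l
    · simpa only [N, if_pos hg] using expect_scaledNoise h l p
    · simp only [N, if_neg hg]; exact PMF.expect_const _ 0
  have hNvar : ∀ (l : History S A H) (p : S × A),
      (M.trans h p.1 p.2).expect (fun s' => N l p s' ^ 2) ≤ 1 := by
    intro l p
    by_cases hg : TildeConfident M φ c h l ∧ BarConfident M φ c h l
    · simp only [N, if_pos hg]
      have h2 := stdV_pos (M := M) (φ := φ) (c := c) hH hd h l p
      rw [expect_scaledNoise_sq, inv_mul_le_iff₀ (by positivity), mul_one]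
      exact variance_le_sq_stdV hφ hθB hθ hlam hg.1 hg.2 p
    · simp only [N, if_neg hg]
      norm_num [PMF.expect_const]
  rw [M.historyLaw_eq_listLaw]
  refine (MeasureTheory.measure_mono fun hs hl => ?_).trans
    (prob_exists_lt_invNorm_score (M.drawnFrom (power φ c M.reward) h) hlam hd
      (x := scaledFeat M φ c h) (η := N) (R := Real.sqrt d)
      (σ2 := 1) (L2 := d) (β := fun t => c.radHat d H (t + 1)) (by positivity)
      (scaledFeat_dotProduct_self_le hφ hH hd h) hNabs hNmean hNvar zero_le_one
      (by positivity) (by rw [div_le_one (by positivity)]; exact hδ1.trans hH')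
      (fun j k hjk => Params.radHat_mono hlam hδ hδ1 hH (Nat.succ_pos _) (by omega)) ?_ ?_ ?_ K)
  · obtain ⟨⟨l, hl, hn⟩, hgood⟩ := hl
    refine ⟨l, hl, ?_⟩
    rw [HatConfident, not_le, sigHat_eq_gram] at hn
    have h1 : scoreHat M φ c h l = score (fun l τ => scaledFeat M φ c h l (stateAction h τ))
        (fun l τ => N l (stateAction h τ) (τ.1 h.succ)) l :=
      score_congr_of_suffix fun τ l' hl' =>
        (if_pos (hgood l' (((List.suffix_cons τ l').trans hl').trans hl))).symm
    rw [h1] at hn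
    exact hn
  · have h1 := (hrad 1 one_pos).1
    simp only [Params.radHat]
    positivity
  · intro t ht
    rw [logTerm_eq]
    refine le_trans ?_ (Params.radHat_mono hlam hδ hδ1 hH ht (Nat.le_succ t))
    rw [Params.radHat]
    exact le_add_of_nonneg_left (by positivity)
  · intro t ht
    rw [logTerm_eq, mul_comm (d : ℝ) c.lam, mul_div_mul_right _ _ hd'.ne']
    obtain ⟨h1, h2⟩ := hrad t ht
    have h3 := le_sq_sqrt_add (a := 1)
      (X := d * Real.log (1 + t / c.lam) * c.logTerm H t)
      (Y := 4 * Real.sqrt d * c.logTerm H t) (by positivity) (by positivity) (by positivity)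
    rw [mul_one] at h3
    calc _ = 64 * 1 ^ 2 * (d * Real.log (1 + t / c.lam) * c.logTerm H t) := by ring
      _ ≤ c.radHat d H t ^ 2 := h3
      _ ≤ _ := pow_le_pow_left₀ (by rw [Params.radHat]; positivity)
        (Params.radHat_mono hlam hδ hδ1 hH ht (Nat.le_succ t)) 2

/-- All confidence sets, of all stages and episodes, hold simultaneously with high probability. -/
theorem prob_not_confident_le {θ : Fin H → EuclideanSpace ℝ (Fin d)}
    (hθB : ∀ h, ‖θ h‖ ≤ c.B)
    (hθ : ∀ h s a s', (M.trans h s a s').toReal = inner ℝ (φ s a s') (θ h)) (K : ℕ) :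
    (M.historyLaw (power φ c M.reward) K).toOuterMeasure
      {hs | ¬∀ h, ∀ l, l <:+ hs →
        TildeConfident M φ c h l ∧ BarConfident M φ c h l ∧ HatConfident M φ c h l} ≤
      ENNReal.ofReal (3 * c.δ) := by
  have hH' : (0 : ℝ) < H := by exact_mod_cast hH
  have hsub : {hs : History S A H | ¬∀ h, ∀ l, l <:+ hs →
        TildeConfident M φ c h l ∧ BarConfident M φ c h l ∧ HatConfident M φ c h l} ⊆
      ⋃ h : Fin H, (({hs | ∃ l, l <:+ hs ∧ ¬TildeConfident M φ c h l} ∪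
        {hs | ∃ l, l <:+ hs ∧ ¬BarConfident M φ c h l}) ∪
        {hs | (∃ l, l <:+ hs ∧ ¬HatConfident M φ c h l) ∧
          ∀ l, l <:+ hs → TildeConfident M φ c h l ∧ BarConfident M φ c h l}) := by
    intro hs hbad
    simp only [Set.mem_ofPred_eq, not_forall] at hbad
    obtain ⟨h, l, hl, hn⟩ := hbad
    simp only [Set.mem_iUnion, Set.mem_union, Set.mem_ofPred_eq]
    refine ⟨h, ?_⟩
    by_contra hcon
    push Not at hcon
    obtain ⟨⟨h1, h2⟩, h3⟩ := hcon
    obtain ⟨l', hl', h4⟩ := h3 ⟨l, hl, fun hh => hn ⟨h1 l hl, h2 l hl, hh⟩⟩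
    exact h4 (h1 l' hl') (h2 l' hl')
  refine (MeasureTheory.measure_mono hsub).trans
    ((MeasureTheory.measure_iUnion_fintype_le _ _).trans ?_)
  have hδH : 0 ≤ c.δ / H := by positivity
  calc _ ≤ ∑ _h : Fin H, ENNReal.ofReal (3 * (c.δ / H)) := by
        refine Finset.sum_le_sum fun h _ => ?_
        refine (MeasureTheory.measure_union_le _ _).trans ((add_le_add
          ((MeasureTheory.measure_union_le _ _).trans (add_le_add
            (prob_not_tildeConfident_le hφ hH hd hlam hδ hδ1 h K)
            (prob_not_barConfident_le hφ hH hd hlam hδ hδ1 h K)))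
          (prob_not_hatConfident_le hφ hH hd hlam hδ hδ1 hθB hθ h K)).trans (le_of_eq ?_))
        rw [← ENNReal.ofReal_add hδH hδH, ← ENNReal.ofReal_add (by positivity) hδH]
        congr 1; ring
    _ = ENNReal.ofReal (3 * c.δ) := by
        rw [← ENNReal.ofReal_sum_of_nonneg fun _ _ => by positivity]
        congr 1
        rw [Finset.sum_const, Finset.card_univ, Fintype.card_fin, nsmul_eq_mul]
        field_simp

end Probability

end PowerMDP

/-! ### Exponential weights, optimism and total variance -/

namespace PMF

/-- Hoeffding's lemma for a distribution on a finite type. -/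
theorem log_expect_exp_le {A : Type*} [Fintype A] (p : PMF A) {q : A → ℝ} {b : ℝ}
    (hq : ∀ a, q a ∈ Set.Icc 0 b) (α : ℝ) :
    Real.log (p.expect fun a => Real.exp (α * q a)) ≤ α * p.expect q + α ^ 2 * b ^ 2 / 8 := by
  let _ : MeasurableSpace A := ⊤
  have hint : ∀ f : A → ℝ, ∫ a, f a ∂p.toMeasure = p.expect f := fun f => by
    rw [PMF.integral_eq_sum, expect_fintype]; rfl
  have h1 := (ProbabilityTheory.hasSubgaussianMGF_of_mem_Icc (μ := p.toMeasure) (X := q)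
    (a := 0) (b := b) (measurable_of_finite q).aemeasurable
    (Filter.Eventually.of_forall hq)).mgf_le α
  rw [ProbabilityTheory.mgf, hint, hint] at h1
  have h2 : (fun a => Real.exp (α * (q a - p.expect q))) = fun a =>
      Real.exp (-(α * p.expect q)) * Real.exp (α * q a) := by
    funext a; rw [← Real.exp_add]; ring_nf
  rw [h2, expect_const_mul, Real.exp_neg, inv_mul_le_iff₀ (Real.exp_pos _), ← Real.exp_add] at h1
  have hpos : 0 < p.expect fun a => Real.exp (α * q a) := by
    have hb : IsBdd fun a => Real.exp (α * q a) := (IsBdd.of_Icc hq).const_mul α |>.exp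
    obtain ⟨C, hC⟩ := (IsBdd.of_Icc hq).const_mul α
    exact lt_of_lt_of_le (Real.exp_pos (-C)) (p.le_expect_of_le hb fun a =>
      Real.exp_le_exp.mpr (abs_le.mp (hC a)).1)
  refine (Real.log_le_iff_le_exp hpos).mpr (h1.trans (Real.exp_le_exp.mpr (le_of_eq ?_)))
  congr 1
  simp [div_pow]
  ring

end PMF

namespace PowerMDP

open Matrix ListProcess

variable {S : Type u} {A : Type v} {H d : ℕ}

section ExpWeights

variable [Fintype A]

theorem expWeights_ne_zero {α : ℝ} {p : PMF A} (q : A → ℝ) {a : A} (hp : p a ≠ 0) :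
    expWeights α p q a ≠ 0 := by
  rw [expWeights, ← PMF.mem_support_iff, PMF.mem_support_normalize_iff]
  exact mul_ne_zero hp (ENNReal.ofReal_pos.mpr (Real.exp_pos _)).ne'

theorem toReal_expWeights (α : ℝ) (p : PMF A) (q : A → ℝ) (a : A) :
    (expWeights α p q a).toReal =
      (p a).toReal * Real.exp (α * q a) / p.expect fun a => Real.exp (α * q a) := by
  rw [expWeights, PMF.normalize_apply, ENNReal.toReal_mul, ENNReal.toReal_mul,
    ENNReal.toReal_ofReal (Real.exp_nonneg _), ENNReal.toReal_inv, tsum_fintype,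
    ENNReal.toReal_sum fun a _ => ENNReal.mul_ne_top (p.apply_ne_top a) ENNReal.ofReal_ne_top,
    PMF.expect_fintype, div_eq_mul_inv]
  congr 2
  exact Finset.sum_congr rfl fun x _ => by
    rw [ENNReal.toReal_mul, ENNReal.toReal_ofReal (Real.exp_nonneg _)]

/-- One step of exponential weights increases the log-probability of `a` by the advantage of `a`,
up to a second order term. -/
theorem log_expWeights_ge {α b : ℝ} {p : PMF A} {q : A → ℝ} (hq : ∀ a, q a ∈ Set.Icc 0 b)
    {a : A} (hp : p a ≠ 0) :
    Real.log (p a).toReal + α * (q a - p.expect q) - α ^ 2 * b ^ 2 / 8 ≤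
      Real.log (expWeights α p q a).toReal := by
  have h1 := p.log_expect_exp_le hq α
  have hpos : 0 < (p a).toReal := ENNReal.toReal_pos hp (p.apply_ne_top a)
  have hE : 0 < p.expect fun a => Real.exp (α * q a) := by
    obtain ⟨C, hC⟩ := (PMF.IsBdd.of_Icc hq).const_mul α
    exact lt_of_lt_of_le (Real.exp_pos (-C)) (p.le_expect_of_le
      ((PMF.IsBdd.of_Icc hq).const_mul α).exp fun a =>
        Real.exp_le_exp.mpr (abs_le.mp (hC a)).1)
  rw [toReal_expWeights, Real.log_div (mul_pos hpos (Real.exp_pos _)).ne' hE.ne',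
    Real.log_mul hpos.ne' (Real.exp_pos _).ne', Real.log_exp]
  linarith

end ExpWeights

variable [Fintype A] [Nonempty A] {M : AdversarialMDP S A H}
  {φ : S → A → S → EuclideanSpace ℝ (Fin d)} {c : Params}

theorem optV_castSucc (hs : History S A H) (h : Fin H) (s : S) :
    optV M φ c hs h.castSucc s =
      (power φ c M.reward hs h s).expect (optQ M φ c hs h s) :=
  estV_castSucc φ c _ _ _ h s

theorem optV_last (hs : History S A H) : optV M φ c hs (Fin.last H) = fun _ => 0 :=
  estV_last φ c _ _ _

theorem optQ_mem_Icc (hs : History S A H) (h : Fin H) (s : S) (a : A) :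
    optQ M φ c hs h s a ∈ Set.Icc (0 : ℝ) H := by
  have h1 := backup_mem_Icc φ c (powerState φ c M.reward hs) (hs.length + 1) (M.reward hs) h
    (optV M φ c hs h.succ) s a
  exact ⟨h1.1, h1.2.trans (by simp)⟩

theorem power_nil_apply (h : Fin H) (s : S) (a : A) :
    (power φ c M.reward [] h s a).toReal = (Fintype.card A : ℝ)⁻¹ := by
  change (expWeights c.α (PMF.uniformOfFintype A) (fun _ => 0) a).toReal = _
  rw [toReal_expWeights]
  simp [PMF.expect_const]

theorem power_cons (τ : Trajectory S A H) (hs : History S A H) (h : Fin H) (s : S) :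
    power φ c M.reward (τ :: hs) h s =
      expWeights c.α (power φ c M.reward hs h s) (optQ M φ c hs h s) := rfl

theorem power_apply_ne_zero (hs : History S A H) (h : Fin H) (s : S) (a : A) :
    power φ c M.reward hs h s a ≠ 0 := by
  induction hs with
  | nil =>
    intro h0
    have := power_nil_apply (M := M) (φ := φ) (c := c) h s a
    rw [h0, ENNReal.toReal_zero] at this
    exact absurd this.symm (by positivity)
  | cons τ hs ih => rw [power_cons]; exact expWeights_ne_zero _ ih

theorem mul_listSum_advantage_le_log (hs : History S A H) (h : Fin H) (s : S) (a : A) :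
    c.α * listSum (fun l _ => optQ M φ c l h s a - optV M φ c l h.castSucc s) hs ≤
      Real.log (power φ c M.reward hs h s a).toReal + Real.log (Fintype.card A)
        + hs.length * (c.α ^ 2 * (H : ℝ) ^ 2 / 8) := by
  induction hs with
  | nil => rw [power_nil_apply, Real.log_inv]; simp [listSum]
  | cons τ hs ih =>
    have h1 := log_expWeights_ge (α := c.α) (optQ_mem_Icc (M := M) (φ := φ) (c := c) hs h s)
      (power_apply_ne_zero (M := M) (φ := φ) (c := c) hs h s a)
    rw [← power_cons τ, ← optV_castSucc] at h1
    rw [listSum, List.length_cons]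
    push_cast
    linarith

/-- The regret of exponential weights at every single state. The second case covers a single
action, where the learning rate may vanish. -/
theorem listSum_advantage_le (hα : 0 < c.α ∨ (c.α = 0 ∧ Fintype.card A = 1))
    (hs : History S A H) (h : Fin H) (s : S) (a : A) :
    listSum (fun l _ => optQ M φ c l h s a - optV M φ c l h.castSucc s) hs ≤
      c.α⁻¹ * Real.log (Fintype.card A) + hs.length * (c.α * (H : ℝ) ^ 2 / 8) := by
  rcases hα with hα | ⟨h0, hA⟩
  · have h1 := mul_listSum_advantage_le_log (M := M) (φ := φ) (c := c) hs h s a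
    have h2 : Real.log (power φ c M.reward hs h s a).toReal ≤ 0 :=
      Real.log_nonpos ENNReal.toReal_nonneg
        (ENNReal.toReal_le_of_le_ofReal zero_le_one (by simpa using PMF.coe_le_one _ a))
    refine le_of_mul_le_mul_left (le_trans h1 ?_) hα
    have h3 : c.α * (c.α⁻¹ * Real.log (Fintype.card A) + hs.length * (c.α * (H : ℝ) ^ 2 / 8)) =
        Real.log (Fintype.card A) + hs.length * (c.α ^ 2 * (H : ℝ) ^ 2 / 8) := by
      field_simp
    rw [h3]
    linarith
  · have hsub : Subsingleton A := Fintype.card_le_one_iff_subsingleton.mp hA.le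
    have h1 : ∀ l : History S A H, optQ M φ c l h s a - optV M φ c l h.castSucc s = 0 := by
      intro l
      have h2 : optQ M φ c l h s = fun _ => optQ M φ c l h s a := by
        funext a'; rw [Subsingleton.elim a' a]
      rw [optV_castSucc, h2, PMF.expect_const, sub_self]
    simp only [h1, listSum_const, hA, h0]
    simp

theorem _root_.PMF.expect_listSum {X E : Type*} (p : PMF X) {F : X → List E → E → ℝ}
    (hF : ∀ l e, PMF.IsBdd fun x => F x l e) (hs : List E) :
    PMF.IsBdd (fun x => listSum (F x) hs) ∧
    p.expect (fun x => listSum (F x) hs) =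
      listSum (fun l e => p.expect fun x => F x l e) hs := by
  induction hs with
  | nil => exact ⟨PMF.IsBdd.const 0, p.expect_const 0⟩
  | cons e hs ih =>
    refine ⟨ih.1.add (hF hs e), ?_⟩
    simp only [listSum]
    rw [PMF.expect_add _ ih.1 (hF hs e), ih.2]

/-- The excess of `Q_{k,h}` over the Bellman backup of `V_{k,h+1}`. -/
noncomputable def bellmanGap (M : AdversarialMDP S A H)
    (φ : S → A → S → EuclideanSpace ℝ (Fin d)) (c : Params) (h : Fin H) (hs : History S A H)
    (p : S × A) : ℝ :=
  optQ M φ c hs h p.1 p.2 - M.reward hs h p.1 p.2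
    - (M.trans h p.1 p.2).expect (optV M φ c hs h.succ)

/-- The bound `min {2 β̂_k ‖Σ̂_{k,h}^{-1/2} φ_V(s,a)‖, H}` for the Bellman gap. -/
noncomputable def gapBound (M : AdversarialMDP S A H)
    (φ : S → A → S → EuclideanSpace ℝ (Fin d)) (c : Params) (h : Fin H) (hs : History S A H)
    (p : S × A) : ℝ :=
  min (2 * c.betaHat d H (hs.length + 1) *
    invNorm ((powerState φ c M.reward hs).sigHat h) (featV M φ c h hs p)) H

theorem expect_optV_mem_Icc (hs : History S A H) (h : Fin H) (p : S × A) :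
    (M.trans h p.1 p.2).expect (optV M φ c hs h.succ) ∈
      Set.Icc (0 : ℝ) ((H : ℝ) - (h : ℕ) - 1) := by
  have h1 := (M.trans h p.1 p.2).expect_mem_Icc (fun s' => estV_mem_Icc φ c
    (powerState φ c M.reward hs) (hs.length + 1) (M.reward hs) h.succ s')
  rw [Fin.val_succ] at h1
  push_cast at h1
  exact ⟨h1.1, h1.2.trans_eq (by ring)⟩

/-- Optimism: on the confidence set, the Bellman gap is nonnegative, and it is at most twice the
bonus. -/
theorem bellmanGap_mem_Icc
    (hφ : ∀ V : S → ℝ, (∀ s, V s ∈ Set.Icc (0 : ℝ) 1) → ∀ s a, ‖featureOf φ V s a‖ ≤ 1)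
    {θ : Fin H → EuclideanSpace ℝ (Fin d)} (hθB : ∀ h, ‖θ h‖ ≤ c.B)
    (hθ : ∀ h s a s', (M.trans h s a s').toReal = inner ℝ (φ s a s') (θ h))
    (hlam : 0 < c.lam) {h : Fin H} {hs : History S A H} (hc : HatConfident M φ c h hs)
    (p : S × A) : bellmanGap M φ c h hs p ∈ Set.Icc 0 (gapBound M φ c h hs p) := by
  have h1 := abs_le.mp (abs_thetaHat_error_le hφ hθB hθ hlam hc p)
  have hβ : c.radHat d H (hs.length + 1) + Real.sqrt c.lam * c.B =
    c.betaHat d H (hs.length + 1) := rfl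
  rw [hβ] at h1
  have hr := M.reward_mem hs h p.1 p.2
  have hV := expect_optV_mem_Icc (M := M) (φ := φ) (c := c) hs h p
  have hQ : optQ M φ c hs h p.1 p.2 = clip ((H : ℝ) - (h : ℕ)) (M.reward hs h p.1 p.2
      + featV M φ c h hs p ⬝ᵥ (powerState φ c M.reward hs).thetaHat h
      + c.betaHat d H (hs.length + 1) *
        invNorm ((powerState φ c M.reward hs).sigHat h) (featV M φ c h hs p)) := by
    rw [dotProduct_comm]; rfl
  have hQH := (optQ_mem_Icc (M := M) (φ := φ) (c := c) hs h p.1 p.2).2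
  have hself := clip_eq_self (b := (H : ℝ) - (h : ℕ))
    (x := M.reward hs h p.1 p.2 + (M.trans h p.1 p.2).expect (optV M φ c hs h.succ))
    ⟨by linarith [hr.1, hV.1], by linarith [hr.2, hV.2]⟩
  constructor
  · have h2 : M.reward hs h p.1 p.2 + (M.trans h p.1 p.2).expect (optV M φ c hs h.succ) ≤
        optQ M φ c hs h p.1 p.2 := by
      rw [hQ]
      refine hself.symm.trans_le (clip_mono _ ?_)
      linarith [h1.1]
    rw [bellmanGap]; linarith
  · refine le_min ?_ ?_
    · have h3 : optQ M φ c hs h p.1 p.2 ≤ M.reward hs h p.1 p.2 +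
          (M.trans h p.1 p.2).expect (optV M φ c hs h.succ) +
          2 * c.betaHat d H (hs.length + 1) *
            invNorm ((powerState φ c M.reward hs).sigHat h) (featV M φ c h hs p) := by
        rw [hQ]
        have h4 : 0 ≤ c.betaHat d H (hs.length + 1) *
            invNorm ((powerState φ c M.reward hs).sigHat h) (featV M φ c h hs p) := by
          linarith [h1.1, h1.2]
        exact clip_le_of_le (by linarith [hr.1, hV.1]) (by linarith [h1.2])
      rw [bellmanGap]; linarith
    · rw [bellmanGap]; linarith [hr.1, hV.1]

/-- The sum of the gap bounds along an episode. -/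
noncomputable def episodeGapBound (M : AdversarialMDP S A H)
    (φ : S → A → S → EuclideanSpace ℝ (Fin d)) (c : Params) (hs : History S A H)
    (τ : Trajectory S A H) : ℝ :=
  ∑ h, gapBound M φ c h hs (stateAction h τ)

/-- The sum of the variances of the value functions along an episode. -/
noncomputable def episodeVariance (M : AdversarialMDP S A H)
    (φ : S → A → S → EuclideanSpace ℝ (Fin d)) (c : Params) (hs : History S A H)
    (τ : Trajectory S A H) : ℝ :=
  ∑ h, (M.trans h (τ.1 h.castSucc) (τ.2 h)).variance (optV M φ c hs h.succ)

/-- The expected sum of the gap bounds in the episode after `hs`. -/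
noncomputable def meanGapBound (M : AdversarialMDP S A H)
    (φ : S → A → S → EuclideanSpace ℝ (Fin d)) (c : Params) (hs : History S A H) : ℝ :=
  (M.episodeLaw (power φ c M.reward hs)).expect (episodeGapBound M φ c hs)

section Means

variable (hβ : ∀ k, 0 < k → 0 ≤ c.betaHat d H k)

include hβ in
theorem gapBound_mem_Icc (h : Fin H) (hs : History S A H) (p : S × A) :
    gapBound M φ c h hs p ∈ Set.Icc (0 : ℝ) H := by
  have h1 := hβ (hs.length + 1) (Nat.succ_pos _)
  have h2 := invNorm_nonneg ((powerState φ c M.reward hs).sigHat h) (featV M φ c h hs p)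
  exact ⟨le_min (by positivity) (by positivity), min_le_right _ _⟩

include hβ in
theorem episodeGapBound_mem_Icc (hs : History S A H) (τ : Trajectory S A H) :
    episodeGapBound M φ c hs τ ∈ Set.Icc (0 : ℝ) ((H : ℝ) ^ 2) := by
  refine ⟨Finset.sum_nonneg fun h _ => (gapBound_mem_Icc hβ h hs _).1, ?_⟩
  refine (Finset.sum_le_sum fun h _ => (gapBound_mem_Icc hβ h hs _).2).trans (le_of_eq ?_)
  simp [sq]

theorem variance_optV_mem_Icc (h : Fin H) (hs : History S A H) (p : S × A) :
    (M.trans h p.1 p.2).variance (optV M φ c hs h.succ) ∈ Set.Icc (0 : ℝ) ((H : ℝ) ^ 2) := by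
  refine ⟨PMF.variance_nonneg _ (isBdd_optV _ _), ?_⟩
  have h1 := (M.trans h p.1 p.2).expect_mem_Icc
    (optV_sq_mem_Icc (M := M) (φ := φ) (c := c) hs h.succ)
  rw [PMF.variance]
  linarith [h1.2, sq_nonneg ((M.trans h p.1 p.2).expect (optV M φ c hs h.succ))]

theorem episodeVariance_mem_Icc (hs : History S A H) (τ : Trajectory S A H) :
    episodeVariance M φ c hs τ ∈ Set.Icc (0 : ℝ) ((H : ℝ) ^ 3) := by
  refine ⟨Finset.sum_nonneg fun h _ => (variance_optV_mem_Icc h hs (stateAction h τ)).1, ?_⟩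
  refine (Finset.sum_le_sum fun h _ =>
    (variance_optV_mem_Icc h hs (stateAction h τ)).2).trans (le_of_eq ?_)
  simp only [Finset.sum_const, Finset.card_univ, Fintype.card_fin, nsmul_eq_mul]
  ring

include hβ in
theorem meanGapBound_eq (hs : History S A H) :
    meanGapBound M φ c hs = ∑ h, (M.occupancy (power φ c M.reward hs) h).expect
      (gapBound M φ c h hs) := by
  rw [meanGapBound]
  have hb : ∀ h : Fin H, PMF.IsBdd (gapBound M φ c h hs) := fun h =>
    .of_Icc (gapBound_mem_Icc hβ h hs)
  change (M.episodeLaw (power φ c M.reward hs)).expect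
    (fun τ => ∑ h, gapBound M φ c h hs (stateAction h τ)) = _
  rw [PMF.expect_finset_sum _ fun h _ => (hb h).comp _]
  exact Finset.sum_congr rfl fun h _ => M.expect_episodeLaw _ h (hb h)

theorem isBdd_optQ (hs : History S A H) (h : Fin H) :
    PMF.IsBdd fun p : S × A => optQ M φ c hs h p.1 p.2 :=
  .of_Icc fun p => optQ_mem_Icc hs h p.1 p.2

theorem isBdd_expect_optV (hs : History S A H) (h : Fin H) :
    PMF.IsBdd fun p : S × A => (M.trans h p.1 p.2).expect (optV M φ c hs h.succ) :=
  .of_Icc fun p => expect_optV_mem_Icc hs h p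

theorem isBdd_expect_optV_sq (hs : History S A H) (h : Fin H) :
    PMF.IsBdd fun p : S × A =>
      (M.trans h p.1 p.2).expect fun s' => optV M φ c hs h.succ s' ^ 2 :=
  .of_Icc fun p => (M.trans h p.1 p.2).expect_mem_Icc
    (optV_sq_mem_Icc (M := M) (φ := φ) (c := c) hs h.succ)

theorem isBdd_bellmanGap (hs : History S A H) (h : Fin H) :
    PMF.IsBdd (bellmanGap M φ c h hs) :=
  ((isBdd_optQ hs h).sub (isBdd_reward hs h)).sub (isBdd_expect_optV hs h)

theorem expect_occupancy_optQ (hs : History S A H) (h : Fin H) :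
    (M.occupancy (power φ c M.reward hs) h).expect (fun p => optQ M φ c hs h p.1 p.2) =
      (M.occupancy (power φ c M.reward hs) h).expect
        fun p => optV M φ c hs h.castSucc p.1 := by
  rw [M.expect_occupancy _ h (isBdd_optQ hs h),
    M.expect_occupancy_state _ h (isBdd_optV hs _)]
  congr 1
  funext s
  exact (optV_castSucc hs h s).symm

theorem expect_occupancy_optV_sq_le (hs : History S A H) (h : Fin H) :
    (M.occupancy (power φ c M.reward hs) h).expect
        (fun p => optV M φ c hs h.castSucc p.1 ^ 2) ≤
      (M.occupancy (power φ c M.reward hs) h).expect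
        fun p => optQ M φ c hs h p.1 p.2 ^ 2 := by
  have hb : ∀ s, PMF.IsBdd (optQ M φ c hs h s) := fun s => .of_Icc (optQ_mem_Icc hs h s)
  rw [M.expect_occupancy _ h (isBdd_optQ hs h).pow_two,
    M.expect_occupancy_state _ h (f := fun s => optV M φ c hs h.castSucc s ^ 2)
      (isBdd_optV hs _).pow_two]
  refine PMF.expect_mono _ (isBdd_optV hs _).pow_two (.of_Icc (a := 0) (b := (H : ℝ) ^ 2)
    fun s => PMF.expect_mem_Icc _ fun a => ?_) fun s => ?_
  · have := optQ_mem_Icc (M := M) (φ := φ) (c := c) hs h s a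
    exact ⟨sq_nonneg _, pow_le_pow_left₀ this.1 this.2 2⟩
  · rw [optV_castSucc]
    exact PMF.sq_expect_le _ (hb s)

theorem value_sub_optV (hs : History S A H) (π : Policy S A H) :
    M.value (M.reward hs) π - optV M φ c hs 0 M.start =
      ∑ h, (M.occupancy π h).expect (fun p => M.reward hs h p.1 p.2 +
        ((M.trans h p.1 p.2).expect (optV M φ c hs h.succ)
          - optV M φ c hs h.castSucc p.1)) := by
  have h1 := M.sum_expect_drift π (optV M φ c hs) (isBdd_optV hs)
  rw [optV_last, PMF.expect_const] at h1
  rw [M.value_eq_sum π _ (M.reward_mem hs), sub_eq_add_neg, ← zero_sub, ← h1,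
    ← Finset.sum_add_distrib]
  exact Finset.sum_congr rfl fun h _ => (PMF.expect_add _ (isBdd_reward hs h)
    ((isBdd_expect_optV hs h).sub ((isBdd_optV hs _).comp _))).symm

/-- The optimistic value exceeds the value of the policy being played by the expected sum of the
Bellman gaps. -/
theorem optV_sub_value_power (hs : History S A H) :
    optV M φ c hs 0 M.start - M.value (M.reward hs) (power φ c M.reward hs) =
      ∑ h, (M.occupancy (power φ c M.reward hs) h).expect (bellmanGap M φ c h hs) := by
  rw [← neg_sub, value_sub_optV, ← Finset.sum_neg_distrib]
  refine Finset.sum_congr rfl fun h _ => ?_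
  have h1 := expect_occupancy_optQ (M := M) (φ := φ) (c := c) hs h
  have h2 : bellmanGap M φ c h hs = fun p => (optQ M φ c hs h p.1 p.2 - M.reward hs h p.1 p.2)
    - (M.trans h p.1 p.2).expect (optV M φ c hs h.succ) := rfl
  rw [h2, PMF.expect_add _ (isBdd_reward hs h)
    ((isBdd_expect_optV hs h).sub ((isBdd_optV hs _).comp _)),
    PMF.expect_sub _ (isBdd_expect_optV hs h) ((isBdd_optV hs _).comp _),
    PMF.expect_sub _ ((isBdd_optQ hs h).sub (isBdd_reward hs h)) (isBdd_expect_optV hs h),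
    PMF.expect_sub _ (isBdd_optQ hs h) (isBdd_reward hs h), h1]
  ring

variable (hφ : ∀ V : S → ℝ, (∀ s, V s ∈ Set.Icc (0 : ℝ) 1) → ∀ s a, ‖featureOf φ V s a‖ ≤ 1)
  {θ : Fin H → EuclideanSpace ℝ (Fin d)} (hθB : ∀ h, ‖θ h‖ ≤ c.B)
  (hθ : ∀ h s a s', (M.trans h s a s').toReal = inner ℝ (φ s a s') (θ h)) (hlam : 0 < c.lam)

include hφ hθB hθ hlam hβ

theorem sum_expect_bellmanGap_le {hs : History S A H} (hc : ∀ h, HatConfident M φ c h hs) :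
    ∑ h, (M.occupancy (power φ c M.reward hs) h).expect (bellmanGap M φ c h hs) ≤
      meanGapBound M φ c hs := by
  rw [meanGapBound_eq hβ]
  exact Finset.sum_le_sum fun h _ => PMF.expect_mono _ (isBdd_bellmanGap hs h)
    (.of_Icc (gapBound_mem_Icc hβ h hs))
    fun p => (bellmanGap_mem_Icc hφ hθB hθ hlam (hc h) p).2

/-- The regret is at most the regret of exponential weights plus the expected gap bounds. -/
theorem regretAgainst_le {hs : History S A H} {W : ℝ}
    (hW : ∀ h s a, listSum (fun l _ => optQ M φ c l h s a - optV M φ c l h.castSucc s) hs ≤ W)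
    (hc : ∀ h l, l <:+ hs → HatConfident M φ c h l) (π : Policy S A H) :
    M.regretAgainst (power φ c M.reward) π hs ≤
      H * W + listSum (fun l _ => meanGapBound M φ c l) hs := by
  rw [M.regretAgainst_eq_listSum]
  have hQV : ∀ (l : History S A H) (h : Fin H),
      PMF.IsBdd fun p : S × A => optQ M φ c l h p.1 p.2 - optV M φ c l h.castSucc p.1 :=
    fun l h => (isBdd_optQ l h).sub ((isBdd_optV l _).comp _)
  have h1 : listSum (fun l _ => M.value (M.reward l) π -
        M.value (M.reward l) (power φ c M.reward l)) hs ≤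
      listSum (fun l _ => ∑ h, (M.occupancy π h).expect (fun p =>
        optQ M φ c l h p.1 p.2 - optV M φ c l h.castSucc p.1) + meanGapBound M φ c l) hs := by
    refine listSum_mono_of_suffix fun τ l hl => ?_
    have hl' := (List.suffix_cons τ l).trans hl
    have h2 := value_sub_optV (M := M) (φ := φ) (c := c) l π
    have h3 := optV_sub_value_power (M := M) (φ := φ) (c := c) l
    have h4 := sum_expect_bellmanGap_le hβ hφ hθB hθ hlam fun h => hc h l hl'
    have h5 : ∑ h, (M.occupancy π h).expect (fun p => M.reward l h p.1 p.2 +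
        ((M.trans h p.1 p.2).expect (optV M φ c l h.succ) - optV M φ c l h.castSucc p.1)) ≤
        ∑ h, (M.occupancy π h).expect (fun p =>
          optQ M φ c l h p.1 p.2 - optV M φ c l h.castSucc p.1) := by
      refine Finset.sum_le_sum fun h _ => PMF.expect_mono _ ((isBdd_reward l h).add
        ((isBdd_expect_optV l h).sub ((isBdd_optV l _).comp _))) (hQV l h) fun p => ?_
      have h6 := (bellmanGap_mem_Icc hφ hθB hθ hlam (hc h l hl') p).1
      rw [bellmanGap] at h6
      linarith
    linarith
  refine h1.trans ?_
  rw [listSum_add, listSum_finset_sum]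
  gcongr
  calc _ ≤ ∑ _h : Fin H, W := by
        refine Finset.sum_le_sum fun h _ => ?_
        have h2 := (M.occupancy π h).expect_listSum
          (F := fun p l (_ : Trajectory S A H) =>
            optQ M φ c l h p.1 p.2 - optV M φ c l h.castSucc p.1) (fun l _ => hQV l h) hs
        rw [← h2.2]
        exact PMF.expect_le_of_le _ h2.1 fun p => hW h p.1 p.2
    _ = H * W := by simp

/-- The law of total variance for the optimistic values: the variances of the one-step transitions
sum up to `O(H²)` instead of `O(H³)`, up to `H` times the sum of the Bellman gaps. -/
theorem expect_episodeVariance_le {hs : History S A H} (hc : ∀ h, HatConfident M φ c h hs) :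
    (M.episodeLaw (power φ c M.reward hs)).expect (episodeVariance M φ c hs) ≤
      2 * (H : ℝ) ^ 2 + 2 * H * meanGapBound M φ c hs := by
  set μ := M.occupancy (power φ c M.reward hs) with hμ
  have hb : ∀ h : Fin H, PMF.IsBdd fun p : S × A =>
      (M.trans h p.1 p.2).variance (optV M φ c hs h.succ) :=
    fun h => .of_Icc (variance_optV_mem_Icc h hs)
  have h1 : (M.episodeLaw (power φ c M.reward hs)).expect (episodeVariance M φ c hs) =
      ∑ h, (μ h).expect fun p => (M.trans h p.1 p.2).variance (optV M φ c hs h.succ) := by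
    change (M.episodeLaw (power φ c M.reward hs)).expect (fun τ => ∑ h,
      (M.trans h (stateAction h τ).1 (stateAction h τ).2).variance (optV M φ c hs h.succ)) = _
    rw [PMF.expect_finset_sum _ fun h _ => (hb h).comp (stateAction h)]
    exact Finset.sum_congr rfl fun h _ => M.expect_episodeLaw _ h (hb h)
  -- `P V² - (P V)² = (P V² - Q²) + (Q² - (P V)²)`, where `Q - P V = r + gap` and `Q + P V ≤ 2H`;
  -- by Jensen's inequality, `Q²` may be replaced by the square of the value, which telescopes
  have h2 : ∀ h : Fin H, (μ h).expect (fun p =>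
        (M.trans h p.1 p.2).variance (optV M φ c hs h.succ)) ≤
      ((μ h).expect fun p => (M.trans h p.1 p.2).expect (fun s' => optV M φ c hs h.succ s' ^ 2)
        - optV M φ c hs h.castSucc p.1 ^ 2)
        + 2 * H * (1 + (μ h).expect (bellmanGap M φ c h hs)) := by
    intro h
    have h3 : (μ h).expect (fun p =>
        (M.trans h p.1 p.2).variance (optV M φ c hs h.succ)) ≤
        (μ h).expect fun p => ((M.trans h p.1 p.2).expect
          (fun s' => optV M φ c hs h.succ s' ^ 2) - optQ M φ c hs h p.1 p.2 ^ 2)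
          + 2 * H * (1 + bellmanGap M φ c h hs p) := by
      refine PMF.expect_mono _ (hb h) (((isBdd_expect_optV_sq hs h).sub
        (isBdd_optQ hs h).pow_two).add (((PMF.IsBdd.const 1).add
          (isBdd_bellmanGap hs h)).const_mul _)) fun p => ?_
      have hg := (bellmanGap_mem_Icc hφ hθB hθ hlam (hc h) p).1
      have hQ := optQ_mem_Icc (M := M) (φ := φ) (c := c) hs h p.1 p.2
      have hr := M.reward_mem hs h p.1 p.2
      have he : (M.trans h p.1 p.2).expect (optV M φ c hs h.succ) = optQ M φ c hs h p.1 p.2 -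
          (M.reward hs h p.1 p.2 + bellmanGap M φ c h hs p) := by rw [bellmanGap]; ring
      rw [PMF.variance, he]
      have h5 : optQ M φ c hs h p.1 p.2 * (M.reward hs h p.1 p.2 + bellmanGap M φ c h hs p) ≤
          H * (1 + bellmanGap M φ c h hs p) :=
        mul_le_mul hQ.2 (by linarith [hr.2]) (by linarith [hr.1]) (by positivity)
      nlinarith [sq_nonneg (M.reward hs h p.1 p.2 + bellmanGap M φ c h hs p)]
    have h4 := expect_occupancy_optV_sq_le (M := M) (φ := φ) (c := c) hs h
    rw [PMF.expect_add _ ((isBdd_expect_optV_sq hs h).sub (isBdd_optQ hs h).pow_two)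
      (((PMF.IsBdd.const 1).add (isBdd_bellmanGap hs h)).const_mul _), PMF.expect_const_mul,
      PMF.expect_add _ (.const 1) (isBdd_bellmanGap hs h), PMF.expect_const,
      PMF.expect_sub _ (isBdd_expect_optV_sq hs h) (isBdd_optQ hs h).pow_two] at h3
    rw [PMF.expect_sub _ (isBdd_expect_optV_sq hs h)
      ((isBdd_optV hs h.castSucc).pow_two.comp fun p : S × A => p.1)]
    linarith
  have h6 := M.sum_expect_drift (power φ c M.reward hs)
    (fun i s => optV M φ c hs i s ^ 2) (fun i => (isBdd_optV hs i).pow_two)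
  have h7 := sum_expect_bellmanGap_le hβ hφ hθB hθ hlam hc
  rw [h1]
  refine (Finset.sum_le_sum fun h _ => h2 h).trans ?_
  rw [Finset.sum_add_distrib, ← Finset.mul_sum, Finset.sum_add_distrib, hμ, h6]
  have h8 : (fun s => optV M φ c hs (Fin.last H) s ^ 2) = fun _ => 0 := by
    rw [optV_last]; funext s; norm_num
  rw [h8, PMF.expect_const]
  simp only [Finset.sum_const, Finset.card_univ, Fintype.card_fin, nsmul_eq_mul, mul_one]
  have h9 : (0 : ℝ) ≤ H := by positivity
  nlinarith [sq_nonneg (optV M φ c hs 0 M.start), mul_le_mul_of_nonneg_left h7 h9]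

end Means

end PowerMDP

/-! ### Pathwise bounds for the bonuses and the variances -/

namespace PowerMDP

open Matrix ListProcess

variable {S : Type u} {A : Type v} {H d : ℕ}

theorem min_mul_le_mul_min_one {a b w m : ℝ} (hw : 0 ≤ w) (hab : a ≤ b)
    (hm : m ≤ b) : min (a * w) m ≤ b * min 1 w := by
  rcases le_total 1 w with h | h
  · rw [min_eq_left h, mul_one]; exact (min_le_right _ _).trans hm
  · rw [min_eq_right h]
    exact (min_le_left _ _).trans (mul_le_mul_of_nonneg_right hab hw)

/-- Cauchy–Schwarz for a plain sum over all stages and episodes. -/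
theorem listSum_le_sqrt (f : Fin H → History S A H → Trajectory S A H → ℝ) {b : ℝ}
    {hs : History S A H} (hb : listSum (fun l τ => ∑ h, f h l τ ^ 2) hs ≤ b) :
    listSum (fun l τ => ∑ h, f h l τ) hs ≤ Real.sqrt (hs.length * H * b) := by
  refine Real.le_sqrt_of_sq_le ?_
  have h1 := listSum_mul_sq_le Finset.univ (fun _ _ _ => 1) f hs
  simp only [one_mul, one_pow, Finset.sum_const, Finset.card_univ, Fintype.card_fin, nsmul_eq_mul,
    mul_one, listSum_const] at h1
  exact h1.trans (mul_le_mul_of_nonneg_left hb (by positivity))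

theorem sq_min_one_invNorm_le {Z : Matrix (Fin d) (Fin d) ℝ} (hZ : Z.PosDef) (x : Fin d → ℝ) :
    min 1 (invNorm Z x) ^ 2 ≤ 2 * potential Z x := by
  have h0 := invNorm_nonneg Z x
  rw [potential, ← sq_invNorm hZ, ← mul_div_assoc, le_div_iff₀ (by positivity)]
  rcases le_total 1 (invNorm Z x) with h | h
  · rw [min_eq_left h]; nlinarith
  · rw [min_eq_right h]
    nlinarith [mul_nonneg (sq_nonneg (invNorm Z x)) (by nlinarith : 0 ≤ 1 - invNorm Z x ^ 2)]

variable [Fintype A] [Nonempty A] {M : AdversarialMDP S A H}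
  {φ : S → A → S → EuclideanSpace ℝ (Fin d)} {c : Params}

/-- The truncated norm of the weighted regressor at stage `h`. -/
noncomputable def truncHat (M : AdversarialMDP S A H)
    (φ : S → A → S → EuclideanSpace ℝ (Fin d)) (c : Params) (h : Fin H) (l : History S A H)
    (τ : Trajectory S A H) : ℝ :=
  min 1 (invNorm ((powerState φ c M.reward l).sigHat h)
    (scaledFeat M φ c h l (stateAction h τ)))

/-- The truncated norm of the regressor of the squared values at stage `h`. -/
noncomputable def truncTilde (M : AdversarialMDP S A H)
    (φ : S → A → S → EuclideanSpace ℝ (Fin d)) (c : Params) (h : Fin H) (l : History S A H)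
    (τ : Trajectory S A H) : ℝ :=
  min 1 (invNorm ((powerState φ c M.reward l).sigTilde h)
    (featSq M φ c h l (stateAction h τ)))

/-- The sum of the bonuses `E_{k,h}` along an episode. -/
noncomputable def episodeBonus (M : AdversarialMDP S A H)
    (φ : S → A → S → EuclideanSpace ℝ (Fin d)) (c : Params) (l : History S A H)
    (τ : Trajectory S A H) : ℝ :=
  ∑ h, (powerState φ c M.reward l).bonus φ c (l.length + 1) h (optV M φ c l h.succ)
    (τ.1 h.castSucc) (τ.2 h)

/-- The sum of the squares of `σ̄_{k,h}` along an episode. -/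
noncomputable def episodeStdSq (M : AdversarialMDP S A H)
    (φ : S → A → S → EuclideanSpace ℝ (Fin d)) (c : Params) (l : History S A H)
    (τ : Trajectory S A H) : ℝ :=
  ∑ h, stdV M φ c h l (stateAction h τ) ^ 2

section Sums

variable (hφ : ∀ V : S → ℝ, (∀ s, V s ∈ Set.Icc (0 : ℝ) 1) → ∀ s a, ‖featureOf φ V s a‖ ≤ 1)
  (hH : 0 < H) (hd : 0 < d) (hlam : 0 < c.lam)

include hφ hH hd hlam

theorem listSum_sq_truncHat_le (hs : History S A H) :
    listSum (fun l τ => ∑ h, truncHat M φ c h l τ ^ 2) hs ≤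
      2 * H * d * Real.log (1 + hs.length / c.lam) := by
  have hd' : (0 : ℝ) < d := by exact_mod_cast hd
  rw [listSum_finset_sum]
  calc _ ≤ ∑ _h : Fin H, 2 * (d * Real.log (1 + hs.length / c.lam)) := by
        refine Finset.sum_le_sum fun h _ => ?_
        have h1 := listSum_potential_le
          (fun l τ => scaledFeat M φ c h l (stateAction h τ)) hlam hd
          (fun l τ => scaledFeat_dotProduct_self_le hφ hH hd h l (stateAction h τ)) hs
        rw [mul_comm (d : ℝ) c.lam, mul_div_mul_right _ _ hd'.ne'] at h1
        refine (listSum_mono (fun l τ => sq_min_one_invNorm_le (sigHat_posDef hlam h l) _)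
          hs).trans ?_
        rw [listSum_const_mul]
        refine mul_le_mul_of_nonneg_left ?_ zero_le_two
        simp only [sigHat_eq_gram]
        exact h1
    _ = _ := by
        simp only [Finset.sum_const, Finset.card_univ, Fintype.card_fin, nsmul_eq_mul]
        ring

theorem listSum_sq_truncTilde_le (hs : History S A H) :
    listSum (fun l τ => ∑ h, truncTilde M φ c h l τ ^ 2) hs ≤
      2 * H * d * Real.log (1 + hs.length * (H : ℝ) ^ 4 / (d * c.lam)) := by
  rw [listSum_finset_sum]
  calc _ ≤ ∑ _h : Fin H, 2 * (d * Real.log (1 + hs.length * (H : ℝ) ^ 4 / (d * c.lam))) := by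
        refine Finset.sum_le_sum fun h _ => ?_
        have h1 := listSum_potential_le
          (fun l τ => featSq M φ c h l (stateAction h τ)) hlam hd
          (fun l τ => featSq_dotProduct_self_le hφ hH h l (stateAction h τ)) hs
        refine (listSum_mono (fun l τ => sq_min_one_invNorm_le (sigTilde_posDef hlam h l) _)
          hs).trans ?_
        rw [listSum_const_mul]
        refine mul_le_mul_of_nonneg_left ?_ zero_le_two
        simp only [sigTilde_eq_gram]
        exact h1
    _ = _ := by
        simp only [Finset.sum_const, Finset.card_univ, Fintype.card_fin, nsmul_eq_mul]
        ring

end Sums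

theorem invNorm_featV (hH : 0 < H) (hd : 0 < d) (h : Fin H) (l : History S A H) (p : S × A) :
    invNorm ((powerState φ c M.reward l).sigHat h) (featV M φ c h l p) =
      stdV M φ c h l p *
        invNorm ((powerState φ c M.reward l).sigHat h) (scaledFeat M φ c h l p) := by
  have h2 := stdV_pos (M := M) (φ := φ) (c := c) hH hd h l p
  rw [scaledFeat, invNorm_smul _ (by positivity), mul_inv_cancel_left₀ h2.ne']

theorem stdV_le (hH : 0 < H) (hd : 0 < d) (h : Fin H) (l : History S A H) (p : S × A) :
    stdV M φ c h l p ≤ 2 * H := by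
  have hH' : (0 : ℝ) < H := by exact_mod_cast hH
  have hd' : (1 : ℝ) ≤ d := by exact_mod_cast hd
  refine Real.sqrt_le_iff.mpr ⟨by positivity, max_le ?_ ?_⟩
  · rw [div_le_iff₀ (by positivity)]; nlinarith [sq_nonneg (H : ℝ)]
  · have h1 : (powerState φ c M.reward l).estVar φ h (optV M φ c l h.succ) p.1 p.2 ≤
        (H : ℝ) ^ 2 :=
      (sub_le_self _ (sq_nonneg _)).trans (clip_mem_Icc (by positivity) _).2
    have h2 : (powerState φ c M.reward l).bonus φ c (l.length + 1) h (optV M φ c l h.succ)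
        p.1 p.2 ≤ (H : ℝ) ^ 2 + (H : ℝ) ^ 2 :=
      add_le_add (min_le_right _ _) (min_le_right _ _)
    nlinarith [sq_nonneg (H : ℝ)]

section Pathwise

variable (hH : 0 < H) (hd : 0 < d) (hlam : 0 < c.lam) (hδ : 0 < c.δ) (hδ1 : c.δ ≤ 1)
  (hB : 0 ≤ c.B)

include hH hlam hδ hδ1 hB

theorem sqrt_le_betaHat {k : ℕ} (hk : 0 < k) : Real.sqrt d ≤ c.betaHat d H k := by
  have h1 := Params.one_le_logTerm hδ hδ1 hH hk
  have h2 : 0 ≤ Real.sqrt d * (c.logTerm H k - 1) := mul_nonneg (Real.sqrt_nonneg _) (by linarith)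
  have h3 : 0 ≤ 8 * Real.sqrt (d * Real.log (1 + k / c.lam) * c.logTerm H k) := by positivity
  have h4 : 0 ≤ Real.sqrt c.lam * c.B := by positivity
  rw [Params.betaHat]
  nlinarith [Real.sqrt_nonneg d]

theorem sqrt_le_betaBar {k : ℕ} (hk : 0 < k) : Real.sqrt d ≤ c.betaBar d H k := by
  have h1 := Params.one_le_logTerm hδ hδ1 hH hk
  have h2 : 0 ≤ Real.sqrt d * (c.logTerm H k - 1) := mul_nonneg (Real.sqrt_nonneg _) (by linarith)
  have h3 : 0 ≤ 8 * d * Real.sqrt (Real.log (1 + k / c.lam) * c.logTerm H k) := by positivity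
  have h4 : 0 ≤ Real.sqrt c.lam * c.B := by positivity
  rw [Params.betaBar]
  nlinarith [Real.sqrt_nonneg d]

theorem sq_le_betaTilde {k : ℕ} (hk : 0 < k) : (H : ℝ) ^ 2 ≤ c.betaTilde d H k := by
  have h1 := Params.one_le_logTerm hδ hδ1 hH hk
  have h2 : 0 ≤ (H : ℝ) ^ 2 * (c.logTerm H k - 1) := mul_nonneg (by positivity) (by linarith)
  have h3 : 0 ≤ 8 * (H : ℝ) ^ 2 *
    Real.sqrt (d * Real.log (1 + k * (H : ℝ) ^ 4 / (d * c.lam)) * c.logTerm H k) := by positivity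
  have h4 : 0 ≤ Real.sqrt c.lam * c.B := by positivity
  rw [Params.betaTilde]
  nlinarith [sq_nonneg (H : ℝ)]

include hd

/-- As `σ̄ ≥ H / √d` and `β̂ ≥ √d`, the truncation of the gap bound at `H` turns into a truncation
of the weighted norm at `1`, which is what the elliptical potential controls. -/
theorem gapBound_le (h : Fin H) {l : History S A H} {K : ℕ} (hK : l.length + 1 ≤ K)
    (τ : Trajectory S A H) :
    gapBound M φ c h l (stateAction h τ) ≤
      2 * c.betaHat d H K * (stdV M φ c h l (stateAction h τ) * truncHat M φ c h l τ) := by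
  have h2 := stdV_pos (M := M) (φ := φ) (c := c) hH hd h l (stateAction h τ)
  have h3 := H_le_sqrt_mul_stdV (M := M) (φ := φ) (c := c) hd h l (stateAction h τ)
  have hk : 0 < l.length + 1 := Nat.succ_pos _
  have h4 := sqrt_le_betaHat (d := d) hH hlam hδ hδ1 hB (hk.trans_le hK)
  have h5 : c.betaHat d H (l.length + 1) ≤ c.betaHat d H K :=
    add_le_add (Params.radHat_mono hlam hδ hδ1 hH hk hK) le_rfl
  have h6 : 0 ≤ c.betaHat d H K := (Real.sqrt_nonneg _).trans h4
  rw [gapBound, invNorm_featV hH hd, ← mul_assoc, ← mul_assoc, truncHat]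
  refine min_mul_le_mul_min_one (invNorm_nonneg _ _) (by gcongr) ?_
  have h7 := mul_le_mul_of_nonneg_right h4 h2.le
  have h8 : 0 ≤ c.betaHat d H K * stdV M φ c h l (stateAction h τ) := by positivity
  linarith

theorem bonus_le (h : Fin H) {l : History S A H} {K : ℕ} (hK : l.length + 1 ≤ K)
    (τ : Trajectory S A H) :
    (powerState φ c M.reward l).bonus φ c (l.length + 1) h (optV M φ c l h.succ)
        (τ.1 h.castSucc) (τ.2 h) ≤
      c.betaTilde d H K * truncTilde M φ c h l τ
        + 4 * (H : ℝ) ^ 2 * c.betaBar d H K * truncHat M φ c h l τ := by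
  have hH' : (0 : ℝ) < H := by exact_mod_cast hH
  have h2 := stdV_pos (M := M) (φ := φ) (c := c) hH hd h l (stateAction h τ)
  have h3 := H_le_sqrt_mul_stdV (M := M) (φ := φ) (c := c) hd h l (stateAction h τ)
  have hσ := stdV_le (M := M) (φ := φ) (c := c) hH hd h l (stateAction h τ)
  have hk : 0 < l.length + 1 := Nat.succ_pos _
  have h4 := sqrt_le_betaBar (d := d) hH hlam hδ hδ1 hB (hk.trans_le hK)
  have h4' := sq_le_betaTilde (d := d) hH hlam hδ hδ1 hB (hk.trans_le hK)
  have h5 : c.betaBar d H (l.length + 1) ≤ c.betaBar d H K :=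
    add_le_add (Params.radBar_mono hlam hδ hδ1 hH hk hK) le_rfl
  have h5' : c.betaTilde d H (l.length + 1) ≤ c.betaTilde d H K :=
    add_le_add (Params.radTilde_mono hlam hδ hδ1 hH hk hK) le_rfl
  have h6 : 0 ≤ c.betaBar d H K := (Real.sqrt_nonneg _).trans h4
  have h6' : 0 ≤ c.betaTilde d H K := (sq_nonneg _).trans h4'
  change min (c.betaTilde d H (l.length + 1) * invNorm ((powerState φ c M.reward l).sigTilde h)
      (featSq M φ c h l (stateAction h τ))) ((H : ℝ) ^ 2) +
    min (2 * H * c.betaBar d H (l.length + 1) * invNorm ((powerState φ c M.reward l).sigHat h)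
      (featV M φ c h l (stateAction h τ))) ((H : ℝ) ^ 2) ≤ _
  refine add_le_add ?_ ?_
  · exact min_mul_le_mul_min_one (invNorm_nonneg _ _) h5' h4'
  · rw [invNorm_featV hH hd, ← mul_assoc, truncHat]
    have h7 : 0 ≤ min 1 (invNorm ((powerState φ c M.reward l).sigHat h)
        (scaledFeat M φ c h l (stateAction h τ))) := le_min zero_le_one (invNorm_nonneg _ _)
    calc _ ≤ 2 * H * c.betaBar d H K * stdV M φ c h l (stateAction h τ) * min 1
          (invNorm ((powerState φ c M.reward l).sigHat h)
            (scaledFeat M φ c h l (stateAction h τ))) := by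
          refine min_mul_le_mul_min_one (invNorm_nonneg _ _) (by gcongr) ?_
          have h8 := mul_le_mul_of_nonneg_right h4 h2.le
          have h9 : 0 ≤ c.betaBar d H K * stdV M φ c h l (stateAction h τ) := by positivity
          nlinarith
      _ ≤ 2 * H * c.betaBar d H K * (2 * H) * min 1
          (invNorm ((powerState φ c M.reward l).sigHat h)
            (scaledFeat M φ c h l (stateAction h τ))) := by gcongr
      _ = _ := by ring

variable (hφ : ∀ V : S → ℝ, (∀ s, V s ∈ Set.Icc (0 : ℝ) 1) → ∀ s a, ‖featureOf φ V s a‖ ≤ 1)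

include hφ

/-- Cauchy–Schwarz splits the gap bounds into the weights `σ̄` and the elliptical potentials. -/
theorem sq_listSum_episodeGapBound_le (hs : History S A H) (hne : hs ≠ [])
    (hβ : ∀ k, 0 < k → 0 ≤ c.betaHat d H k) :
    listSum (episodeGapBound M φ c) hs ^ 2 ≤
      8 * c.betaHat d H hs.length ^ 2 * H * d * Real.log (1 + hs.length / c.lam) *
        listSum (episodeStdSq M φ c) hs := by
  have hβK := hβ hs.length (List.length_pos_of_ne_nil hne)
  have h1 : listSum (episodeGapBound M φ c) hs ≤ 2 * c.betaHat d H hs.length *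
      listSum (fun l τ => ∑ h, stdV M φ c h l (stateAction h τ) * truncHat M φ c h l τ) hs := by
    rw [← listSum_const_mul]
    refine listSum_mono_of_suffix fun τ l hl => ?_
    rw [episodeGapBound, Finset.mul_sum]
    exact Finset.sum_le_sum fun h _ => gapBound_le hH hd hlam hδ hδ1 hB h
      (by simpa using hl.length_le) τ
  have h0 : 0 ≤ listSum (episodeGapBound M φ c) hs :=
    listSum_nonneg (fun l τ => (episodeGapBound_mem_Icc hβ l τ).1) hs
  have h2 := listSum_mul_sq_le Finset.univ
    (fun h l (τ : Trajectory S A H) => stdV M φ c h l (stateAction h τ)) (truncHat M φ c) hs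
  have h3 := listSum_sq_truncHat_le (M := M) hφ hH hd hlam hs
  have h4 : 0 ≤ listSum (episodeStdSq M φ c) hs :=
    listSum_nonneg (fun l τ => Finset.sum_nonneg fun h _ => sq_nonneg _) hs
  change _ ≤ listSum (episodeStdSq M φ c) hs * _ at h2
  calc _ ≤ (2 * c.betaHat d H hs.length * listSum (fun l τ => ∑ h,
          stdV M φ c h l (stateAction h τ) * truncHat M φ c h l τ) hs) ^ 2 :=
        pow_le_pow_left₀ h0 h1 2
    _ = 4 * c.betaHat d H hs.length ^ 2 * listSum (fun l τ => ∑ h,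
          stdV M φ c h l (stateAction h τ) * truncHat M φ c h l τ) hs ^ 2 := by ring
    _ ≤ 4 * c.betaHat d H hs.length ^ 2 * (listSum (episodeStdSq M φ c) hs *
          (2 * H * d * Real.log (1 + hs.length / c.lam))) := by
        refine mul_le_mul_of_nonneg_left (h2.trans ?_) (by positivity)
        exact mul_le_mul_of_nonneg_left h3 h4
    _ = _ := by ring

theorem listSum_episodeBonus_le (hs : History S A H) (hne : hs ≠ []) :
    listSum (episodeBonus M φ c) hs ≤
      c.betaTilde d H hs.length * Real.sqrt (hs.length * H *
          (2 * H * d * Real.log (1 + hs.length * (H : ℝ) ^ 4 / (d * c.lam))))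
      + 4 * (H : ℝ) ^ 2 * c.betaBar d H hs.length * Real.sqrt (hs.length * H *
          (2 * H * d * Real.log (1 + hs.length / c.lam))) := by
  have hK := List.length_pos_of_ne_nil hne
  have h1 : listSum (episodeBonus M φ c) hs ≤
      c.betaTilde d H hs.length * listSum (fun l τ => ∑ h, truncTilde M φ c h l τ) hs
        + 4 * (H : ℝ) ^ 2 * c.betaBar d H hs.length *
          listSum (fun l τ => ∑ h, truncHat M φ c h l τ) hs := by
    rw [← listSum_const_mul, ← listSum_const_mul, ← listSum_add]
    refine listSum_mono_of_suffix fun τ l hl => ?_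
    rw [episodeBonus, Finset.mul_sum, Finset.mul_sum, ← Finset.sum_add_distrib]
    exact Finset.sum_le_sum fun h _ => bonus_le hH hd hlam hδ hδ1 hB h
      (by simpa using hl.length_le) τ
  have h4 := (Real.sqrt_nonneg d).trans (sqrt_le_betaBar (d := d) hH hlam hδ hδ1 hB hK)
  have h4' := (sq_nonneg (H : ℝ)).trans (sq_le_betaTilde (d := d) hH hlam hδ hδ1 hB hK)
  refine h1.trans (add_le_add ?_ ?_)
  · exact mul_le_mul_of_nonneg_left
      (listSum_le_sqrt _ (listSum_sq_truncTilde_le (M := M) hφ hH hd hlam hs)) h4'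
  · exact mul_le_mul_of_nonneg_left
      (listSum_le_sqrt _ (listSum_sq_truncHat_le (M := M) hφ hH hd hlam hs)) (by positivity)

end Pathwise

/-- On the confidence sets of the variance estimate, the estimate exceeds the true variance by at
most twice the bonus. -/
theorem listSum_episodeStdSq_le
    (hφ : ∀ V : S → ℝ, (∀ s, V s ∈ Set.Icc (0 : ℝ) 1) → ∀ s a, ‖featureOf φ V s a‖ ≤ 1)
    (hlam : 0 < c.lam) {θ : Fin H → EuclideanSpace ℝ (Fin d)}
    (hθB : ∀ h, ‖θ h‖ ≤ c.B)
    (hθ : ∀ h s a s', (M.trans h s a s').toReal = inner ℝ (φ s a s') (θ h))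
    {hs : History S A H}
    (hc : ∀ h l, l <:+ hs → TildeConfident M φ c h l ∧ BarConfident M φ c h l) :
    listSum (episodeStdSq M φ c) hs ≤ hs.length * H * ((H : ℝ) ^ 2 / d)
      + listSum (episodeVariance M φ c) hs + 2 * listSum (episodeBonus M φ c) hs := by
  have h1 : (hs.length : ℝ) * H * ((H : ℝ) ^ 2 / d) =
      listSum (fun (_ : History S A H) (_ : Trajectory S A H) => ∑ _h : Fin H,
        (H : ℝ) ^ 2 / d) hs := by
    rw [listSum_const]
    simp [mul_assoc]
  rw [h1, ← listSum_const_mul, ← listSum_add, ← listSum_add]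
  refine listSum_mono_of_suffix fun τ l hl => ?_
  rw [episodeStdSq, episodeVariance, episodeBonus, Finset.mul_sum, ← Finset.sum_add_distrib,
    ← Finset.sum_add_distrib]
  refine Finset.sum_le_sum fun h _ => ?_
  obtain ⟨ht, hb⟩ := hc h l ((List.suffix_cons τ l).trans hl)
  have h2 := abs_le.mp (abs_estVar_sub_variance_le hφ hθB hθ hlam ht hb (stateAction h τ))
  have h3 := (variance_optV_mem_Icc (M := M) (φ := φ) (c := c) h l (stateAction h τ)).1
  have h4 : (0 : ℝ) ≤ (H : ℝ) ^ 2 / d := by positivity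
  rw [sq_stdV]
  change _ ≤ (H : ℝ) ^ 2 / d + (M.trans h (stateAction h τ).1 (stateAction h τ).2).variance
    (optV M φ c l h.succ) + 2 * (powerState φ c M.reward l).bonus φ c (l.length + 1) h
      (optV M φ c l h.succ) (stateAction h τ).1 (stateAction h τ).2
  exact max_le (by linarith [h2.1, h2.2]) (by linarith [h2.1, h2.2])

end PowerMDP

/-! ### The regret bound for a fixed learning rate -/

namespace PowerMDP

open Matrix ListProcess

/-- The quantity `√(d²H²T) + √(dH³T) + d²H³ + d^{5/2}H^{5/2}` with `T = KH`, in terms of `D = √d`,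
`h = √H` and `k = √K`. -/
def rateSum (D h k : ℝ) : ℝ := D ^ 2 * h ^ 3 * k + D * h ^ 4 * k + D ^ 4 * h ^ 6 + D ^ 5 * h ^ 5

theorem le_of_sq_le_mul_add {X U m : ℝ} (hX : 0 ≤ X) (hU : 0 ≤ U) (hm : 1 ≤ m)
    (h : X ^ 2 ≤ m * (U ^ 2 + U * X)) : X ≤ 2 * m * U := by
  by_contra hcon
  push Not at hcon
  have hXpos : 0 < X := lt_of_le_of_lt (by positivity) hcon
  have h1 : 2 * (m * (U * X)) ≤ X ^ 2 := by nlinarith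
  have h2 : 2 * U ≤ X := by nlinarith
  have h3 : 2 * (m * U ^ 2) ≤ m * (U * X) := by
    have := mul_le_mul_of_nonneg_left h2 (by positivity : 0 ≤ m * U)
    nlinarith
  nlinarith

/-- The system of inequalities between the sum `X` of the gap bounds, its mean `Y`, the sum `V` of
the variances, its mean `N`, the sum `G` of the bonuses, and the sum `Q` of the squares of the
estimated standard deviations: eliminating all but `X` gives a quadratic inequality for `X`. -/
theorem sq_gap_sum_le {D h k J X Y V N G Q : ℝ} (hD : 1 ≤ D) (hh : 1 ≤ h) (hk : 0 ≤ k) (hJ : 1 ≤ J)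
    (hX0 : 0 ≤ X) (hX : X ^ 2 ≤ 1352 * J ^ 3 * D ^ 4 * h ^ 2 * Q)
    (hQ : Q ≤ k ^ 2 * h ^ 2 * (h ^ 4 / D ^ 2) + V + 2 * G)
    (hG : G ≤ 100 * J ^ 2 * h ^ 6 * D ^ 3 * k)
    (hV : V ≤ 2 * N + h ^ 6 * J) (hN : N ≤ k ^ 2 * (2 * h ^ 4) + 2 * h ^ 2 * Y)
    (hY : Y ≤ 2 * X + 4 * h ^ 4 * J) :
    X ^ 2 ≤ 300144 * J ^ 5 * (rateSum D h k ^ 2 + rateSum D h k * X) := by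
  have hD0 : 0 < D := by linarith
  have hh0 : 0 < h := by linarith
  have hJ0 : 0 < J := by linarith
  have hQX : Q ≤ k ^ 2 * h ^ 2 * (h ^ 4 / D ^ 2) + (4 * k ^ 2 * h ^ 4 + 8 * h ^ 2 * X
      + 17 * h ^ 6 * J) + 200 * J ^ 2 * h ^ 6 * D ^ 3 * k := by
    have h1 : 4 * h ^ 2 * Y ≤ 4 * h ^ 2 * (2 * X + 4 * h ^ 4 * J) :=
      mul_le_mul_of_nonneg_left hY (by positivity)
    have h2 : 4 * h ^ 2 * (2 * X + 4 * h ^ 4 * J) = 8 * h ^ 2 * X + 16 * (h ^ 6 * J) := by ring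
    linarith
  have e1 : D ^ 4 * h ^ 2 * (k ^ 2 * h ^ 2 * (h ^ 4 / D ^ 2)) = (D * h ^ 4 * k) ^ 2 := by
    field_simp
  have q3 : D ^ 4 * h ^ 4 ≤ D ^ 4 * h ^ 6 :=
    mul_le_mul_of_nonneg_left (pow_le_pow_right₀ hh (by norm_num)) (by positivity)
  have q3' : D ^ 4 * h ^ 8 ≤ (D ^ 4 * h ^ 6) ^ 2 := by
    rw [show (D ^ 4 * h ^ 6) ^ 2 = D ^ 8 * h ^ 12 by ring]
    exact mul_le_mul (pow_le_pow_right₀ hD (by norm_num)) (pow_le_pow_right₀ hh (by norm_num))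
      (by positivity) (by positivity)
  have hJ1 : 1 ≤ J ^ 2 := one_le_pow₀ hJ
  have hJ2 : J ≤ J ^ 2 := le_self_pow₀ hJ (by norm_num)
  have h1 : D ^ 4 * h ^ 2 * Q ≤ (D * h ^ 4 * k) ^ 2 + 4 * (D ^ 2 * h ^ 3 * k) ^ 2
      + 8 * (D ^ 4 * h ^ 4 * X) + 17 * (D ^ 4 * h ^ 8 * J)
      + J ^ 2 * (200 * ((D ^ 2 * h ^ 3 * k) * (D ^ 5 * h ^ 5))) := by
    refine (mul_le_mul_of_nonneg_left hQX (by positivity)).trans (le_of_eq ?_)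
    rw [mul_add, mul_add, e1]
    ring
  have h2 : D ^ 4 * h ^ 4 * X ≤ D ^ 4 * h ^ 6 * X := mul_le_mul_of_nonneg_right q3 hX0
  have h3 : D ^ 4 * h ^ 8 * J ≤ (D ^ 4 * h ^ 6) ^ 2 * J ^ 2 :=
    mul_le_mul q3' hJ2 hJ0.le (sq_nonneg _)
  have p1 : 0 ≤ D ^ 2 * h ^ 3 * k := by positivity
  have p2 : 0 ≤ D * h ^ 4 * k := by positivity
  have p3 : 0 ≤ D ^ 4 * h ^ 6 := by positivity
  have p4 : 0 ≤ D ^ 5 * h ^ 5 := by positivity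
  have key : D ^ 4 * h ^ 2 * Q ≤
      J ^ 2 * (222 * (rateSum D h k ^ 2 + rateSum D h k * X)) := by
    rw [rateSum]
    generalize D ^ 2 * h ^ 3 * k = u1 at *
    generalize D * h ^ 4 * k = u2 at *
    generalize D ^ 4 * h ^ 6 = u3 at *
    generalize D ^ 5 * h ^ 5 = u4 at *
    obtain ⟨U, hU⟩ : ∃ U, U = u1 + u2 + u3 + u4 := ⟨_, rfl⟩
    rw [← hU]
    have s1 : u1 ^ 2 ≤ U ^ 2 := pow_le_pow_left₀ p1 (by linarith) 2
    have s2 : u2 ^ 2 ≤ U ^ 2 := pow_le_pow_left₀ p2 (by linarith) 2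
    have s3 : u3 ^ 2 ≤ U ^ 2 := pow_le_pow_left₀ p3 (by linarith) 2
    have s14 : u1 * u4 ≤ U ^ 2 := by
      rw [sq]; exact mul_le_mul (by linarith) (by linarith) p4 (by linarith)
    have s3X : u3 * X ≤ U * X := mul_le_mul_of_nonneg_right (by linarith) hX0
    have hUX : 0 ≤ U * X := mul_nonneg (by linarith) hX0
    have h4 : u2 ^ 2 + 4 * u1 ^ 2 + 8 * (u3 * X) ≤
        J ^ 2 * (u2 ^ 2 + 4 * u1 ^ 2 + 8 * (u3 * X)) :=
      le_mul_of_one_le_left (by positivity) hJ1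
    have h5 : u2 ^ 2 + 4 * u1 ^ 2 + 8 * (u3 * X) + 17 * u3 ^ 2 + 200 * (u1 * u4) ≤
        222 * (U ^ 2 + U * X) := by linarith
    have h6 := mul_le_mul_of_nonneg_left h5 (sq_nonneg J)
    linarith
  calc X ^ 2 ≤ 1352 * J ^ 3 * (D ^ 4 * h ^ 2 * Q) := hX.trans (le_of_eq (by ring))
    _ ≤ 1352 * J ^ 3 * (J ^ 2 * (222 * (rateSum D h k ^ 2 + rateSum D h k * X))) :=
      mul_le_mul_of_nonneg_left key (by positivity)
    _ = _ := by ring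

/-- The quadratic inequality of `sq_gap_sum_le`, solved for `X` and then for `Y`. -/
theorem gap_sum_le {D h k J X Y V N G Q : ℝ} (hD : 1 ≤ D) (hh : 1 ≤ h) (hk : 0 ≤ k) (hJ : 1 ≤ J)
    (hX0 : 0 ≤ X) (hX : X ^ 2 ≤ 1352 * J ^ 3 * D ^ 4 * h ^ 2 * Q)
    (hQ : Q ≤ k ^ 2 * h ^ 2 * (h ^ 4 / D ^ 2) + V + 2 * G)
    (hG : G ≤ 100 * J ^ 2 * h ^ 6 * D ^ 3 * k)
    (hV : V ≤ 2 * N + h ^ 6 * J) (hN : N ≤ k ^ 2 * (2 * h ^ 4) + 2 * h ^ 2 * Y)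
    (hY : Y ≤ 2 * X + 4 * h ^ 4 * J) :
    Y ≤ 1200580 * J ^ 5 * rateSum D h k := by
  have hD0 : 0 < D := by linarith
  have hh0 : 0 < h := by linarith
  have hJ0 : 0 < J := by linarith
  have hJ5 : 1 ≤ J ^ 5 := one_le_pow₀ hJ
  have hU0 : 0 ≤ rateSum D h k := by rw [rateSum]; positivity
  have hXU := le_of_sq_le_mul_add hX0 hU0 (by linarith)
    (sq_gap_sum_le hD hh hk hJ hX0 hX hQ hG hV hN hY)
  have h7 : J * h ^ 4 ≤ J ^ 5 * rateSum D h k := by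
    have h8 : h ^ 4 ≤ rateSum D h k := by
      have h9 : 1 * h ^ 4 ≤ D ^ 4 * h ^ 6 := mul_le_mul (one_le_pow₀ hD)
        (pow_le_pow_right₀ hh (by norm_num)) (by positivity) (by positivity)
      have h10 : 0 ≤ D ^ 2 * h ^ 3 * k + D * h ^ 4 * k + D ^ 5 * h ^ 5 := by positivity
      rw [rateSum]; linarith
    exact mul_le_mul (le_self_pow₀ hJ (by norm_num)) h8 (by positivity) (by positivity)
  linarith

section Radii

variable {c : Params} {d H K : ℕ} {J : ℝ}

theorem betaHat_le (hd : 0 < d) (hJ : 1 ≤ J) (hℓ0 : 0 ≤ c.logTerm H K) (hℓ : c.logTerm H K ≤ J)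
    (hL : Real.log (1 + K / c.lam) ≤ J) (hB : Real.sqrt c.lam * c.B = 1) :
    c.betaHat d H K ≤ 13 * Real.sqrt d * J := by
  have hd' : (1 : ℝ) ≤ d := by exact_mod_cast hd
  have hD : 1 ≤ Real.sqrt d := Real.one_le_sqrt.mpr hd'
  have h1 : Real.sqrt (d * Real.log (1 + K / c.lam) * c.logTerm H K) ≤ Real.sqrt d * J := by
    rw [← Real.sqrt_sq (by linarith : 0 ≤ J), ← Real.sqrt_mul (by linarith), mul_assoc, sq]
    exact Real.sqrt_le_sqrt (mul_le_mul_of_nonneg_left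
      (mul_le_mul hL hℓ hℓ0 (by linarith)) (by linarith))
  have h2 := mul_le_mul_of_nonneg_left hℓ (by linarith : 0 ≤ Real.sqrt d)
  rw [Params.betaHat, hB]
  nlinarith

theorem betaBar_le (hd : 0 < d) (hJ : 1 ≤ J) (hℓ0 : 0 ≤ c.logTerm H K) (hℓ : c.logTerm H K ≤ J)
    (hL : Real.log (1 + K / c.lam) ≤ J) (hB : Real.sqrt c.lam * c.B = 1) :
    c.betaBar d H K ≤ 13 * d * J := by
  have hd' : (1 : ℝ) ≤ d := by exact_mod_cast hd
  have hD : Real.sqrt d ≤ d := by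
    rw [Real.sqrt_le_left (by linarith)]; nlinarith
  have h1 : Real.sqrt (Real.log (1 + K / c.lam) * c.logTerm H K) ≤ J := by
    rw [Real.sqrt_le_left (by linarith), sq]
    exact mul_le_mul hL hℓ hℓ0 (by linarith)
  have h2 : Real.sqrt d * c.logTerm H K ≤ d * J := mul_le_mul hD hℓ hℓ0 (by linarith)
  have h3 := mul_le_mul_of_nonneg_left h1 (by linarith : (0 : ℝ) ≤ d)
  rw [Params.betaBar, hB]
  nlinarith

theorem betaTilde_le (hd : 0 < d) (hH : 0 < H) (hJ : 1 ≤ J) (hℓ0 : 0 ≤ c.logTerm H K)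
    (hℓ : c.logTerm H K ≤ J) (hL : Real.log (1 + K * (H : ℝ) ^ 4 / (d * c.lam)) ≤ J)
    (hB : Real.sqrt c.lam * c.B = 1) :
    c.betaTilde d H K ≤ 13 * (H : ℝ) ^ 2 * Real.sqrt d * J := by
  have hd' : (1 : ℝ) ≤ d := by exact_mod_cast hd
  have hH' : (1 : ℝ) ≤ (H : ℝ) ^ 2 := one_le_pow₀ (by exact_mod_cast hH)
  have hD : 1 ≤ Real.sqrt d := Real.one_le_sqrt.mpr hd'
  have h1 : Real.sqrt (d * Real.log (1 + K * (H : ℝ) ^ 4 / (d * c.lam)) * c.logTerm H K) ≤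
      Real.sqrt d * J := by
    rw [← Real.sqrt_sq (by linarith : 0 ≤ J), ← Real.sqrt_mul (by linarith), mul_assoc, sq]
    exact Real.sqrt_le_sqrt (mul_le_mul_of_nonneg_left
      (mul_le_mul hL hℓ hℓ0 (by linarith)) (by linarith))
  have h2 : c.logTerm H K ≤ Real.sqrt d * J := by nlinarith
  have h3 : 1 ≤ Real.sqrt d * J := by nlinarith
  have h4 := mul_le_mul_of_nonneg_left h1 (by positivity : 0 ≤ (H : ℝ) ^ 2)
  have h5 := mul_le_mul_of_nonneg_left h2 (by positivity : 0 ≤ (H : ℝ) ^ 2)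
  have h6 : 1 * 1 ≤ (H : ℝ) ^ 2 * (Real.sqrt d * J) :=
    mul_le_mul hH' h3 zero_le_one (by positivity)
  rw [Params.betaTilde, hB]
  nlinarith

end Radii

/-- The total bonus, in terms of `D = √d`, `h = √H` and `k = √K`. -/
theorem bonus_sum_le {d H K : ℕ} {J bT bB L1 L2 : ℝ} (hd : 0 < d) (hJ : 1 ≤ J)
    (hbT : bT ≤ 13 * (H : ℝ) ^ 2 * Real.sqrt d * J) (hbB : bB ≤ 13 * d * J)
    (hL1 : L1 ≤ J) (hL2 : L2 ≤ J) :
    bT * Real.sqrt (K * H * (2 * H * d * L2)) +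
        4 * (H : ℝ) ^ 2 * bB * Real.sqrt (K * H * (2 * H * d * L1)) ≤
      100 * J ^ 2 * Real.sqrt H ^ 6 * Real.sqrt d ^ 3 * Real.sqrt K := by
  have hd' : (1 : ℝ) ≤ d := by exact_mod_cast hd
  set D := Real.sqrt d with hD
  set h := Real.sqrt H with hh
  set k := Real.sqrt K with hk
  have eD : (d : ℝ) = D ^ 2 := (Real.sq_sqrt (by positivity)).symm
  have eh : (H : ℝ) = h ^ 2 := (Real.sq_sqrt (by positivity)).symm
  have ek : (K : ℝ) = k ^ 2 := (Real.sq_sqrt (by positivity)).symm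
  have hD1 : 1 ≤ D := Real.one_le_sqrt.mpr hd'
  have hh0 : 0 ≤ h := Real.sqrt_nonneg _
  have hk0 : 0 ≤ k := Real.sqrt_nonneg _
  have hs : ∀ L, L ≤ J → Real.sqrt (K * H * (2 * H * d * L)) ≤ 3 / 2 * J * (k * h ^ 2 * D) := by
    intro L hL
    rw [Real.sqrt_le_left (by positivity), eD, eh, ek]
    have h1 : 2 * L ≤ (3 / 2 * J) ^ 2 := by nlinarith
    calc k ^ 2 * h ^ 2 * (2 * h ^ 2 * D ^ 2 * L) = (k * h ^ 2 * D) ^ 2 * (2 * L) := by ring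
      _ ≤ (k * h ^ 2 * D) ^ 2 * (3 / 2 * J) ^ 2 := mul_le_mul_of_nonneg_left h1 (sq_nonneg _)
      _ = _ := by ring
  have hP : 0 ≤ J ^ 2 * h ^ 6 * k * D ^ 2 := by positivity
  have t1 : bT * Real.sqrt (K * H * (2 * H * d * L2)) ≤
      13 * (H : ℝ) ^ 2 * D * J * (3 / 2 * J * (k * h ^ 2 * D)) :=
    mul_le_mul hbT (hs L2 hL2) (Real.sqrt_nonneg _) (by positivity)
  have t2 : 4 * (H : ℝ) ^ 2 * bB * Real.sqrt (K * H * (2 * H * d * L1)) ≤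
      4 * (H : ℝ) ^ 2 * (13 * d * J) * (3 / 2 * J * (k * h ^ 2 * D)) :=
    mul_le_mul (mul_le_mul_of_nonneg_left hbB (by positivity)) (hs L1 hL1)
      (Real.sqrt_nonneg _) (by positivity)
  have e1 : 13 * (H : ℝ) ^ 2 * D * J * (3 / 2 * J * (k * h ^ 2 * D)) =
      39 / 2 * (J ^ 2 * h ^ 6 * k * D ^ 2) := by rw [eh]; ring
  have e2 : 4 * (H : ℝ) ^ 2 * (13 * d * J) * (3 / 2 * J * (k * h ^ 2 * D)) =
      78 * (J ^ 2 * h ^ 6 * k * D ^ 2) * D := by rw [eh, eD]; ring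
  have e3 : 100 * J ^ 2 * h ^ 6 * D ^ 3 * k = 100 * (J ^ 2 * h ^ 6 * k * D ^ 2) * D := by ring
  rw [e3]
  have h2 := mul_le_mul_of_nonneg_left hD1 hP
  linarith

variable {S : Type u} {A : Type v} {H d : ℕ}
variable [Fintype A] [Nonempty A] {M : AdversarialMDP S A H}
  {φ : S → A → S → EuclideanSpace ℝ (Fin d)} {c : Params}

theorem half_le_log_two : (1 / 2 : ℝ) ≤ Real.log 2 := by
  linarith [Real.log_two_gt_d9]

/-- The regret bound of POWER for a given learning rate, with high probability. -/
theorem prob_regret_le (hM : IsLinearMixture M φ c.B) (hH : 0 < H) {K : ℕ} (hK : 0 < K)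
    (hlam : c.lam = 1 / c.B ^ 2) (hδ : 0 < c.δ) (hδ1 : c.δ < 1)
    (hα : 0 < c.α ∨ (c.α = 0 ∧ Fintype.card A = 1)) :
    1 ≤ 2 * logFactor K H c.B c.δ ∧
    ENNReal.ofReal (1 - 6 * c.δ) ≤
      (M.historyLaw (power φ c M.reward) K).toOuterMeasure
        {hs | M.regret (power φ c M.reward) hs ≤
          H * (c.α⁻¹ * Real.log (Fintype.card A) + K * (c.α * (H : ℝ) ^ 2 / 8)) +
            1200580 * (2 * logFactor K H c.B c.δ) ^ 5 *
              rateSum (Real.sqrt d) (Real.sqrt H) (Real.sqrt K)} := by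
  have hB1 := hM.one_le hH
  have hd := hM.dim_pos hH
  obtain ⟨⟨θ, hθB, hθ⟩, hφ⟩ := hM
  have hB0 : 0 < c.B := by linarith
  have hlam0 : 0 < c.lam := by rw [hlam]; positivity
  have hH' : (1 : ℝ) ≤ H := by exact_mod_cast hH
  have hK' : (1 : ℝ) ≤ K := by exact_mod_cast hK
  have hd' : (1 : ℝ) ≤ d := by exact_mod_cast hd
  have hlamB : Real.sqrt c.lam * c.B = 1 := by
    rw [hlam, Real.sqrt_div zero_le_one, Real.sqrt_one, Real.sqrt_sq hB0.le]
    field_simp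
  set L := Real.log (1 + K * (H : ℝ) ^ 4 * c.B ^ 2) with hL
  have hH4 : (1 : ℝ) ≤ (H : ℝ) ^ 4 := one_le_pow₀ hH'
  have hB2 : (1 : ℝ) ≤ c.B ^ 2 := one_le_pow₀ hB1
  have hLhalf : 1 / 2 ≤ L := by
    refine half_le_log_two.trans (Real.log_le_log (by norm_num) ?_)
    have h1 : 1 ≤ K * (H : ℝ) ^ 4 := one_le_mul_of_one_le_of_one_le hK' hH4
    have h2 : 1 ≤ K * (H : ℝ) ^ 4 * c.B ^ 2 := one_le_mul_of_one_le_of_one_le h1 hB2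
    linarith
  have hℓ1 := Params.one_le_logTerm hδ hδ1.le hH hK
  set J := 2 * logFactor K H c.B c.δ with hJdef
  have hJe : J = 2 * (c.logTerm H K * L) := rfl
  have hℓJ : c.logTerm H K ≤ J := by rw [hJe]; nlinarith
  have hLJ : L ≤ J := by rw [hJe]; nlinarith
  have hJ : 1 ≤ J := hℓ1.trans hℓJ
  have hL1 : Real.log (1 + K / c.lam) ≤ J := by
    refine le_trans (Real.log_le_log (by positivity) ?_) hLJ
    rw [hlam, div_div_eq_mul_div, div_one]
    have : (K : ℝ) * c.B ^ 2 * 1 ≤ K * c.B ^ 2 * (H : ℝ) ^ 4 :=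
      mul_le_mul_of_nonneg_left hH4 (by positivity)
    linarith
  have hL2 : Real.log (1 + K * (H : ℝ) ^ 4 / (d * c.lam)) ≤ J := by
    refine le_trans (Real.log_le_log (by positivity) ?_) hLJ
    have h1 : K * (H : ℝ) ^ 4 / (d * c.lam) = K * (H : ℝ) ^ 4 * c.B ^ 2 / d := by
      rw [hlam]; field_simp
    rw [h1]
    have : K * (H : ℝ) ^ 4 * c.B ^ 2 / d ≤ K * (H : ℝ) ^ 4 * c.B ^ 2 :=
      div_le_self (by positivity) hd'
    linarith
  have hlogδ : Real.log (1 / c.δ) ≤ J := by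
    refine le_trans (Real.log_le_log (by positivity) ?_) hℓJ
    refine div_le_div_of_nonneg_right ?_ hδ.le
    have h1 : 1 ≤ (K : ℝ) ^ 2 * H := one_le_mul_of_one_le_of_one_le (one_le_pow₀ hK') hH'
    linarith
  have hβ : ∀ k, 0 < k → 0 ≤ c.betaHat d H k := fun k hk =>
    (Real.sqrt_nonneg _).trans (sqrt_le_betaHat hH hlam0 hδ hδ1.le hB0.le hk)
  refine ⟨hJ, ?_⟩
  set P := M.historyLaw (power φ c M.reward) K with hP
  have hexp : ENNReal.ofReal (Real.exp (-Real.log (1 / c.δ))) = ENNReal.ofReal c.δ := by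
    rw [← Real.log_inv, Real.exp_log (by positivity), one_div, inv_inv]
  let m : History S A H → ℝ := fun l =>
    (M.episodeLaw (power φ c M.reward l)).expect (episodeVariance M φ c l)
  -- the failure of the confidence sets, and the two comparisons of sums with conditional means
  let bad1 : Set (History S A H) := {hs | ¬∀ h, ∀ l, l <:+ hs →
    TildeConfident M φ c h l ∧ BarConfident M φ c h l ∧ HatConfident M φ c h l}
  let bad2 : Set (History S A H) := {hs | 2 * listSum (episodeGapBound M φ c) hs
    + 4 * (H : ℝ) ^ 2 * Real.log (1 / c.δ) ≤ listSum (fun l _ => meanGapBound M φ c l) hs}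
  let bad3 : Set (History S A H) := {hs | 2 * listSum (fun l _ => m l) hs
    + (H : ℝ) ^ 3 * Real.log (1 / c.δ) ≤ listSum (episodeVariance M φ c) hs}
  have hbad1 : P.toOuterMeasure bad1 ≤ ENNReal.ofReal (3 * c.δ) :=
    prob_not_confident_le hφ hH hd hlam0 hδ hδ1.le hθB hθ K
  have hbad2 : P.toOuterMeasure bad2 ≤ ENNReal.ofReal c.δ := by
    rw [hP, M.historyLaw_eq_listLaw, ← hexp]
    exact prob_listSum_mean_le (by positivity) (fun l τ => episodeGapBound_mem_Icc hβ l τ)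
      (fun l => le_rfl) K _
  have hbad3 : P.toOuterMeasure bad3 ≤ ENNReal.ofReal c.δ := by
    rw [hP, M.historyLaw_eq_listLaw, ← hexp]
    exact prob_listSum_le_mean (by positivity) (fun l τ => episodeVariance_mem_Icc l τ)
      (fun l => le_rfl) K _
  set good : Set (History S A H) := {hs | M.regret (power φ c M.reward) hs ≤
          H * (c.α⁻¹ * Real.log (Fintype.card A) + K * (c.α * (H : ℝ) ^ 2 / 8)) +
            1200580 * J ^ 5 * rateSum (Real.sqrt d) (Real.sqrt H) (Real.sqrt K)} with hgood
  -- outside of the exceptional events, the regret bound holds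
  have hcover : P.support ⊆ good ∪ (bad1 ∪ bad2 ∪ bad3) := by
    intro hs hsup
    have hlen : hs.length = K := by
      rw [hP, M.historyLaw_eq_listLaw] at hsup
      exact length_of_mem_support_listLaw hsup
    have hne : hs ≠ [] := by rintro rfl; simp at hlen; omega
    by_contra hcon
    simp only [Set.mem_union, not_or] at hcon
    obtain ⟨hng, ⟨hn1, hn2⟩, hn3⟩ := hcon
    simp only [bad1, bad2, bad3, Set.mem_ofPred_eq, not_not, not_le] at hn1 hn2 hn3
    refine hng ?_
    have hX0 : 0 ≤ listSum (episodeGapBound M φ c) hs :=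
      listSum_nonneg (fun l τ => (episodeGapBound_mem_Icc hβ l τ).1) hs
    have hX := sq_listSum_episodeGapBound_le (M := M) hH hd hlam0 hδ hδ1.le hB0.le hφ hs hne hβ
    have hG := listSum_episodeBonus_le (M := M) hH hd hlam0 hδ hδ1.le hB0.le hφ hs hne
    have hQ := listSum_episodeStdSq_le hφ hlam0 hθB hθ
      (fun h l hl => ⟨(hn1 h l hl).1, (hn1 h l hl).2.1⟩)
    have hN : listSum (fun l _ => m l) hs ≤ K * (2 * (H : ℝ) ^ 2) +
        2 * H * listSum (fun l _ => meanGapBound M φ c l) hs := by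
      rw [← hlen, ← listSum_const, ← listSum_const_mul, ← listSum_add]
      exact listSum_mono_of_suffix fun τ l hl => expect_episodeVariance_le hβ hφ hθB hθ hlam0
        fun h => (hn1 h l ((List.suffix_cons τ l).trans hl)).2.2
    rw [hlen] at hX hG hQ
    have hQ0 : 0 ≤ listSum (episodeStdSq M φ c) hs :=
      listSum_nonneg (fun l τ => Finset.sum_nonneg fun h _ => sq_nonneg _) hs
    have hℓ0 : 0 ≤ c.logTerm H K := zero_le_one.trans hℓ1
    have eD : Real.sqrt d ^ 2 = (d : ℝ) := Real.sq_sqrt (by positivity)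
    have eh : Real.sqrt H ^ 2 = (H : ℝ) := Real.sq_sqrt (by positivity)
    have ek : Real.sqrt K ^ 2 = (K : ℝ) := Real.sq_sqrt (by positivity)
    have eh4 : Real.sqrt H ^ 4 = (H : ℝ) ^ 2 := by
      rw [show Real.sqrt H ^ 4 = (Real.sqrt H ^ 2) ^ 2 by ring, eh]
    have eh6 : Real.sqrt H ^ 6 = (H : ℝ) ^ 3 := by
      rw [show Real.sqrt H ^ 6 = (Real.sqrt H ^ 2) ^ 3 by ring, eh]
    have eD4 : Real.sqrt d ^ 4 = (d : ℝ) ^ 2 := by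
      rw [show Real.sqrt d ^ 4 = (Real.sqrt d ^ 2) ^ 2 by ring, eD]
    have hY := gap_sum_le (D := Real.sqrt d) (h := Real.sqrt H) (k := Real.sqrt K) (J := J)
      (X := listSum (episodeGapBound M φ c) hs)
      (Y := listSum (fun l _ => meanGapBound M φ c l) hs)
      (V := listSum (episodeVariance M φ c) hs) (N := listSum (fun l _ => m l) hs)
      (G := listSum (episodeBonus M φ c) hs) (Q := listSum (episodeStdSq M φ c) hs)
      (Real.one_le_sqrt.mpr hd') (Real.one_le_sqrt.mpr hH') (Real.sqrt_nonneg _) hJ hX0 ?_ ?_ ?_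
      ?_ ?_ ?_
    · have hreg : ∀ π, M.regretAgainst (power φ c M.reward) π hs ≤
          H * (c.α⁻¹ * Real.log (Fintype.card A) + K * (c.α * (H : ℝ) ^ 2 / 8)) +
            listSum (fun l _ => meanGapBound M φ c l) hs :=
        regretAgainst_le hβ hφ hθB hθ hlam0 (fun h s a => by
          rw [← hlen]; exact listSum_advantage_le hα hs h s a)
          (fun h l hl => (hn1 h l hl).2.2)
      have : Nonempty (Policy S A H) := ⟨power φ c M.reward hs⟩
      exact ciSup_le fun π => (hreg π).trans (add_le_add le_rfl hY)
    · refine hX.trans ?_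
      have hb := betaHat_le hd hJ hℓ0 hℓJ hL1 hlamB
      rw [eD4, eh]
      have h1 : c.betaHat d H K ^ 2 ≤ 169 * d * J ^ 2 := by
        refine (pow_le_pow_left₀ (hβ K hK) hb 2).trans (le_of_eq ?_)
        rw [mul_pow, mul_pow, eD]; norm_num
      have h2 : 8 * c.betaHat d H K ^ 2 * H * d * Real.log (1 + K / c.lam) ≤
          8 * (169 * d * J ^ 2) * H * d * J := by
        have h3 : 0 ≤ Real.log (1 + K / c.lam) :=
          Real.log_nonneg (by have : 0 ≤ (K : ℝ) / c.lam := by positivity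
                              linarith)
        gcongr
      refine (mul_le_mul_of_nonneg_right h2 hQ0).trans (le_of_eq (by ring))
    · rw [eD, eh, eh4, ek]; exact hQ
    · exact hG.trans (bonus_sum_le hd hJ (betaTilde_le hd hH hJ hℓ0 hℓJ hL2 hlamB)
        (betaBar_le hd hJ hℓ0 hℓJ hL1 hlamB) hL1 hL2)
    · rw [eh6]
      have := mul_le_mul_of_nonneg_left hlogδ (by positivity : 0 ≤ (H : ℝ) ^ 3)
      linarith
    · rw [eh4, eh, ek]; exact hN
    · rw [eh4]
      have := mul_le_mul_of_nonneg_left hlogδ (by positivity : 0 ≤ 4 * (H : ℝ) ^ 2)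
      linarith
  have h1 : 1 ≤ P.toOuterMeasure good + ENNReal.ofReal (6 * c.δ) := by
    rw [← (PMF.toOuterMeasure_apply_eq_one_iff P _).mpr hcover]
    refine (MeasureTheory.measure_union_le _ _).trans (add_le_add le_rfl ?_)
    refine (MeasureTheory.measure_union_le _ _).trans ((add_le_add
      ((MeasureTheory.measure_union_le _ _).trans (add_le_add hbad1 hbad2)) hbad3).trans ?_)
    rw [← ENNReal.ofReal_add (by positivity) hδ.le, ← ENNReal.ofReal_add (by positivity) hδ.le]
    exact ENNReal.ofReal_le_ofReal (by linarith)
  rw [ENNReal.ofReal_sub _ (by positivity), ENNReal.ofReal_one]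
  exact tsub_le_iff_right.mpr h1

theorem rateSum_eq (d H K : ℕ) {T : ℝ} (hT : T = (K : ℝ) * H) :
    rateSum (Real.sqrt d) (Real.sqrt H) (Real.sqrt K) =
      Real.sqrt ((d : ℝ) ^ 2 * (H : ℝ) ^ 2 * T) + Real.sqrt ((d : ℝ) * (H : ℝ) ^ 3 * T)
        + (d : ℝ) ^ 2 * (H : ℝ) ^ 3 + (d : ℝ) ^ (5 / 2 : ℝ) * (H : ℝ) ^ (5 / 2 : ℝ) := by
  have eD : (d : ℝ) = Real.sqrt d ^ 2 := (Real.sq_sqrt (by positivity)).symm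
  have eh : (H : ℝ) = Real.sqrt H ^ 2 := (Real.sq_sqrt (by positivity)).symm
  have ek : (K : ℝ) = Real.sqrt K ^ 2 := (Real.sq_sqrt (by positivity)).symm
  have hpow : ∀ n : ℕ, (n : ℝ) ^ (5 / 2 : ℝ) = Real.sqrt n ^ 5 := fun n => by
    rw [Real.sqrt_eq_rpow, ← Real.rpow_natCast, ← Real.rpow_mul (by positivity)]
    norm_num
  have h1 : Real.sqrt ((d : ℝ) ^ 2 * (H : ℝ) ^ 2 * T) =
      Real.sqrt d ^ 2 * Real.sqrt H ^ 3 * Real.sqrt K := by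
    rw [← Real.sqrt_sq (by positivity : 0 ≤ Real.sqrt d ^ 2 * Real.sqrt H ^ 3 * Real.sqrt K), hT]
    congr 1
    conv_lhs => rw [eD, eh, ek]
    ring
  have h2 : Real.sqrt ((d : ℝ) * (H : ℝ) ^ 3 * T) =
      Real.sqrt d * Real.sqrt H ^ 4 * Real.sqrt K := by
    rw [← Real.sqrt_sq (by positivity : 0 ≤ Real.sqrt d * Real.sqrt H ^ 4 * Real.sqrt K), hT]
    congr 1
    conv_lhs => rw [eD, eh, ek]
    ring
  have h3 : (d : ℝ) ^ 2 * (H : ℝ) ^ 3 = Real.sqrt d ^ 4 * Real.sqrt H ^ 6 := by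
    conv_lhs => rw [eD, eh]
    ring
  rw [hpow, hpow, h1, h2, h3, rateSum]

/-- In the regime `T ≥ d³H³`, `d ≥ H`, the terms of `rateSum` are dominated by `dH√T`. -/
theorem rateSum_le {D h k : ℝ} (hD : 1 ≤ D) (hh : 1 ≤ h) (hk : 0 ≤ k) (hhD : h ≤ D)
    (hT : D ^ 3 * h ^ 2 ≤ k) : rateSum D h k ≤ 4 * (D ^ 2 * h ^ 3 * k) := by
  have h2 : D * h ^ 4 * k ≤ D ^ 2 * h ^ 3 * k := by
    calc D * h ^ 4 * k = h * (D * h ^ 3 * k) := by ring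
      _ ≤ D * (D * h ^ 3 * k) := mul_le_mul_of_nonneg_right hhD (by positivity)
      _ = _ := by ring
  have h4 : D ^ 5 * h ^ 5 ≤ D ^ 2 * h ^ 3 * k := by
    calc D ^ 5 * h ^ 5 = D ^ 2 * h ^ 3 * (D ^ 3 * h ^ 2) := by ring
      _ ≤ _ := mul_le_mul_of_nonneg_left hT (by positivity)
  have h3 : D ^ 4 * h ^ 6 ≤ D ^ 5 * h ^ 5 := by
    calc D ^ 4 * h ^ 6 = h * (D ^ 4 * h ^ 5) := by ring
      _ ≤ D * (D ^ 4 * h ^ 5) := mul_le_mul_of_nonneg_right hhD (by positivity)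
      _ = _ := by ring
  rw [rateSum]
  linarith

end PowerMDP

/-! ### The choice of the learning rate -/

namespace PowerMDP

theorem rateSum_nonneg {D h k : ℝ} (hD : 0 ≤ D) (hh : 0 ≤ h) (hk : 0 ≤ k) :
    0 ≤ rateSum D h k := by
  rw [rateSum]; positivity

/-- The regret bound of POWER in the form used for both choices of the learning rate: any `b`
above the deterministic bound is exceeded with probability at most `6δ`. -/
theorem le_probRegretLe {S : Type u} {A : Type v} [Fintype A] [Nonempty A] {H K d : ℕ}
    {M : AdversarialMDP S A H} {φ : S → A → S → EuclideanSpace ℝ (Fin d)} {B α δ T b X : ℝ}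
    (hH : 0 < H) (hK : 0 < K) (hM : IsLinearMixture M φ B) (hδ : 0 < δ) (hδ1 : δ < 1)
    (hα : 0 < α ∨ (α = 0 ∧ Fintype.card A = 1)) (hT : T = (K : ℝ) * H)
    (hX : α * T * (H : ℝ) ^ 2 + α⁻¹ * H * Real.log (Fintype.card A)
      + rateSum (Real.sqrt d) (Real.sqrt H) (Real.sqrt K) ≤ X)
    (hb : 1200580 * 32 * logFactor K H B δ ^ 5 * X ≤ b) :
    ENNReal.ofReal (1 - 6 * δ) ≤ probRegretLe M φ B α δ K b := by
  obtain ⟨hι, hprob⟩ := prob_regret_le (c := ⟨1 / B ^ 2, α, B, δ⟩) hM hH hK rfl hδ hδ1 hα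
  refine hprob.trans (MeasureTheory.measure_mono fun hs hreg => ?_)
  refine le_trans hreg (le_trans ?_ hb)
  have hα0 : 0 ≤ α := by rcases hα with h | h <;> linarith
  have hlog : 0 ≤ Real.log (Fintype.card A) :=
    Real.log_nonneg (by exact_mod_cast Fintype.card_pos)
  have hR := rateSum_nonneg (Real.sqrt_nonneg d) (Real.sqrt_nonneg H) (Real.sqrt_nonneg K)
  dsimp only at hι ⊢
  have hι5 : 1 ≤ 32 * logFactor K H B δ ^ 5 := by
    have := one_le_pow₀ hι (n := 5)
    rw [mul_pow] at this
    linarith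
  have hα1 : 0 ≤ α * T * (H : ℝ) ^ 2 := by rw [hT]; positivity
  have hα2 : 0 ≤ α⁻¹ * H * Real.log (Fintype.card A) := by positivity
  have e1 : H * (α⁻¹ * Real.log (Fintype.card A) + K * (α * (H : ℝ) ^ 2 / 8)) =
      α * T * (H : ℝ) ^ 2 / 8 + α⁻¹ * H * Real.log (Fintype.card A) := by
    rw [hT]; ring
  have e2 : 1200580 * (2 * logFactor K H B δ) ^ 5 =
      1200580 * (32 * logFactor K H B δ ^ 5) := by rw [mul_pow]; norm_num
  rw [e1, e2, mul_assoc (1200580 : ℝ) 32]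
  generalize 32 * logFactor K H B δ ^ 5 = c at *
  refine le_trans ?_ (mul_le_mul_of_nonneg_left hX (by positivity))
  have h1 : 1 * (α * T * (H : ℝ) ^ 2 + α⁻¹ * H * Real.log (Fintype.card A)) ≤
      1200580 * c * (α * T * (H : ℝ) ^ 2 + α⁻¹ * H * Real.log (Fintype.card A)) :=
    mul_le_mul_of_nonneg_right (by linarith) (by positivity)
  rw [mul_add (1200580 * c)]
  linarith

/-- For `α` of the order of `√(log |A| / (H²K))` and in the regime `T ≥ d³H³`, `d ≥ H`,
`d ≥ log |A|`, the whole regret bound is of the order of `dH√T`. -/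
theorem bound_le_of_learningRate {d H K : ℕ} {c₁ c₂ α T a : ℝ} (hd : 0 < d) (hH : 0 < H)
    (hK : 0 < K) (hc₁ : 0 < c₁) (hc : c₁ ≤ c₂) (hT : T = (K : ℝ) * H) (ha : 0 ≤ a)
    (hα0 : 0 < α ∨ a = 0)
    (hα1 : c₁ * Real.sqrt (a / ((H : ℝ) ^ 2 * K)) ≤ α)
    (hα2 : α ≤ c₂ * Real.sqrt (a / ((H : ℝ) ^ 2 * K)))
    (hdT : (d : ℝ) ^ 3 * (H : ℝ) ^ 3 ≤ T) (hHd : H ≤ d) (had : a ≤ d) :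
    α * T * (H : ℝ) ^ 2 + α⁻¹ * H * a + rateSum (Real.sqrt d) (Real.sqrt H) (Real.sqrt K) ≤
      (c₂ + 1 / c₁ + 4) * (d * H * Real.sqrt T) := by
  have hd' : (1 : ℝ) ≤ d := by exact_mod_cast hd
  have hH' : (1 : ℝ) ≤ H := by exact_mod_cast hH
  have hD1 : 1 ≤ Real.sqrt d := Real.one_le_sqrt.mpr hd'
  have hh1 : 1 ≤ Real.sqrt H := Real.one_le_sqrt.mpr hH'
  have hk0 : 0 < Real.sqrt K := Real.sqrt_pos.mpr (by exact_mod_cast hK)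
  have hq0 : 0 ≤ Real.sqrt a := Real.sqrt_nonneg _
  have hqD : Real.sqrt a ≤ Real.sqrt d := Real.sqrt_le_sqrt had
  have hhD : Real.sqrt H ≤ Real.sqrt d := Real.sqrt_le_sqrt (by exact_mod_cast hHd)
  have eD : (d : ℝ) = Real.sqrt d ^ 2 := (Real.sq_sqrt (by positivity)).symm
  have eh : (H : ℝ) = Real.sqrt H ^ 2 := (Real.sq_sqrt (by positivity)).symm
  have ek : (K : ℝ) = Real.sqrt K ^ 2 := (Real.sq_sqrt (by positivity)).symm
  have eq : a = Real.sqrt a ^ 2 := (Real.sq_sqrt ha).symm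
  have eT : Real.sqrt T = Real.sqrt K * Real.sqrt H := by rw [hT, Real.sqrt_mul (by positivity)]
  have er : Real.sqrt (a / ((H : ℝ) ^ 2 * K)) = Real.sqrt a / (H * Real.sqrt K) := by
    rw [Real.sqrt_div ha, Real.sqrt_mul (by positivity), Real.sqrt_sq (by positivity)]
  rw [er] at hα1 hα2
  rw [eT]
  generalize Real.sqrt d = D at *
  generalize Real.sqrt H = h at *
  generalize Real.sqrt K = k at *
  generalize Real.sqrt a = q at *
  rw [hT, eh, eD, ek] at hdT
  rw [eh] at hα1 hα2
  rw [hT, eh, eD, ek, eq]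
  have hDhk : D ^ 3 * h ^ 2 ≤ k := by
    refine le_of_sq_le_sq ?_ hk0.le
    refine le_of_mul_le_mul_right ?_ (by positivity : 0 < h ^ 2)
    calc (D ^ 3 * h ^ 2) ^ 2 * h ^ 2 = (D ^ 2) ^ 3 * (h ^ 2) ^ 3 := by ring
      _ ≤ _ := hdT
  have hrate := rateSum_le hD1 hh1 hk0.le hhD hDhk
  have hc₂ : 0 < c₂ := hc₁.trans_le hc
  have hqh : q * h ≤ D ^ 2 := by rw [sq]; exact mul_le_mul hqD hhD (by linarith) (by linarith)
  have hmain : q * k * h ^ 4 ≤ D ^ 2 * h ^ 3 * k := by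
    calc q * k * h ^ 4 = q * h * (h ^ 3 * k) := by ring
      _ ≤ D ^ 2 * (h ^ 3 * k) := mul_le_mul_of_nonneg_right hqh (by positivity)
      _ = _ := by ring
  have h1 : α * (k ^ 2 * h ^ 2) * (h ^ 2) ^ 2 ≤ c₂ * (D ^ 2 * h ^ 3 * k) := by
    calc α * (k ^ 2 * h ^ 2) * (h ^ 2) ^ 2 = α * (k ^ 2 * h ^ 6) := by ring
      _ ≤ c₂ * (q / (h ^ 2 * k)) * (k ^ 2 * h ^ 6) :=
        mul_le_mul_of_nonneg_right hα2 (by positivity)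
      _ = c₂ * (q * k * h ^ 4) := by field_simp
      _ ≤ _ := mul_le_mul_of_nonneg_left hmain hc₂.le
  have h2 : α⁻¹ * h ^ 2 * q ^ 2 ≤ 1 / c₁ * (D ^ 2 * h ^ 3 * k) := by
    rcases hα0 with hα0 | hq
    · have h3 : q ≤ α * (h ^ 2 * k) / c₁ := by
        rw [le_div_iff₀ hc₁]
        rw [← mul_div_assoc, div_le_iff₀ (by positivity)] at hα1
        linarith
      calc α⁻¹ * h ^ 2 * q ^ 2 = α⁻¹ * h ^ 2 * q * q := by ring
        _ ≤ α⁻¹ * h ^ 2 * q * (α * (h ^ 2 * k) / c₁) :=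
          mul_le_mul_of_nonneg_left h3 (by positivity)
        _ = 1 / c₁ * (q * k * h ^ 4) := by field_simp
        _ ≤ _ := mul_le_mul_of_nonneg_left hmain (by positivity)
    · rw [← eq, hq, mul_zero]; positivity
  have e : (c₂ + 1 / c₁ + 4) * (D ^ 2 * h ^ 2 * (k * h)) =
      c₂ * (D ^ 2 * h ^ 3 * k) + 1 / c₁ * (D ^ 2 * h ^ 3 * k) + 4 * (D ^ 2 * h ^ 3 * k) := by ring
  rw [e]
  linarith

end PowerMDP

theorem theorem1 :
    (∃ (C : ℝ) (p : ℕ), 0 < C ∧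
      ∀ (S : Type u) (A : Type v) [Fintype A] [Nonempty A] (H K d : ℕ)
        (M : PowerMDP.AdversarialMDP S A H) (φ : S → A → S → EuclideanSpace ℝ (Fin d))
        (B α δ : ℝ) (T : ℝ),
        0 < H → 0 < K → PowerMDP.IsLinearMixture M φ B → 0 < α → 0 < δ → δ < 1 →
        T = (K : ℝ) * H →
        ENNReal.ofReal (1 - 6 * δ) ≤
          PowerMDP.probRegretLe M φ B α δ K
            (C * PowerMDP.logFactor K H B δ ^ p *
              (α * T * (H : ℝ) ^ 2 + α⁻¹ * H * Real.log (Fintype.card A)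
                + Real.sqrt ((d : ℝ) ^ 2 * (H : ℝ) ^ 2 * T)
                + Real.sqrt ((d : ℝ) * (H : ℝ) ^ 3 * T)
                + (d : ℝ) ^ 2 * (H : ℝ) ^ 3
                + (d : ℝ) ^ (5 / 2 : ℝ) * (H : ℝ) ^ (5 / 2 : ℝ)))) ∧
    (∀ c₁ c₂ : ℝ, 0 < c₁ → c₁ ≤ c₂ →
      ∃ (C : ℝ) (p : ℕ), 0 < C ∧
        ∀ (S : Type u) (A : Type v) [Fintype A] [Nonempty A] (H K d : ℕ)
          (M : PowerMDP.AdversarialMDP S A H) (φ : S → A → S → EuclideanSpace ℝ (Fin d))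
          (B α δ : ℝ) (T : ℝ),
          0 < H → 0 < K → PowerMDP.IsLinearMixture M φ B → 0 < δ → δ < 1 →
          T = (K : ℝ) * H →
          c₁ * Real.sqrt (Real.log (Fintype.card A) / ((H : ℝ) ^ 2 * K)) ≤ α →
          α ≤ c₂ * Real.sqrt (Real.log (Fintype.card A) / ((H : ℝ) ^ 2 * K)) →
          (d : ℝ) ^ 3 * (H : ℝ) ^ 3 ≤ T → H ≤ d → Real.log (Fintype.card A) ≤ d →
          ENNReal.ofReal (1 - 6 * δ) ≤
            PowerMDP.probRegretLe M φ B α δ K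
              (C * PowerMDP.logFactor K H B δ ^ p * ((d : ℝ) * H * Real.sqrt T))) := by
  constructor
  · refine ⟨1200580 * 32, 5, by norm_num, ?_⟩
    intro S A _ _ H K d M φ B α δ T hH hK hM hα hδ hδ1 hT
    refine PowerMDP.le_probRegretLe hH hK hM hδ hδ1 (Or.inl hα) hT ?_ le_rfl
    rw [PowerMDP.rateSum_eq d H K hT]
    linarith
  · intro c₁ c₂ hc₁ hc
    have hc₂ : 0 < c₂ := hc₁.trans_le hc
    refine ⟨1200580 * 32 * (c₂ + 1 / c₁ + 4), 5, by positivity, ?_⟩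
    intro S A _ _ H K d M φ B α δ T hH hK hM hδ hδ1 hT hα1 hα2 hdT hHd hAd
    have hlog : 0 ≤ Real.log (Fintype.card A) :=
      Real.log_nonneg (by exact_mod_cast Fintype.card_pos)
    have hH' : (0 : ℝ) < H := by exact_mod_cast hH
    have hK' : (0 : ℝ) < K := by exact_mod_cast hK
    -- a single action is the only case in which the learning rate vanishes
    have hα : 0 < α ∨ (α = 0 ∧ Fintype.card A = 1) := by
      rcases Nat.lt_or_ge 1 (Fintype.card A) with h1 | h1
      · have h2 : 0 < Real.log (Fintype.card A) := Real.log_pos (by exact_mod_cast h1)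
        exact Or.inl (lt_of_lt_of_le (by positivity) hα1)
      · have h2 : Fintype.card A = 1 := le_antisymm h1 Fintype.card_pos
        rw [h2] at hα1 hα2
        simp only [Nat.cast_one, Real.log_one, zero_div, Real.sqrt_zero, mul_zero] at hα1 hα2
        exact Or.inr ⟨le_antisymm hα2 hα1, h2⟩
    refine PowerMDP.le_probRegretLe hH hK hM hδ hδ1 hα hT
      (PowerMDP.bound_le_of_learningRate (hM.dim_pos hH) hH hK hc₁ hc hT hlog
        (hα.imp id fun h => by rw [h.2]; simp) hα1 hα2 hdT hHd hAd) (le_of_eq (by ring))
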